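/- Let $\Omega\subset\mathbb R^2$ be a nonempty bounded open set, $f:[0,1]\times\Omega\to\mathbb R$ bounded and continuous, $\lambda,\nu>0$, $c:[0,1]^2\to\mathbb R$ lower semicontinuous, and $\mu^0$ a Borel probability measure on $[0,1]$. Let $\mathrm{TV}(u)=\sup\{\int_\Omega u\,\mathrm{div}\,\xi\,dx : \xi\in C^1_c(\Omega,\mathbb R^2),\ \|\xi\|_\infty\le 1\}$, let $C=\mathrm{BV}(\Omega,[0,1])$ be the set of measurable $u:\Omega\to[0,1]$ with $\mathrm{TV}(u)<\infty$, and for $u\in C$ let $\mu^u(A)=|\Omega|^{-1}|u^{-1}(A)|$ and $$E(u)=\int_\Omega f(u(x),x)\,dx+\lambda\,\mathrm{TV}(u)+\nu\,W(\mu^u,\mu^0),\qquad W(\mu,\mu')=\inf_{\pi\in\Pi(\mu,\mu')}\int c\,d\pi\in(-\infty,\infty],$$ where $\Pi(\mu,\mu')$ is the set of couplings of $\mu$ and $\mu'$. Let $D$ be the set of pairs $(\psi,\psi')$ of Borel functions in $L^1([0,1])$ with $\psi(\gamma_1)-\psi'(\gamma_2)\le c(\gamma_1,\gamma_2)$ for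 all $\gamma_1,\gamma_2\in[0,1]$, and $$E(u,\psi,\psi')=\int_\Omega f(u(x),x)\,dx+\lambda\,\mathrm{TV}(u)+\nu\Big(\int\psi\,d\mu^u-\int\psi'\,d\mu^0\Big).$$ Let $C''$ be the set of measurable $\phi:\Omega\times\mathbb R\to[0,1]$ of finite total variation on $\Omega\times\mathbb R$ such that (up to null sets) $\phi=1$ for $\gamma\le0$, $\phi=0$ for $\gamma\ge1$, and the distributional derivative satisfies $D_\gamma\phi\le0$, i.e. $-D_\gamma\phi$ is a nonnegative measure on $\Omega\times\mathbb R$. For $\phi\in C''$ let $\mu^\phi(A)=|\Omega|^{-1}(-D_\gamma\phi)(\Omega\times A)$ for Borel $A\subset[0,1]$, and $$E'(\phi,\psi,\psi')=\int_{\Omega\times[0,1]}f(\gamma,x)\,d(-D_\gamma\phi)(x,\gamma)+\lambda\int_0^1\mathrm{TV}(\phi(\cdot,\gamma))\,d\gamma+\nu\Big(\int\psi\,d\mu^\phi-\int\psi'\,d\mu^0\Big).$$ All energies take values in $[-\infty,\infty]$; a difference $\int\psi\,d\mu-\int\psi'\,d\mu^0$ is read as $\big(\int\psi^+d\mu+\int\psi'^-d\mu^0\big)-\big(\int\psi^-d\mu+\int\psi'^+d\mu^0\big)$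 with $\infty-\infty=-\infty$. Then $C''$ and $D$ are convex, $E'$ is convex in $\phi\in C''$ for every $(\psi,\psi')\in D$ and concave in $(\psi,\psi')\in D$ for every $\phi\in C''$, the two minima below are attained, and $$\min_{u\in C}E(u)\ \ge\ \min_{\phi\in C''}\ \sup_{(\psi,\psi')\in D}E'(\phi,\psi,\psi').$$ If moreover $$\inf_{u\in C}\sup_{(\psi,\psi')\in D}E(u,\psi,\psi')=\sup_{(\psi,\psi')\in D}\inf_{u\in C}E(u,\psi,\psi'),$$ then the relaxation is exact, i.e. the two minima are equal. -/

import Mathlib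

open MeasureTheory Set
open scoped ENNReal

noncomputable section

namespace HistogramTV

/-- The plane with its Euclidean norm. -/
abbrev Plane : Type := EuclideanSpace ℝ (Fin 2)

/-- The set of gray values `[0,1]`. -/
abbrev Gray : Type := Set.Icc (0 : ℝ) 1

/-! ### Total variation and spaces of functions of bounded variation -/

/-- Divergence of a planar vector field. -/
def divergence (X : Plane → Plane) (x : Plane) : ℝ :=
  ∑ i : Fin 2, (fderiv ℝ X x (EuclideanSpace.single i 1)) i

/-- Vector fields in `C_c^1(Ω, ℝ²)` with sup norm at most `1`. -/
def testFields (Ω : Set Plane) : Set (Plane → Plane) :=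
  {X | ContDiff ℝ 1 X ∧ HasCompactSupport X ∧ tsupport X ⊆ Ω ∧ ∀ x, ‖X x‖ ≤ 1}

/-- Total variation in `Ω`, with values in `[0,∞]`. The zero field is a test field, so the
truncation at `0` by `ENNReal.ofReal` does not change the supremum. -/
def tv (Ω : Set Plane) (u : Plane → ℝ) : ℝ≥0∞ :=
  ⨆ X ∈ testFields Ω, ENNReal.ofReal (∫ x in Ω, u x * divergence X x)

/-- `BV(Ω, [0,1])`. Only the values on `Ω` matter; for bounded `Ω` integrability is automatic. -/
def bvGray (Ω : Set Plane) : Set (Plane → Gray) :=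
  {u | AEMeasurable u (volume.restrict Ω) ∧ tv Ω (fun x => (u x : ℝ)) < ∞}

/-- The cylinder `Ω × ℝ`. -/
def cyl (Ω : Set Plane) : Set (Plane × ℝ) := Ω ×ˢ univ

/-- Divergence of a vector field on `ℝ² × ℝ`. -/
def divergence₃ (X : Plane × ℝ → Plane × ℝ) (p : Plane × ℝ) : ℝ :=
  (∑ i : Fin 2, (fderiv ℝ X p (EuclideanSpace.single i 1, 0)).1 i) + (fderiv ℝ X p (0, 1)).2

/-- Vector fields in `C_c^1(Ω × ℝ, ℝ³)` of Euclidean length at most `1`. -/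
def testFields₃ (Ω : Set Plane) : Set (Plane × ℝ → Plane × ℝ) :=
  {X | ContDiff ℝ 1 X ∧ HasCompactSupport X ∧ tsupport X ⊆ cyl Ω ∧
    ∀ p, ‖(X p).1‖ ^ 2 + (X p).2 ^ 2 ≤ 1}

/-- Total variation in `Ω × ℝ`. -/
def tv₃ (Ω : Set Plane) (φ : Plane × ℝ → ℝ) : ℝ≥0∞ :=
  ⨆ X ∈ testFields₃ Ω, ENNReal.ofReal (∫ p in cyl Ω, φ p * divergence₃ X p)

/-- The finite (nonnegative) Borel measure `m` on `Ω × ℝ` is the distribution `-D_γ φ`. -/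
def IsNegVertDeriv (Ω : Set Plane) (φ : Plane × ℝ → ℝ) (m : Measure (Plane × ℝ)) : Prop :=
  IsFiniteMeasure m ∧ m (cyl Ω)ᶜ = 0 ∧
    ∀ ζ : Plane × ℝ → ℝ, ContDiff ℝ 1 ζ → HasCompactSupport ζ → tsupport ζ ⊆ cyl Ω →
      ∫ p in cyl Ω, φ p * fderiv ℝ ζ p (0, 1) = ∫ p, ζ p ∂m

/-- The set `C''` of relaxed lifted functions: `φ` has finite total variation on `Ω × ℝ`, takes
values in `[0,1]`, equals `1` for `γ ≤ 0` and `0` for `γ ≥ 1`, and `D_γ φ ≤ 0`, that is, `-D_γ φ`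
is a nonnegative measure. As usual for BV functions, everything is up to null sets. -/
def liftSet (Ω : Set Plane) : Set (Plane × ℝ → ℝ) :=
  {φ | AEMeasurable φ (volume.restrict (cyl Ω)) ∧ tv₃ Ω φ < ∞ ∧
    (∀ᵐ p ∂(volume.restrict (cyl Ω)), φ p ∈ Icc (0 : ℝ) 1) ∧
    (∀ᵐ p ∂(volume.restrict (cyl Ω)), p.2 ≤ 0 → φ p = 1) ∧
    (∀ᵐ p ∂(volume.restrict (cyl Ω)), 1 ≤ p.2 → φ p = 0) ∧
    ∃ m, IsNegVertDeriv Ω φ m}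

open Classical in
/-- The measure `-D_γ φ` on `Ω × ℝ` (it is unique if it exists). -/
def negVertDeriv (Ω : Set Plane) (φ : Plane × ℝ → ℝ) : Measure (Plane × ℝ) :=
  if h : ∃ m, IsNegVertDeriv Ω φ m then h.choose else 0

/-- The measure `-D_γ φ` restricted to `Ω × [0,1]`. -/
def grayDeriv (Ω : Set Plane) (φ : Plane × ℝ → ℝ) : Measure (Plane × Gray) :=
  (negVertDeriv Ω φ).comap (Prod.map id Subtype.val)

/-! ### Histograms -/

/-- `μ^u`: the normalized push-forward of Lebesgue measure on `Ω`. -/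
def hist (Ω : Set Plane) (u : Plane → Gray) : Measure Gray :=
  (volume Ω)⁻¹ • (volume.restrict Ω).map u

/-- `μ^φ(A) = |Ω|⁻¹ (-D_γ φ)(Ω × A)`. -/
def liftHist (Ω : Set Plane) (φ : Plane × ℝ → ℝ) : Measure Gray :=
  (volume Ω)⁻¹ • (grayDeriv Ω φ).map Prod.snd

/-! ### The transport cost and its dual -/

/-- Transport plans with marginals `μ` and `μ'`. -/
def plans (μ μ' : Measure Gray) : Set (Measure (Gray × Gray)) :=
  {π | IsProbabilityMeasure π ∧ π.map Prod.fst = μ ∧ π.map Prod.snd = μ'}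

/-- `W(μ, μ')`. The integral of the cost (bounded below in the theorem) is extended valued. -/
def transportCost (c : Gray → Gray → ℝ) (μ μ' : Measure Gray) : EReal :=
  ⨅ π ∈ plans μ μ',
    (((∫⁻ p, ENNReal.ofReal (c p.1 p.2) ∂π : ℝ≥0∞) : EReal) -
      ((∫⁻ p, ENNReal.ofReal (-c p.1 p.2) ∂π : ℝ≥0∞) : EReal))

/-- The set `D` of pairs `(ψ, ψ')` of (Borel) functions in `L¹([0,1])` with
`ψ(γ₁) - ψ'(γ₂) ≤ c(γ₁, γ₂)` everywhere. -/
def dualSet (c : Gray → Gray → ℝ) : Set ((Gray → ℝ) × (Gray → ℝ)) :=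
  {p | Measurable p.1 ∧ Measurable p.2 ∧ Integrable p.1 volume ∧ Integrable p.2 volume ∧
    ∀ γ₁ γ₂, p.1 γ₁ - p.2 γ₂ ≤ c γ₁ γ₂}

/-- `∫ ψ dμ - ∫ ψ' dμ'`, computed as the total positive part minus the total negative part, with
values in `[-∞, ∞]`. It is the difference of the two integrals if both functions are integrable,
and `-∞` in the undefined case `∞ - ∞`. -/
def dualValue (μ μ' : Measure Gray) (p : (Gray → ℝ) × (Gray → ℝ)) : EReal :=
  (((∫⁻ γ, ENNReal.ofReal (p.1 γ) ∂μ) + ∫⁻ γ, ENNReal.ofReal (-p.2 γ) ∂μ' : ℝ≥0∞) : EReal) -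
    (((∫⁻ γ, ENNReal.ofReal (-p.1 γ) ∂μ) + ∫⁻ γ, ENNReal.ofReal (p.2 γ) ∂μ' : ℝ≥0∞) : EReal)

/-! ### The energies -/

/-- `E(u) = ∫_Ω f(u(x),x) dx + lam TV(u) + ν W(μ^u, μ⁰)`. -/
def energy (Ω : Set Plane) (f : Gray → Plane → ℝ) (lam ν : ℝ) (c : Gray → Gray → ℝ)
    (μ₀ : Measure Gray) (u : Plane → Gray) : EReal :=
  ((∫ x in Ω, f (u x) x : ℝ) : EReal) + (lam : EReal) * (tv Ω (fun x => (u x : ℝ)) : EReal) +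
    (ν : EReal) * transportCost c (hist Ω u) μ₀

/-- `E(u,ψ,ψ')`. -/
def energyDual (Ω : Set Plane) (f : Gray → Plane → ℝ) (lam ν : ℝ) (μ₀ : Measure Gray)
    (u : Plane → Gray) (p : (Gray → ℝ) × (Gray → ℝ)) : EReal :=
  ((∫ x in Ω, f (u x) x : ℝ) : EReal) + (lam : EReal) * (tv Ω (fun x => (u x : ℝ)) : EReal) +
    (ν : EReal) * dualValue (hist Ω u) μ₀ p

/-- `E'(φ,ψ,ψ')`. -/
def liftEnergy (Ω : Set Plane) (f : Gray → Plane → ℝ) (lam ν : ℝ) (μ₀ : Measure Gray)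
    (φ : Plane × ℝ → ℝ) (p : (Gray → ℝ) × (Gray → ℝ)) : EReal :=
  ((∫ q, f q.2 q.1 ∂(grayDeriv Ω φ) : ℝ) : EReal) +
    (lam : EReal) *
      ((∫⁻ γ in Icc (0 : ℝ) 1, tv Ω (fun x => φ (x, γ)) : ℝ≥0∞) : EReal) +
    (ν : EReal) * dualValue (liftHist Ω φ) μ₀ p

/-- `sup_{(ψ,ψ') ∈ D} E'(φ,ψ,ψ')`, the objective of the relaxed problem. -/
def relaxedEnergy (Ω : Set Plane) (f : Gray → Plane → ℝ) (lam ν : ℝ) (c : Gray → Gray → ℝ)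
    (μ₀ : Measure Gray) (φ : Plane × ℝ → ℝ) : EReal :=
  ⨆ p ∈ dualSet c, liftEnergy Ω f lam ν μ₀ φ p

/-! ### Convexity of extended real valued functions -/

/-- An extended real valued function is convex on the convex set `s`
(Mathlib's `∞ + (-∞) = -∞` makes the inequality the stronger one where it matters). -/
def EConvexOn {V : Type*} [AddCommGroup V] [Module ℝ V] (s : Set V) (F : V → EReal) : Prop :=
  Convex ℝ s ∧ ∀ x ∈ s, ∀ y ∈ s, ∀ a b : ℝ, 0 ≤ a → 0 ≤ b → a + b = 1 →
    F (a • x + b • y) ≤ (a : EReal) * F x + (b : EReal) * F y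

/-- An extended real valued function is concave on the convex set `s`. -/
def EConcaveOn {V : Type*} [AddCommGroup V] [Module ℝ V] (s : Set V) (F : V → EReal) : Prop :=
  Convex ℝ s ∧ ∀ x ∈ s, ∀ y ∈ s, ∀ a b : ℝ, 0 ≤ a → 0 ≤ b → a + b = 1 →
    (a : EReal) * F x + (b : EReal) * F y ≤ F (a • x + b • y)

end HistogramTV

end

open HistogramTV

noncomputable section

namespace HistogramTV

open Filter Topology

/-! ### Elementary properties of the total variation -/

lemma zero_mem_testFields (Ω : Set Plane) : (0 : Plane → Plane) ∈ testFields Ω :=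
  ⟨contDiff_const, HasCompactSupport.zero, by simp [tsupport], by simp⟩

lemma divergence_eq_sum {X : Plane → Plane} (hX : ContDiff ℝ 1 X) (x : Plane) :
    divergence X x = ∑ i : Fin 2, fderiv ℝ (fun y => X y i) x (EuclideanSpace.single i 1) := by
  refine Finset.sum_congr rfl fun i _ => ?_
  have h := (hX.differentiable one_ne_zero x).hasFDerivAt
  have h2 := ((EuclideanSpace.proj (𝕜 := ℝ) i : Plane →L[ℝ] ℝ).hasFDerivAt (x := X x)).comp x h
  have h3 : (fun y => X y i) = (EuclideanSpace.proj (𝕜 := ℝ) i : Plane →L[ℝ] ℝ) ∘ X := rfl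
  rw [h3, h2.fderiv]
  rfl

lemma divergence_comp_add (X : Plane → Plane) (h x : Plane) :
    divergence (fun y => X (y + h)) x = divergence X (x + h) := by
  simp [divergence, fderiv_comp_add_right]

lemma divergence_eq_zero_of_notMem {X : Plane → Plane} {x : Plane} (hx : x ∉ tsupport X) :
    divergence X x = 0 := by
  have : fderiv ℝ X x = 0 := by
    by_contra h
    exact hx (support_fderiv_subset ℝ h)
  simp [divergence, this]

lemma continuous_divergence {X : Plane → Plane} (hX : ContDiff ℝ 1 X) :
    Continuous (divergence X) := by
  have h := hX.continuous_fderiv one_ne_zero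
  unfold divergence
  fun_prop

lemma hasCompactSupport_divergence {X : Plane → Plane} (hX : HasCompactSupport X) :
    HasCompactSupport (divergence X) :=
  HasCompactSupport.intro hX fun _ hx => divergence_eq_zero_of_notMem hx

lemma integrable_divergence {X : Plane → Plane} (hX : ContDiff ℝ 1 X)
    (hc : HasCompactSupport X) : Integrable (divergence X) volume :=
  (continuous_divergence hX).integrable_of_hasCompactSupport (hasCompactSupport_divergence hc)

lemma setIntegral_mul_divergence {Ω : Set Plane} {X : Plane → Plane} (hX : tsupport X ⊆ Ω)
    (u : Plane → ℝ) : ∫ x in Ω, u x * divergence X x = ∫ x, u x * divergence X x :=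
  setIntegral_eq_integral_of_forall_compl_eq_zero fun x hx => by
    rw [divergence_eq_zero_of_notMem fun h => hx (hX h), mul_zero]

lemma integrable_mul_divergence {X : Plane → Plane} (hX : ContDiff ℝ 1 X)
    (hc : HasCompactSupport X) {μ : Measure Plane} (hμ : μ ≤ volume) {u : Plane → ℝ}
    (hu : AEStronglyMeasurable u μ) {C : ℝ} (hb : ∀ᵐ x ∂μ, ‖u x‖ ≤ C) :
    Integrable (fun x => u x * divergence X x) μ :=
  ((integrable_divergence hX hc).mono_measure hμ).bdd_mul hu hb

/-- Integration by parts against a compactly supported vector field. -/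
lemma integral_mul_divergence {v : Plane → ℝ} (hv : ContDiff ℝ 1 v) {X : Plane → Plane}
    (hX : ContDiff ℝ 1 X) (hc : HasCompactSupport X) :
    ∫ x, v x * divergence X x = -∫ x, fderiv ℝ v x (X x) := by
  have hvf := hv.continuous_fderiv one_ne_zero
  have hXi : ∀ i : Fin 2, ContDiff ℝ 1 fun y => X y i := fun i =>
    (contDiff_euclidean.1 hX) i
  have hXc : ∀ i : Fin 2, HasCompactSupport fun y => X y i := fun i =>
    hc.comp_left (g := fun z : Plane => z i) rfl
  have hXf : ∀ i : Fin 2, Continuous fun x => fderiv ℝ (fun y => X y i) x := fun i =>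
    (hXi i).continuous_fderiv one_ne_zero
  have i1 : ∀ i : Fin 2, Integrable (fun x => fderiv ℝ v x (EuclideanSpace.single i 1) * X x i)
      volume := fun i => by
    refine Continuous.integrable_of_hasCompactSupport ?_ (hXc i).mul_left
    have := (hXi i).continuous
    fun_prop
  have i2 : ∀ i : Fin 2, Integrable (fun x => v x * fderiv ℝ (fun y => X y i) x
      (EuclideanSpace.single i 1)) volume := fun i => by
    refine Continuous.integrable_of_hasCompactSupport ?_ ((hXc i).fderiv_apply ℝ _).mul_left
    have := hXf i
    have := hv.continuous
    fun_prop
  have i3 : ∀ i : Fin 2, Integrable (fun x => v x * X x i) volume := fun i =>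
    Continuous.integrable_of_hasCompactSupport (hv.continuous.mul (hXi i).continuous)
      (hXc i).mul_left
  have key : ∀ i : Fin 2, ∫ x, v x * fderiv ℝ (fun y => X y i) x (EuclideanSpace.single i 1) =
      -∫ x, fderiv ℝ v x (EuclideanSpace.single i 1) * X x i := fun i =>
    integral_mul_fderiv_eq_neg_fderiv_mul_of_integrable (i1 i) (i2 i) (i3 i)
      (fun x _ => hv.differentiable one_ne_zero x)
      (fun x _ => (hXi i).differentiable one_ne_zero x)
  have e1 : ∀ x, v x * divergence X x =
      ∑ i : Fin 2, v x * fderiv ℝ (fun y => X y i) x (EuclideanSpace.single i 1) := fun x => by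
    rw [divergence_eq_sum hX, Finset.mul_sum]
  have e2 : ∀ x, fderiv ℝ v x (X x) =
      ∑ i : Fin 2, fderiv ℝ v x (EuclideanSpace.single i 1) * X x i := fun x => by
    conv_lhs => rw [show X x = ∑ i : Fin 2, X x i • EuclideanSpace.single i (1 : ℝ) by
      ext j; fin_cases j <;> simp [Fin.sum_univ_two]]
    rw [map_sum]
    refine Finset.sum_congr rfl fun i _ => ?_
    rw [map_smul, smul_eq_mul, mul_comm]
  simp_rw [e1, e2]
  rw [integral_finsetSum _ fun i _ => i2 i, integral_finsetSum _ fun i _ => i1 i,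
    ← Finset.sum_neg_distrib]
  exact Finset.sum_congr rfl fun i _ => key i

lemma tv_const {Ω : Set Plane} (a : ℝ) : tv Ω (fun _ => a) = 0 := by
  refine le_antisymm (iSup₂_le fun X hX => ?_) zero_le
  rw [setIntegral_mul_divergence hX.2.2.1 (fun _ => a),
    integral_mul_divergence contDiff_const hX.1 hX.2.1]
  simp

lemma le_tv {Ω : Set Plane} {X : Plane → Plane} (hX : X ∈ testFields Ω) (u : Plane → ℝ) :
    ENNReal.ofReal (∫ x in Ω, u x * divergence X x) ≤ tv Ω u :=
  le_iSup₂ (f := fun X (_ : X ∈ testFields Ω) =>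
    ENNReal.ofReal (∫ x in Ω, u x * divergence X x)) X hX

lemma integral_le_tv_toReal {Ω : Set Plane} {X : Plane → Plane} (hX : X ∈ testFields Ω)
    {u : Plane → ℝ} (hu : tv Ω u ≠ ∞) :
    ∫ x in Ω, u x * divergence X x ≤ (tv Ω u).toReal :=
  (ENNReal.ofReal_le_iff_le_toReal hu).1 (le_tv hX u)

lemma tv_congr {Ω : Set Plane} {u v : Plane → ℝ} (h : u =ᵐ[volume.restrict Ω] v) :
    tv Ω u = tv Ω v := by
  unfold tv
  refine iSup_congr fun X => iSup_congr fun _ => ?_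
  congr 1
  refine integral_congr_ae ?_
  filter_upwards [h] with x hx
  rw [hx]

/-- Lower semicontinuity of the total variation, with respect to both function and domain. -/
lemma tv_le_liminf {Ω : Set Plane} {Ω' : ℕ → Set Plane} {u : Plane → ℝ} {v : ℕ → Plane → ℝ}
    (hΩ : ∀ X ∈ testFields Ω, ∀ᶠ n in atTop, X ∈ testFields (Ω' n))
    (h : ∀ X ∈ testFields Ω, Tendsto (fun n => ∫ x, v n x * divergence X x) atTop
      (𝓝 (∫ x, u x * divergence X x))) :
    tv Ω u ≤ liminf (fun n => tv (Ω' n) (v n)) atTop := by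
  refine iSup₂_le fun X hX => ?_
  have h1 := (ENNReal.continuous_ofReal.tendsto _).comp (h X hX)
  rw [setIntegral_mul_divergence hX.2.2.1, ← h1.liminf_eq]
  refine liminf_le_liminf ?_
  filter_upwards [hΩ X hX] with n hn
  rw [Function.comp_apply, ← setIntegral_mul_divergence hn.2.2.1]
  exact le_tv hn _

/-- Lower semicontinuity of the total variation under bounded a.e. convergence. -/
lemma tv_le_liminf_of_ae {Ω : Set Plane} {u : Plane → ℝ} {v : ℕ → Plane → ℝ} {C : ℝ}
    (hv : ∀ n, AEStronglyMeasurable (v n) (volume.restrict Ω))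
    (hb : ∀ n, ∀ᵐ x ∂volume.restrict Ω, ‖v n x‖ ≤ C)
    (h : ∀ᵐ x ∂volume.restrict Ω, Tendsto (fun n => v n x) atTop (𝓝 (u x))) :
    tv Ω u ≤ liminf (fun n => tv Ω (v n)) atTop := by
  refine tv_le_liminf (fun X hX => Eventually.of_forall fun _ => hX) fun X hX => ?_
  simp_rw [← setIntegral_mul_divergence hX.2.2.1]
  have hd := integrable_divergence hX.1 hX.2.1
  refine tendsto_integral_of_dominated_convergence (fun x => C * ‖divergence X x‖)
    (fun n => (hv n).mul hd.aestronglyMeasurable.restrict) (hd.restrict.norm.const_mul C)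
    (fun n => ?_) ?_
  · filter_upwards [hb n] with x hx
    rw [norm_mul]
    gcongr
  · filter_upwards [h] with x hx
    exact hx.mul_const _

lemma tv_add_le {Ω : Set Plane} {u v : Plane → ℝ} {C : ℝ}
    (hu : AEStronglyMeasurable u (volume.restrict Ω))
    (hub : ∀ᵐ x ∂volume.restrict Ω, ‖u x‖ ≤ C)
    (hv : AEStronglyMeasurable v (volume.restrict Ω))
    (hvb : ∀ᵐ x ∂volume.restrict Ω, ‖v x‖ ≤ C) {a b : ℝ} (ha : 0 ≤ a) (hb : 0 ≤ b) :
    tv Ω (fun x => a * u x + b * v x) ≤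
      ENNReal.ofReal a * tv Ω u + ENNReal.ofReal b * tv Ω v := by
  refine iSup₂_le fun X hX => ?_
  have h1 := integrable_mul_divergence hX.1 hX.2.1 Measure.restrict_le_self hu hub
  have h2 := integrable_mul_divergence hX.1 hX.2.1 Measure.restrict_le_self hv hvb
  have : ∫ x in Ω, (a * u x + b * v x) * divergence X x =
      a * (∫ x in Ω, u x * divergence X x) + b * ∫ x in Ω, v x * divergence X x := by
    rw [← integral_const_mul, ← integral_const_mul,
      ← integral_add (h1.const_mul a) (h2.const_mul b)]
    congr 1 with x
    ring
  rw [this]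
  refine ENNReal.ofReal_add_le.trans ?_
  rw [ENNReal.ofReal_mul ha, ENNReal.ofReal_mul hb]
  gcongr <;> exact le_tv hX _

/-! ### Parametrised families -/

/-- A countable family of test fields computes the total variation of all bounded functions. -/
lemma exists_seq_testFields (Ω : Set Plane) : ∃ Y : ℕ → Plane → Plane, (∀ n, Y n ∈ testFields Ω) ∧
    ∀ (u : Plane → ℝ) (C : ℝ), AEStronglyMeasurable u (volume.restrict Ω) →
      (∀ᵐ x ∂volume.restrict Ω, ‖u x‖ ≤ C) →
      tv Ω u = ⨆ n, ENNReal.ofReal (∫ x in Ω, u x * divergence (Y n) x) := by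
  have : Fact ((1 : ℝ≥0∞) ≤ 1) := ⟨le_rfl⟩
  have : Fact ((1 : ℝ≥0∞) ≠ ∞) := ⟨ENNReal.one_ne_top⟩
  -- The integral `∫ u div X` depends on `X` only through the class of `div X` in `L¹(Ω)`,
  -- continuously for bounded `u`. Separability of `L¹` makes a countable dense set of divergences
  -- sufficient.
  let F : testFields Ω → Lp ℝ 1 (volume.restrict Ω) := fun X =>
    (integrable_divergence X.2.1 X.2.2.1).restrict.toL1 _
  have : Nonempty (range F) := ⟨⟨F ⟨0, zero_mem_testFields Ω⟩, mem_range_self _⟩⟩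
  let s := TopologicalSpace.denseSeq (range F)
  have hs : DenseRange s := TopologicalSpace.denseRange_denseSeq _
  choose Y hY using fun n => (s n).2
  refine ⟨fun n => (Y n).1, fun n => (Y n).2, fun u C hu hb => le_antisymm ?_ ?_⟩
  · refine iSup₂_le fun X hX => ?_
    refine ENNReal.le_of_forall_pos_le_add fun ε hε _ => ?_
    set C' := max C 1 with hC'
    have hC'0 : 0 < C' := lt_of_lt_of_le one_pos (le_max_right _ _)
    obtain ⟨n, hn⟩ := Metric.denseRange_iff.1 hs ⟨F ⟨X, hX⟩, mem_range_self _⟩ (ε / C')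
      (div_pos hε hC'0)
    rw [Subtype.dist_eq, ← hY n, dist_eq_norm, ← Integrable.toL1_sub, L1.norm_of_fun_eq_integral_norm] at hn
    have i1 := integrable_mul_divergence hX.1 hX.2.1 Measure.restrict_le_self hu hb
    have i2 := integrable_mul_divergence (Y n).2.1 (Y n).2.2.1 Measure.restrict_le_self hu hb
    have i3 := ((integrable_divergence hX.1 hX.2.1).restrict (s := Ω)).sub
      ((integrable_divergence (Y n).2.1 (Y n).2.2.1).restrict (s := Ω))
    have : ∫ x in Ω, u x * divergence X x ≤
        (∫ x in Ω, u x * divergence (Y n).1 x) + ε := by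
      rw [← sub_le_iff_le_add', ← integral_sub i1 i2]
      calc _ ≤ ∫ x in Ω, C' * ‖(divergence X - divergence (Y n).1) x‖ := by
            refine integral_mono_ae (i1.sub i2) (i3.norm.const_mul C') ?_
            filter_upwards [hb] with x hx
            simp only [Pi.sub_apply]
            rw [← mul_sub]
            refine (le_abs_self _).trans ?_
            rw [abs_mul]
            exact mul_le_mul_of_nonneg_right (hx.trans (le_max_left _ _)) (abs_nonneg _)
        _ ≤ ε := by
            rw [integral_const_mul]
            calc _ ≤ C' * (ε / C') := by gcongr
              _ = ε := by field_simp
    calc _ ≤ ENNReal.ofReal ((∫ x in Ω, u x * divergence (Y n).1 x) + ε) :=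
          ENNReal.ofReal_le_ofReal this
      _ ≤ ENNReal.ofReal (∫ x in Ω, u x * divergence (Y n).1 x) + ENNReal.ofReal ε :=
          ENNReal.ofReal_add_le
      _ ≤ _ := by
          rw [ENNReal.ofReal_coe_nnreal]
          gcongr
          exact le_iSup (fun n => ENNReal.ofReal (∫ x in Ω, u x * divergence (Y n).1 x)) n
  · exact iSup_le fun n => le_tv (Y n).2 u

/-- The supremum over all test fields may be taken over a countable family that does not depend on
the parameter, and each member is measurable in it. This allows total variations to be integrated
over levels and slices. -/
lemma measurable_tv {T : Type*} [MeasurableSpace T] (Ω : Set Plane) {w : Plane × T → ℝ}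
    (hw : Measurable w) {C : ℝ} (hb : ∀ p, ‖w p‖ ≤ C) :
    Measurable fun τ => tv Ω fun x => w (x, τ) := by
  obtain ⟨Y, hY, h⟩ := exists_seq_testFields Ω
  have : (fun τ => tv Ω fun x => w (x, τ)) =
      fun τ => ⨆ n, ENNReal.ofReal (∫ x in Ω, w (x, τ) * divergence (Y n) x) := by
    ext τ
    exact h _ C (hw.comp measurable_prodMk_right).aestronglyMeasurable
      (Eventually.of_forall fun x => hb _)
  rw [this]
  refine Measurable.iSup fun n => ENNReal.measurable_ofReal.comp ?_
  have : StronglyMeasurable fun q : T × Plane => w (q.2, q.1) * divergence (Y n) q.2 :=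
    ((hw.comp measurable_swap).mul
      ((continuous_divergence (hY n).1).measurable.comp measurable_snd)).stronglyMeasurable
  exact this.integral_prod_right'.measurable

lemma ofReal_integral_le_lintegral_ofReal {α : Type*} [MeasurableSpace α] {μ : Measure α}
    {g : α → ℝ} (hg : Integrable g μ) :
    ENNReal.ofReal (∫ a, g a ∂μ) ≤ ∫⁻ a, ENNReal.ofReal (g a) ∂μ := by
  rw [integral_eq_lintegral_pos_part_sub_lintegral_neg_part hg]
  refine ENNReal.ofReal_le_of_le_toReal ?_
  linarith [ENNReal.toReal_nonneg (a := ∫⁻ a, ENNReal.ofReal (-g a) ∂μ)]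

/-- Jensen's inequality for the total variation. -/
lemma tv_integral_le {T : Type*} [MeasurableSpace T] {Ω : Set Plane} {κ : Measure T}
    [IsFiniteMeasure κ] {w : Plane × T → ℝ} (hw : Measurable w) {C : ℝ} (hb : ∀ p, ‖w p‖ ≤ C) :
    tv Ω (fun x => ∫ τ, w (x, τ) ∂κ) ≤ ∫⁻ τ, tv Ω (fun x => w (x, τ)) ∂κ := by
  refine iSup₂_le fun X hX => ?_
  have hi : Integrable (fun q : Plane × T => w q * divergence X q.1)
      ((volume.restrict Ω).prod κ) := by
    refine Integrable.bdd_mul (c := C) ?_ hw.aestronglyMeasurable (Eventually.of_forall hb)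
    have := (integrable_divergence hX.1 hX.2.1).restrict (s := Ω)
    simpa using this.mul_prod (integrable_const (1 : ℝ) (μ := κ))
  have e : ∫ x in Ω, (∫ τ, w (x, τ) ∂κ) * divergence X x =
      ∫ τ, (∫ x in Ω, w (x, τ) * divergence X x) ∂κ := by
    rw [← integral_integral_swap hi]
    congr 1 with x
    rw [integral_mul_const]
  rw [e]
  refine (ofReal_integral_le_lintegral_ofReal hi.integral_prod_right).trans ?_
  exact lintegral_mono fun τ => le_tv hX _

/-- The superlevel indicator `1_{v > t}`. -/
def superlevel (v : Plane → ℝ) (t : ℝ) (x : Plane) : ℝ := if t < v x then 1 else 0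

lemma measurable_superlevel {v : Plane → ℝ} (hv : Measurable v) :
    Measurable fun q : Plane × ℝ => superlevel v q.2 q.1 :=
  Measurable.ite (measurableSet_lt measurable_snd (hv.comp measurable_fst)) measurable_const
    measurable_const

lemma norm_superlevel_le (v : Plane → ℝ) (t : ℝ) (x : Plane) : ‖superlevel v t x‖ ≤ 1 := by
  unfold superlevel
  split_ifs <;> simp

/-- The layer cake identity behind both the coarea inequality and the vertical integration by parts.
-/
lemma integral_ite_lt {s : ℝ} (hs : s ∈ Icc (0 : ℝ) 1) :
    ∫ t in Icc (0 : ℝ) 1, (if t < s then (1 : ℝ) else 0) = s := by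
  have : (fun t : ℝ => if t < s then (1 : ℝ) else 0) = (Iio s).indicator 1 := by
    ext t
    simp [indicator]
  rw [this, integral_indicator measurableSet_Iio, Measure.restrict_restrict measurableSet_Iio]
  have : Iio s ∩ Icc 0 1 = Ico 0 s := by
    ext t
    simp only [mem_inter_iff, mem_Iio, mem_Icc, mem_Ico]
    constructor
    · rintro ⟨h1, h2, _⟩; exact ⟨h2, h1⟩
    · rintro ⟨h1, h2⟩; exact ⟨h2, h1, h2.le.trans hs.2⟩
  rw [this]
  simp [hs.1]

/-- The easy half of the coarea formula. -/
lemma tv_le_lintegral_superlevel {Ω : Set Plane} {v : Plane → ℝ} (hv : Measurable v)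
    (hb : ∀ x, v x ∈ Icc (0 : ℝ) 1) :
    tv Ω v ≤ ∫⁻ t in Icc (0 : ℝ) 1, tv Ω (superlevel v t) := by
  have := tv_integral_le (Ω := Ω) (κ := volume.restrict (Icc (0 : ℝ) 1))
    (measurable_superlevel hv) (fun p => norm_superlevel_le v p.2 p.1)
  refine le_of_eq_of_le ?_ this
  congr 1 with x
  exact (integral_ite_lt (hb x)).symm

/-! ### Inner parallel sets -/

/-- The points of `Ω` at distance more than `r` from the complement. -/
def shrink (Ω : Set Plane) (r : ℝ) : Set Plane := (Metric.cthickening r Ωᶜ)ᶜ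

lemma mem_shrink {Ω : Set Plane} {r : ℝ} {x : Plane} :
    x ∈ shrink Ω r ↔ ENNReal.ofReal r < Metric.infEDist x Ωᶜ := by
  rw [shrink, mem_compl_iff, Metric.mem_cthickening_iff, not_le]

lemma isOpen_shrink (Ω : Set Plane) (r : ℝ) : IsOpen (shrink Ω r) :=
  Metric.isClosed_cthickening.isOpen_compl

lemma shrink_anti (Ω : Set Plane) {r s : ℝ} (h : r ≤ s) : shrink Ω s ⊆ shrink Ω r :=
  compl_subset_compl.2 (Metric.cthickening_mono h _)

lemma shrink_subset (Ω : Set Plane) (r : ℝ) : shrink Ω r ⊆ Ω := fun _ hx =>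
  notMem_compl_iff.1 fun h => hx (Metric.self_subset_cthickening _ h)

lemma closure_shrink_subset (Ω : Set Plane) {r s : ℝ} (hr : 0 ≤ r) (h : r < s) :
    closure (shrink Ω s) ⊆ shrink Ω r := by
  have h1 : closure (shrink Ω s) ⊆ (Metric.thickening s Ωᶜ)ᶜ :=
    closure_minimal (compl_subset_compl.2 (Metric.thickening_subset_cthickening _ _))
      Metric.isOpen_thickening.isClosed_compl
  refine h1.trans fun x hx => mem_shrink.2 ?_
  rw [mem_compl_iff, Metric.mem_thickening_iff_infEDist_lt, not_lt] at hx
  exact lt_of_lt_of_le ((ENNReal.ofReal_lt_ofReal_iff (hr.trans_lt h)).2 h) hx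

lemma add_mem_shrink {Ω : Set Plane} {a b : ℝ} (ha : 0 ≤ a) (hb : 0 ≤ b) {x h : Plane}
    (hx : x ∈ shrink Ω (a + b)) (hh : ‖h‖ ≤ a) : x + h ∈ shrink Ω b := by
  rw [mem_shrink] at hx ⊢
  have h1 : Metric.infEDist x Ωᶜ ≤ Metric.infEDist (x + h) Ωᶜ + edist x (x + h) :=
    Metric.infEDist_le_infEDist_add_edist
  have h2 : edist x (x + h) ≤ ENNReal.ofReal a := by
    rw [edist_dist]
    refine ENNReal.ofReal_le_ofReal ?_
    simpa using hh
  rw [ENNReal.ofReal_add ha hb] at hx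
  by_contra hc
  rw [not_lt] at hc
  exact absurd (hx.trans_le (h1.trans (add_le_add hc h2))) (by rw [add_comm]; exact lt_irrefl _)

lemma add_mem_of_mem_shrink {Ω : Set Plane} {a : ℝ} {x h : Plane}
    (hx : x ∈ shrink Ω a) (hh : ‖h‖ ≤ a) : x + h ∈ Ω :=
  shrink_subset Ω 0 (add_mem_shrink ((norm_nonneg _).trans hh) le_rfl (by simpa using hx) hh)

lemma exists_subset_shrink {Ω K : Set Plane} (hΩ : IsOpen Ω) (hK : IsCompact K) (h : K ⊆ Ω) :
    ∃ δ > 0, ∀ r ≤ δ, K ⊆ shrink Ω r := by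
  obtain ⟨δ, hδ, hd⟩ := (disjoint_compl_right_iff_subset.2 h).exists_cthickenings hK
    hΩ.isClosed_compl
  exact ⟨δ, hδ, fun r hr x hx hx' => disjoint_left.1 hd
    (Metric.self_subset_cthickening _ hx) (Metric.cthickening_mono hr _ hx')⟩

/-- A compact support keeps a positive distance from the complement of `Ω`. Estimates on shrinking
inner sets therefore pass to `Ω` through `tv_le_liminf`. -/
lemma eventually_mem_testFields_shrink {Ω : Set Plane} (hΩ : IsOpen Ω) {X : Plane → Plane}
    (hX : X ∈ testFields Ω) {r : ℕ → ℝ} (hr : Tendsto r atTop (𝓝 0)) :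
    ∀ᶠ n in atTop, X ∈ testFields (shrink Ω (r n)) := by
  obtain ⟨δ, hδ, h⟩ := exists_subset_shrink hΩ hX.2.1 hX.2.2.1
  filter_upwards [hr.eventually_le_const hδ] with n hn
  exact ⟨hX.1, hX.2.1, h _ hn, hX.2.2.2⟩

/-! ### Mollification -/

/-- The radius of the `k`-th mollifier. -/
def radius (k : ℕ) : ℝ := 1 / ((k : ℝ) + 1)

lemma radius_pos (k : ℕ) : 0 < radius k := Nat.one_div_pos_of_nat

lemma tendsto_radius : Tendsto radius atTop (𝓝 0) := tendsto_one_div_add_atTop_nhds_zero_nat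

/-- A smooth bump function supported in the ball of radius `radius k`. -/
def bump (k : ℕ) : ContDiffBump (0 : Plane) where
  rIn := radius k / 2
  rOut := radius k
  rIn_pos := half_pos (radius_pos k)
  rIn_lt_rOut := half_lt_self (radius_pos k)

/-- The convolution of `v` with the normalised `k`-th bump function. -/
def mollify (k : ℕ) (v : Plane → ℝ) (x : Plane) : ℝ :=
  ∫ h, (bump k).normed volume h * v (x - h)

lemma mollify_eq (k : ℕ) (v : Plane → ℝ) :
    mollify k v = convolution ((bump k).normed volume) v (ContinuousLinearMap.lsmul ℝ ℝ) volume :=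
  rfl

lemma locallyIntegrable_of_bdd {v : Plane → ℝ} (hv : Measurable v) {C : ℝ}
    (hb : ∀ x, ‖v x‖ ≤ C) : LocallyIntegrable v volume :=
  (locallyIntegrable_const C).mono hv.aestronglyMeasurable
    (Eventually.of_forall fun x => (hb x).trans (le_abs_self _))

lemma contDiff_mollify (k : ℕ) {v : Plane → ℝ} (hv : LocallyIntegrable v volume) :
    ContDiff ℝ 2 (mollify k v) := by
  rw [mollify_eq]
  exact (bump k).hasCompactSupport_normed.contDiff_convolution_left _
    (bump k).contDiff_normed hv

lemma ae_tendsto_mollify {v : Plane → ℝ} (hv : LocallyIntegrable v volume) :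
    ∀ᵐ x, Tendsto (fun k => mollify k v x) atTop (𝓝 (v x)) :=
  ContDiffBump.ae_convolution_tendsto_right_of_locallyIntegrable (φ := bump) (K := 2)
    tendsto_radius (Eventually.of_forall fun k => by
      change radius k ≤ 2 * (radius k / 2); linarith) hv

lemma norm_bump_mul_le (k : ℕ) {a C : ℝ} (ha : ‖a‖ ≤ C) (h : Plane) :
    ‖(bump k).normed volume h * a‖ ≤ C * (bump k).normed volume h := by
  rw [norm_mul, Real.norm_of_nonneg ((bump k).nonneg_normed h), mul_comm]
  exact mul_le_mul_of_nonneg_right ha ((bump k).nonneg_normed h)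

lemma norm_mollify_le (k : ℕ) {v : Plane → ℝ} {C : ℝ} (hb : ∀ x, ‖v x‖ ≤ C) (x : Plane) :
    ‖mollify k v x‖ ≤ C := by
  refine (norm_integral_le_of_norm_le ((bump k).integrable_normed.const_mul C)
    (Eventually.of_forall fun h => norm_bump_mul_le k (hb _) h)).trans ?_
  rw [integral_const_mul, (bump k).integral_normed, mul_one]

lemma bump_eq_zero {k : ℕ} {h : Plane} (hh : radius k < ‖h‖) : (bump k).normed volume h = 0 := by
  have : h ∉ Function.support ((bump k).normed volume) := by
    rw [(bump k).support_normed_eq]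
    simpa [bump] using hh.le
  simpa using this

lemma comp_add_mem_testFields {Ω : Set Plane} {r : ℝ} {X : Plane → Plane}
    (hX : X ∈ testFields (shrink Ω r)) {h : Plane} (hh : ‖h‖ ≤ r) :
    (fun x => X (x + h)) ∈ testFields Ω := by
  have hs : tsupport (fun x => X (x + h)) = (Homeomorph.addRight h) ⁻¹' tsupport X :=
    tsupport_comp_eq_preimage X (Homeomorph.addRight h)
  refine ⟨hX.1.comp (contDiff_id.add contDiff_const), ?_, ?_, fun x => hX.2.2.2 _⟩
  · rw [HasCompactSupport, hs]
    exact (Homeomorph.addRight h).isCompact_preimage.2 hX.2.1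
  · rw [hs]
    intro x hx
    have := add_mem_of_mem_shrink (hX.2.2.1 hx) (h := -h) (by rwa [norm_neg])
    simpa using this

/-- By Fubini the mollification moves onto the field and leaves an average of translates of `X` by
at most `radius k`. Each of these is still a test field for `Ω`, since `X` is supported at distance
more than `radius k` from the complement. -/
lemma integral_mollify_mul_divergence_le {Ω : Set Plane} {k : ℕ} {v : Plane → ℝ}
    (hv : Measurable v) {C : ℝ} (hb : ∀ x, ‖v x‖ ≤ C) (ht : tv Ω v ≠ ∞) {X : Plane → Plane}
    (hX : X ∈ testFields (shrink Ω (radius k))) :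
    ∫ x, mollify k v x * divergence X x ≤ (tv Ω v).toReal := by
  have hd := integrable_divergence hX.1 hX.2.1
  have hi : Integrable (fun q : Plane × Plane =>
      ((bump k).normed volume q.2 * v (q.1 - q.2)) * divergence X q.1)
      (volume.prod volume) := by
    have h1 : Integrable (fun q : Plane × Plane => divergence X q.1 * (bump k).normed volume q.2)
        (volume.prod volume) := hd.mul_prod (bump k).integrable_normed
    refine ((h1.bdd_mul (f := fun q : Plane × Plane => v (q.1 - q.2)) (c := C) ?_
      (Eventually.of_forall fun _ => hb _))).congr (Eventually.of_forall fun q => ?_)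
    · exact (hv.comp (measurable_fst.sub measurable_snd)).aestronglyMeasurable
    · simp only
      ring
  have e (h : Plane) : ∫ x, ((bump k).normed volume h * v (x - h)) * divergence X x =
      (bump k).normed volume h * ∫ x, v x * divergence X (x + h) := by
    rw [← integral_const_mul, ← integral_add_right_eq_self _ h]
    congr 1 with x
    simp only [add_sub_cancel_right]
    ring
  simp_rw [mollify, ← integral_mul_const]
  rw [integral_integral_swap hi]
  calc _ ≤ ∫ h, (bump k).normed volume h * (tv Ω v).toReal := by
        refine integral_mono hi.integral_prod_right
          ((bump k).integrable_normed.mul_const _) fun h => ?_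
        simp only [e]
        rcases le_or_gt ‖h‖ (radius k) with hh | hh
        · refine mul_le_mul_of_nonneg_left ?_ ((bump k).nonneg_normed h)
          have hX' := comp_add_mem_testFields hX hh
          have := integral_le_tv_toReal hX' ht
          simp_rw [divergence_comp_add] at this
          refine le_of_eq_of_le ?_ this
          have h2 := setIntegral_mul_divergence hX'.2.2.1 v
          simp_rw [divergence_comp_add] at h2
          exact h2.symm
        · simp [bump_eq_zero hh]
    _ = _ := by rw [integral_mul_const, (bump k).integral_normed, one_mul]

/-- The gradient of a real function on the plane. -/
def grad (v : Plane → ℝ) (x : Plane) : Plane :=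
  WithLp.toLp 2 fun i => fderiv ℝ v x (EuclideanSpace.single i 1)

lemma fderiv_eq_inner_grad (v : Plane → ℝ) (x y : Plane) :
    fderiv ℝ v x y = inner ℝ (grad v x) y := by
  conv_lhs => rw [show y = ∑ i : Fin 2, y i • EuclideanSpace.single i (1 : ℝ) by
    ext j; fin_cases j <;> simp [Fin.sum_univ_two]]
  rw [map_sum, PiLp.inner_apply]
  refine Finset.sum_congr rfl fun i _ => ?_
  rw [map_smul]
  rfl

lemma norm_fderiv_le_norm_grad (v : Plane → ℝ) (x : Plane) :
    ‖fderiv ℝ v x‖ ≤ ‖grad v x‖ :=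
  ContinuousLinearMap.opNorm_le_bound _ (norm_nonneg _) fun y => by
    rw [fderiv_eq_inner_grad]
    exact norm_inner_le_norm _ _

lemma contDiff_grad {v : Plane → ℝ} (hv : ContDiff ℝ 2 v) : ContDiff ℝ 1 (grad v) := by
  refine contDiff_euclidean.2 fun i => ?_
  exact (hv.fderiv_right (m := 1) (by norm_num)).clm_apply contDiff_const

/-- On an inner parallel set, the gradient of the mollification is controlled by the total
variation. -/
lemma lintegral_fderiv_mollify_le {Ω : Set Plane} (hΩ : Bornology.IsBounded Ω) (k : ℕ)
    {v : Plane → ℝ} (hv : Measurable v) {C : ℝ} (hb : ∀ x, ‖v x‖ ≤ C) :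
    ∫⁻ x in shrink Ω (3 * radius k), ‖fderiv ℝ (mollify k v) x‖ₑ ≤ tv Ω v := by
  rcases eq_or_ne (tv Ω v) ∞ with ht | ht
  · rw [ht]; exact le_top
  set S := shrink Ω (3 * radius k) with hS
  set V := mollify k v with hV
  have hr := radius_pos k
  have hV2 : ContDiff ℝ 2 V := contDiff_mollify k (locallyIntegrable_of_bdd hv hb)
  have hg := contDiff_grad hV2
  have hSb : Bornology.IsBounded S := hΩ.subset (shrink_subset _ _)
  have hSv : volume S < ∞ := hSb.measure_lt_top
  -- Three nested inner sets: the cutoff is `1` on the closure of the `3r`-set and vanishes off the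
  -- `2r`-set, whose closure lies in the `r`-set where the mollified estimate is available.
  obtain ⟨χ, hχ, hχr, hχs, hχ1⟩ := exists_contMDiff_support_eq_eq_one_iff (n := 1)
    (modelWithCornersSelf ℝ Plane) (isOpen_shrink Ω (2 * radius k))
    (isClosed_closure (s := S)) (closure_shrink_subset Ω (by positivity) (by linarith))
  have hχ' : ContDiff ℝ 1 χ := hχ.contDiff
  have hχ0 : ∀ x, 0 ≤ χ x ∧ χ x ≤ 1 := fun x => hχr ⟨x, rfl⟩
  have hgS : IntegrableOn (fun x => ‖grad V x‖) S := by
    refine IntegrableOn.mono_set ?_ subset_closure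
    exact hg.continuous.norm.continuousOn.integrableOn_compact hSb.isCompact_closure
  -- The ideal field `-∇V/|∇V|` is not `C¹` where the gradient vanishes. Dividing by `√(|∇V|² + δ²)`
  -- instead keeps length at most `1`, and the pairing with `∇V` loses at most `δ` pointwise.
  have main : ∀ δ : ℝ, 0 < δ → ∫ x in S, ‖grad V x‖ ≤ (tv Ω v).toReal + δ * volume.real S := by
    intro δ hδ
    have hq : ∀ x, 0 < ‖grad V x‖ ^ 2 + δ ^ 2 := fun x => by positivity
    let a : Plane → ℝ := fun x => χ x * (√(‖grad V x‖ ^ 2 + δ ^ 2))⁻¹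
    have ha : ContDiff ℝ 1 a := by
      refine hχ'.mul (ContDiff.inv ?_ fun x => (Real.sqrt_pos.2 (hq x)).ne')
      exact ((hg.norm_sq ℝ).add contDiff_const).sqrt fun x => (hq x).ne'
    let X : Plane → Plane := fun x => -(a x • grad V x)
    have hXs : tsupport X ⊆ closure (shrink Ω (2 * radius k)) := by
      refine closure_mono fun x hx => ?_
      rw [← hχs]
      intro h0
      apply hx
      simp [X, a, h0]
    have hXt : tsupport X ⊆ shrink Ω (radius k) :=
      hXs.trans (closure_shrink_subset Ω hr.le (by linarith))
    have hX : X ∈ testFields (shrink Ω (radius k)) := by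
      refine ⟨(ha.smul hg).neg, ?_, hXt, fun x => ?_⟩
      · exact Metric.isCompact_of_isClosed_isBounded (isClosed_tsupport _)
          (hΩ.subset (hXt.trans (shrink_subset _ _)))
      · have h1 : ‖grad V x‖ ≤ √(‖grad V x‖ ^ 2 + δ ^ 2) := by
          apply Real.le_sqrt_of_sq_le; nlinarith
        simp only [X, a]
        rw [norm_neg, norm_smul, norm_mul, norm_inv, Real.norm_of_nonneg (hχ0 x).1,
          Real.norm_of_nonneg (Real.sqrt_nonneg _), mul_assoc, ← div_eq_inv_mul]
        exact mul_le_one₀ (hχ0 x).2 (by positivity)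
          ((div_le_one (Real.sqrt_pos.2 (hq x))).2 h1)
    have h1 := integral_mollify_mul_divergence_le hv hb ht hX
    rw [← hV, integral_mul_divergence (hV2.of_le (by norm_num)) hX.1 hX.2.1,
      ← integral_neg] at h1
    have e : ∀ x, -(fderiv ℝ V x) (X x) = a x * ‖grad V x‖ ^ 2 := fun x => by
      simp only [X, map_neg, map_smul, neg_neg, fderiv_eq_inner_grad, smul_eq_mul,
        real_inner_self_eq_norm_sq]
    simp_rw [e] at h1
    have ha0 : ∀ x, 0 ≤ a x := fun x => mul_nonneg (hχ0 x).1 (by positivity)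
    have hai : Integrable (fun x => a x * ‖grad V x‖ ^ 2) volume := by
      refine Continuous.integrable_of_hasCompactSupport
        (ha.continuous.mul (hg.continuous.norm.pow 2)) ?_
      refine HasCompactSupport.intro hX.2.1 fun x hx => ?_
      have : X x = 0 := image_eq_zero_of_notMem_tsupport hx
      have h3 := e x
      rw [this] at h3
      simpa using h3.symm
    have h2 : ∫ x in S, (‖grad V x‖ - δ) ≤ ∫ x in S, a x * ‖grad V x‖ ^ 2 := by
      refine setIntegral_mono_on (hgS.sub (integrableOn_const hSv.ne)) hai.integrableOn
        (isOpen_shrink _ _).measurableSet fun x hx => ?_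
      have hx1 : χ x = 1 := (hχ1 x).1 (subset_closure hx)
      simp only [a, hx1, one_mul]
      rw [← div_eq_inv_mul, le_div_iff₀ (Real.sqrt_pos.2 (hq x))]
      have h3 : √(‖grad V x‖ ^ 2 + δ ^ 2) ≤ ‖grad V x‖ + δ := by
        rw [Real.sqrt_le_left (by positivity)]
        nlinarith [norm_nonneg (grad V x)]
      rcases le_or_gt ‖grad V x‖ δ with h4 | h4
      · nlinarith [Real.sqrt_nonneg (‖grad V x‖ ^ 2 + δ ^ 2)]
      · nlinarith [Real.sqrt_nonneg (‖grad V x‖ ^ 2 + δ ^ 2)]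
    have h3 : ∫ x in S, a x * ‖grad V x‖ ^ 2 ≤ ∫ x, a x * ‖grad V x‖ ^ 2 :=
      setIntegral_le_integral hai (Eventually.of_forall fun x => mul_nonneg (ha0 x) (by positivity))
    rw [integral_sub hgS (integrableOn_const hSv.ne), setIntegral_const, smul_eq_mul] at h2
    linarith
  have hmain : ∫ x in S, ‖grad V x‖ ≤ (tv Ω v).toReal := by
    refine le_of_forall_pos_le_add fun ε hε => ?_
    refine (main (ε / (volume.real S + 1)) (by positivity)).trans ?_
    gcongr
    rw [div_mul_eq_mul_div, div_le_iff₀ (by positivity)]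
    nlinarith [measureReal_nonneg (μ := volume) (s := S)]
  calc _ ≤ ∫⁻ x in S, ENNReal.ofReal ‖grad V x‖ := lintegral_mono fun x => by
        rw [← ofReal_norm]
        exact ENNReal.ofReal_le_ofReal (norm_fderiv_le_norm_grad _ _)
    _ = ENNReal.ofReal (∫ x in S, ‖grad V x‖) :=
        (ofReal_integral_eq_lintegral_ofReal hgS
          (Eventually.of_forall fun _ => norm_nonneg _)).symm
    _ ≤ _ := ENNReal.ofReal_le_of_le_toReal hmain

/-! ### The coarea inequality -/

/-- A smooth approximation of the step function at `t`. -/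
def smoothStep (ε t s : ℝ) : ℝ := Real.smoothTransition ((s - t) / ε)

lemma contDiff_smoothTransition_one : ContDiff ℝ 1 Real.smoothTransition :=
  Real.smoothTransition.contDiff

lemma norm_smoothStep_le (ε t s : ℝ) : ‖smoothStep ε t s‖ ≤ 1 := by
  rw [smoothStep, Real.norm_of_nonneg (Real.smoothTransition.nonneg _)]
  exact Real.smoothTransition.le_one _

lemma monotone_smoothTransition : Monotone Real.smoothTransition := Real.smoothTransition.monotone

lemma continuous_deriv_smoothTransition : Continuous (deriv Real.smoothTransition) :=
  contDiff_smoothTransition_one.continuous_deriv le_rfl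

lemma hasDerivAt_smoothTransition (s : ℝ) :
    HasDerivAt Real.smoothTransition (deriv Real.smoothTransition s) s :=
  (contDiff_smoothTransition_one.differentiable one_ne_zero s).hasDerivAt

lemma hasDerivAt_smoothStep (ε t s : ℝ) :
    HasDerivAt (smoothStep ε t) (deriv Real.smoothTransition ((s - t) / ε) / ε) s := by
  have h1 : HasDerivAt (fun s : ℝ => (s - t) / ε) (1 / ε) s :=
    ((hasDerivAt_id s).sub_const t).div_const ε
  have := (hasDerivAt_smoothTransition ((s - t) / ε)).comp s h1
  rwa [mul_one_div] at this

/-- The integrand is the derivative in `t` of `-smoothTransition ((s - t) / ε)`, so the integral is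
a difference of two values in `[0,1]`. -/
lemma lintegral_deriv_smoothStep_le {ε : ℝ} (hε : 0 < ε) (s : ℝ) :
    ∫⁻ t in Icc (0 : ℝ) 1, ENNReal.ofReal (deriv Real.smoothTransition ((s - t) / ε) / ε) ≤ 1 := by
  have hcont : Continuous fun t : ℝ => deriv Real.smoothTransition ((s - t) / ε) / ε := by
    have := continuous_deriv_smoothTransition
    fun_prop
  have hd : ∀ t ∈ uIcc (0 : ℝ) 1, HasDerivAt (fun t => -Real.smoothTransition ((s - t) / ε))
      (deriv Real.smoothTransition ((s - t) / ε) / ε) t := fun t _ => by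
    have h1 : HasDerivAt (fun t : ℝ => (s - t) / ε) (-1 / ε) t :=
      ((hasDerivAt_id t).const_sub s).div_const ε
    have h2 := ((hasDerivAt_smoothTransition ((s - t) / ε)).comp t h1).neg
    have h3 : -(deriv Real.smoothTransition ((s - t) / ε) * (-1 / ε)) =
        deriv Real.smoothTransition ((s - t) / ε) / ε := by ring
    rwa [h3] at h2
  rw [← ofReal_integral_eq_lintegral_ofReal (hcont.integrableOn_Icc)
    (Eventually.of_forall fun t => div_nonneg monotone_smoothTransition.deriv_nonneg hε.le),
    integral_Icc_eq_integral_Ioc, ← intervalIntegral.integral_of_le zero_le_one,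
    intervalIntegral.integral_eq_sub_of_hasDerivAt hd (hcont.intervalIntegrable _ _)]
  rw [← ENNReal.ofReal_one]
  refine ENNReal.ofReal_le_ofReal ?_
  linarith [Real.smoothTransition.le_one ((s - 0) / ε),
    Real.smoothTransition.nonneg ((s - 1) / ε)]

/-- Integration by parts and the chain rule. The density factors into a weight depending on the
level and the gradient of `V`. -/
lemma tv_smoothStep_comp_le {S : Set Plane} {V : Plane → ℝ}
    (hV : ContDiff ℝ 1 V) {ε : ℝ} (hε : 0 < ε) (t : ℝ) :
    tv S (fun x => smoothStep ε t (V x)) ≤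
      ∫⁻ x in S, ENNReal.ofReal (deriv Real.smoothTransition ((V x - t) / ε) / ε) *
        ‖fderiv ℝ V x‖ₑ := by
  refine iSup₂_le fun X hX => ?_
  have hc : ContDiff ℝ 1 fun x => smoothStep ε t (V x) :=
    contDiff_smoothTransition_one.comp ((hV.sub contDiff_const).div_const ε)
  have hf : ∀ x, fderiv ℝ (fun x => smoothStep ε t (V x)) x =
      (deriv Real.smoothTransition ((V x - t) / ε) / ε) • fderiv ℝ V x := fun x =>
    ((hasDerivAt_smoothStep ε t (V x)).comp_hasFDerivAt x
      (hV.differentiable one_ne_zero x).hasFDerivAt).fderiv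
  rw [setIntegral_mul_divergence hX.2.2.1, integral_mul_divergence hc hX.1 hX.2.1, ← integral_neg]
  have e : ∫ x, -(fderiv ℝ (fun x => smoothStep ε t (V x)) x) (X x) =
      ∫ x in S, -(fderiv ℝ (fun x => smoothStep ε t (V x)) x) (X x) := by
    refine (setIntegral_eq_integral_of_forall_compl_eq_zero fun x hx => ?_).symm
    rw [image_eq_zero_of_notMem_tsupport fun h => hx (hX.2.2.1 h), map_zero, neg_zero]
  rw [e]
  refine (Real.ofReal_le_enorm _).trans ((enorm_integral_le_lintegral_enorm _).trans ?_)
  refine lintegral_mono fun x => ?_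
  rw [enorm_neg, hf, smul_apply, enorm_smul,
    Real.enorm_of_nonneg (div_nonneg monotone_smoothTransition.deriv_nonneg hε.le)]
  gcongr
  have h1 : ‖fderiv ℝ V x (X x)‖ ≤ ‖fderiv ℝ V x‖ :=
    (ContinuousLinearMap.le_opNorm _ _).trans
      (mul_le_of_le_one_right (norm_nonneg _) (hX.2.2.2 x))
  rw [← ofReal_norm, ← ofReal_norm]
  exact ENNReal.ofReal_le_ofReal h1

lemma measurable_smoothStep_comp {V : Plane → ℝ} (hV : Measurable V) (ε : ℝ) :
    Measurable fun q : Plane × ℝ => smoothStep ε q.2 (V q.1) :=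
  Real.smoothTransition.continuous.measurable.comp
    (((hV.comp measurable_fst).sub measurable_snd).div_const ε)

lemma measurable_tv_smoothStep_comp (S : Set Plane) {V : Plane → ℝ} (hV : Measurable V) (ε : ℝ) :
    Measurable fun t => tv S fun x => smoothStep ε t (V x) :=
  measurable_tv S (w := fun q : Plane × ℝ => smoothStep ε q.2 (V q.1))
    (measurable_smoothStep_comp hV ε) (C := 1) fun q => norm_smoothStep_le ε q.2 (V q.1)

/-- The coarea inequality in smooth form: after Tonelli the level weights integrate to at most `1`
at each point, and what remains is the gradient of the mollification, bounded by the variation of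
`v`. -/
lemma lintegral_tv_smoothStep_mollify_le {Ω : Set Plane} (hΩ : Bornology.IsBounded Ω) (k : ℕ)
    {v : Plane → ℝ} (hv : Measurable v) {C : ℝ} (hb : ∀ x, ‖v x‖ ≤ C) {ε : ℝ} (hε : 0 < ε) :
    ∫⁻ t in Icc (0 : ℝ) 1, tv (shrink Ω (3 * radius k)) (fun x => smoothStep ε t (mollify k v x)) ≤
      tv Ω v := by
  set V := mollify k v
  have hV : ContDiff ℝ 1 V :=
    (contDiff_mollify k (locallyIntegrable_of_bdd hv hb)).of_le (by norm_num)
  have hVf := hV.continuous_fderiv one_ne_zero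
  calc _ ≤ ∫⁻ t in Icc (0 : ℝ) 1, ∫⁻ x in shrink Ω (3 * radius k),
        ENNReal.ofReal (deriv Real.smoothTransition ((V x - t) / ε) / ε) * ‖fderiv ℝ V x‖ₑ :=
        lintegral_mono fun t => tv_smoothStep_comp_le hV hε t
    _ = ∫⁻ x in shrink Ω (3 * radius k), ∫⁻ t in Icc (0 : ℝ) 1,
        ENNReal.ofReal (deriv Real.smoothTransition ((V x - t) / ε) / ε) * ‖fderiv ℝ V x‖ₑ := by
        refine lintegral_lintegral_swap (Measurable.aemeasurable ?_)
        have h1 := continuous_deriv_smoothTransition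
        have h2 := hV.continuous
        have m1 : Measurable fun q : ℝ × Plane =>
            ENNReal.ofReal (deriv Real.smoothTransition ((V q.2 - q.1) / ε) / ε) := by
          refine ENNReal.measurable_ofReal.comp (Continuous.measurable ?_)
          fun_prop
        have m2 : Measurable fun q : ℝ × Plane => ‖fderiv ℝ V q.2‖ₑ :=
          (hVf.enorm.comp continuous_snd).measurable
        exact m1.mul m2
    _ ≤ ∫⁻ x in shrink Ω (3 * radius k), ‖fderiv ℝ V x‖ₑ := by
        refine lintegral_mono fun x => ?_
        rw [lintegral_mul_const' _ _ enorm_ne_top]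
        exact mul_le_of_le_one_left' (lintegral_deriv_smoothStep_le hε (V x))
    _ ≤ _ := lintegral_fderiv_mollify_le hΩ k hv hb

/-- The mollification is removed at fixed `ε`, by lower semicontinuity at each level and Fatou over
the levels. The passage `ε → 0` is a separate, identical limit. -/
lemma lintegral_tv_smoothStep_le {Ω : Set Plane} (hΩo : IsOpen Ω) (hΩ : Bornology.IsBounded Ω)
    {v : Plane → ℝ} (hv : Measurable v) {C : ℝ} (hb : ∀ x, ‖v x‖ ≤ C) {ε : ℝ} (hε : 0 < ε) :
    ∫⁻ t in Icc (0 : ℝ) 1, tv Ω (fun x => smoothStep ε t (v x)) ≤ tv Ω v := by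
  have hloc := locallyIntegrable_of_bdd hv hb
  have hm : ∀ k, Measurable (mollify k v) := fun k =>
    (contDiff_mollify k hloc).continuous.measurable
  have h1 : ∀ t, tv Ω (fun x => smoothStep ε t (v x)) ≤ liminf (fun k =>
      tv (shrink Ω (3 * radius k)) (fun x => smoothStep ε t (mollify k v x))) atTop := by
    intro t
    refine tv_le_liminf (fun X hX => eventually_mem_testFields_shrink hΩo hX ?_) fun X hX => ?_
    · simpa using tendsto_radius.const_mul 3
    · have hd := integrable_divergence hX.1 hX.2.1
      have hcs : Continuous (smoothStep ε t) :=
        Real.smoothTransition.continuous.comp ((continuous_id.sub continuous_const).div_const ε)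
      refine tendsto_integral_of_dominated_convergence (fun x => ‖divergence X x‖)
        (fun n => (hcs.measurable.comp (hm n)).aestronglyMeasurable.mul
          hd.aestronglyMeasurable) hd.norm
        (fun n => Eventually.of_forall fun x => ?_) ?_
      · rw [norm_mul]
        exact mul_le_of_le_one_left (norm_nonneg _) (norm_smoothStep_le _ _ _)
      · filter_upwards [ae_tendsto_mollify hloc] with x hx
        exact ((hcs.tendsto _).comp hx).mul_const _
  calc _ ≤ ∫⁻ t in Icc (0 : ℝ) 1, liminf (fun k =>
        tv (shrink Ω (3 * radius k)) (fun x => smoothStep ε t (mollify k v x))) atTop :=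
        lintegral_mono h1
    _ ≤ liminf (fun k => ∫⁻ t in Icc (0 : ℝ) 1,
        tv (shrink Ω (3 * radius k)) (fun x => smoothStep ε t (mollify k v x))) atTop :=
        lintegral_liminf_le fun k => measurable_tv_smoothStep_comp _ (hm k) ε
    _ ≤ liminf (fun _ : ℕ => tv Ω v) atTop := liminf_le_liminf
        (Eventually.of_forall fun k => lintegral_tv_smoothStep_mollify_le hΩ k hv hb hε)
    _ = _ := liminf_const _

/-- The hard half of the coarea formula. -/
theorem lintegral_tv_superlevel_le {Ω : Set Plane} (hΩo : IsOpen Ω) (hΩ : Bornology.IsBounded Ω)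
    {v : Plane → ℝ} (hv : Measurable v) {C : ℝ} (hb : ∀ x, ‖v x‖ ≤ C) :
    ∫⁻ t in Icc (0 : ℝ) 1, tv Ω (superlevel v t) ≤ tv Ω v := by
  have hlim : ∀ t x, Tendsto (fun k => smoothStep (radius k) t (v x)) atTop
      (𝓝 (superlevel v t x)) := by
    intro t x
    unfold superlevel
    split_ifs with h
    · refine tendsto_const_nhds.congr' ?_
      filter_upwards [tendsto_radius.eventually_le_const (sub_pos.2 h)] with k hk
      exact (Real.smoothTransition.one_of_one_le ((one_le_div (radius_pos k)).2 hk)).symm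
    · refine tendsto_const_nhds.congr fun k => ?_
      exact (Real.smoothTransition.zero_of_nonpos
        (div_nonpos_of_nonpos_of_nonneg (by linarith) (radius_pos k).le)).symm
  have hm : ∀ (ε t : ℝ), Measurable fun x => smoothStep ε t (v x) := fun ε t =>
    (measurable_smoothStep_comp hv ε).comp (measurable_id.prodMk measurable_const)
  calc _ ≤ ∫⁻ t in Icc (0 : ℝ) 1, liminf (fun k =>
        tv Ω (fun x => smoothStep (radius k) t (v x))) atTop :=
        lintegral_mono fun t => tv_le_liminf_of_ae (C := 1)
          (fun k => (hm (radius k) t).aestronglyMeasurable)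
          (fun k => Eventually.of_forall fun x => norm_smoothStep_le _ _ _)
          (Eventually.of_forall (hlim t))
    _ ≤ liminf (fun k => ∫⁻ t in Icc (0 : ℝ) 1,
        tv Ω (fun x => smoothStep (radius k) t (v x))) atTop :=
        lintegral_liminf_le fun k => measurable_tv_smoothStep_comp _ hv _
    _ ≤ liminf (fun _ : ℕ => tv Ω v) atTop := liminf_le_liminf
        (Eventually.of_forall fun k => lintegral_tv_smoothStep_le hΩo hΩ hv hb (radius_pos k))
    _ = _ := liminf_const _

/-! ### Translation estimates and compactness -/

lemma enorm_sub_le_lintegral_fderiv {V : Plane → ℝ} (hV : ContDiff ℝ 1 V) (x h : Plane) :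
    ‖V (x + h) - V x‖ₑ ≤ ∫⁻ t in Icc (0 : ℝ) 1, ‖fderiv ℝ V (x + t • h)‖ₑ * ‖h‖ₑ := by
  have hd : ∀ t ∈ uIcc (0 : ℝ) 1, HasDerivAt (fun t : ℝ => V (x + t • h))
      (fderiv ℝ V (x + t • h) h) t := fun t _ => by
    have h1 : HasDerivAt (fun t : ℝ => x + t • h) h t := by
      simpa using ((hasDerivAt_id t).smul_const h).const_add x
    exact (hV.differentiable one_ne_zero _).hasFDerivAt.comp_hasDerivAt t h1
  have hcont : Continuous fun t : ℝ => fderiv ℝ V (x + t • h) h := by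
    have := hV.continuous_fderiv one_ne_zero
    fun_prop
  have e := intervalIntegral.integral_eq_sub_of_hasDerivAt hd (hcont.intervalIntegrable _ _)
  simp only [one_smul, zero_smul, add_zero] at e
  rw [← e, intervalIntegral.integral_of_le zero_le_one, ← integral_Icc_eq_integral_Ioc]
  refine (enorm_integral_le_lintegral_enorm _).trans (lintegral_mono fun t => ?_)
  exact ContinuousLinearMap.le_opENorm _ _

lemma setLIntegral_add_right_le {S T : Set Plane} (hS : MeasurableSet S) (hT : MeasurableSet T)
    {h : Plane} (hST : ∀ x ∈ S, x + h ∈ T) (g : Plane → ℝ≥0∞) :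
    ∫⁻ x in S, g (x + h) ≤ ∫⁻ x in T, g x := by
  rw [← lintegral_indicator hS, ← lintegral_indicator hT,
    ← lintegral_add_right_eq_self (T.indicator g) h]
  refine lintegral_mono fun x => ?_
  by_cases hx : x ∈ S
  · rw [indicator_of_mem hx, indicator_of_mem (hST x hx)]
  · rw [indicator_of_notMem hx]
    exact zero_le

/-- Translates of a function of bounded variation. -/
lemma lintegral_translate_sub_le {Ω : Set Plane} (hΩ : Bornology.IsBounded Ω) {v : Plane → ℝ}
    (hv : Measurable v) {C : ℝ} (hb : ∀ x, ‖v x‖ ≤ C) {h : Plane} {s : ℝ} (hs : ‖h‖ < s) :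
    ∫⁻ x in shrink Ω s, ‖v (x + h) - v x‖ₑ ≤ ‖h‖ₑ * tv Ω v := by
  have hloc := locallyIntegrable_of_bdd hv hb
  have hc1 : ∀ k, ContDiff ℝ 1 (mollify k v) := fun k =>
    (contDiff_mollify k hloc).of_le (by norm_num)
  have hae := ae_tendsto_mollify hloc
  have hae' : ∀ᵐ x, Tendsto (fun k => mollify k v (x + h)) atTop (𝓝 (v (x + h))) :=
    (measurePreserving_add_right volume h).quasiMeasurePreserving.ae hae
  have hS := (isOpen_shrink Ω s).measurableSet
  have key : ∀ᶠ k in atTop, ∫⁻ x in shrink Ω s, ‖mollify k v (x + h) - mollify k v x‖ₑ ≤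
      ‖h‖ₑ * tv Ω v := by
    have : Tendsto (fun k => 3 * radius k) atTop (𝓝 0) := by
      simpa using tendsto_radius.const_mul 3
    -- The strict inequality `‖h‖ < s` leaves room, for large `k`, for both the translation and the
    -- margin `3 * radius k` of the gradient bound.
    filter_upwards [this.eventually_le_const (sub_pos.2 hs)] with k hk
    have hf := (hc1 k).continuous_fderiv one_ne_zero
    have hr := radius_pos k
    calc _ ≤ ∫⁻ x in shrink Ω s, ∫⁻ t in Icc (0 : ℝ) 1,
          ‖fderiv ℝ (mollify k v) (x + t • h)‖ₑ * ‖h‖ₑ :=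
          lintegral_mono fun x => enorm_sub_le_lintegral_fderiv (hc1 k) x h
      _ = ∫⁻ t in Icc (0 : ℝ) 1, ∫⁻ x in shrink Ω s,
          ‖fderiv ℝ (mollify k v) (x + t • h)‖ₑ * ‖h‖ₑ := by
          refine lintegral_lintegral_swap (Measurable.aemeasurable ?_)
          have m1 : Continuous fun q : Plane × ℝ => fderiv ℝ (mollify k v) (q.1 + q.2 • h) := by
            fun_prop
          exact m1.enorm.measurable.mul_const _
      _ ≤ ∫⁻ t in Icc (0 : ℝ) 1, ‖h‖ₑ * tv Ω v := by
          refine setLIntegral_mono measurable_const fun t ht => ?_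
          rw [lintegral_mul_const' _ _ enorm_ne_top, mul_comm]
          gcongr
          refine le_trans ?_ (lintegral_fderiv_mollify_le hΩ k hv hb)
          refine setLIntegral_add_right_le hS (isOpen_shrink _ _).measurableSet (fun x hx => ?_)
            (fun y => ‖fderiv ℝ (mollify k v) y‖ₑ)
          refine add_mem_shrink (norm_nonneg h) (by positivity)
            (shrink_anti Ω (by linarith) hx) ?_
          rw [norm_smul, Real.norm_of_nonneg ht.1]
          exact mul_le_of_le_one_left (norm_nonneg _) ht.2
      _ = _ := by simp
  calc _ ≤ ∫⁻ x in shrink Ω s, liminf (fun k => ‖mollify k v (x + h) - mollify k v x‖ₑ) atTop := by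
        refine lintegral_mono_ae (ae_restrict_of_ae ?_)
        filter_upwards [hae, hae'] with x h1 h2
        exact ((h2.sub h1).enorm.liminf_eq).ge
    _ ≤ liminf (fun k => ∫⁻ x in shrink Ω s, ‖mollify k v (x + h) - mollify k v x‖ₑ) atTop := by
        refine lintegral_liminf_le fun k => ?_
        have := (hc1 k).continuous
        have h2 : Continuous fun x => mollify k v (x + h) - mollify k v x := by fun_prop
        exact h2.enorm.measurable
    _ ≤ liminf (fun _ : ℕ => ‖h‖ₑ * tv Ω v) atTop := liminf_le_liminf key
    _ = _ := liminf_const _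

lemma lintegral_bump (k : ℕ) : ∫⁻ h, ENNReal.ofReal ((bump k).normed volume h) = 1 := by
  rw [← ofReal_integral_eq_lintegral_ofReal (bump k).integrable_normed
    (Eventually.of_forall fun h => (bump k).nonneg_normed h), (bump k).integral_normed,
    ENNReal.ofReal_one]

/-- The mollification error is an average of translation differences over `‖h‖ ≤ radius k`. The
resulting rate depends on `v` only through its variation, and this uniformity drives the compactness
theorem. -/
lemma lintegral_mollify_sub_le {Ω : Set Plane} (hΩ : Bornology.IsBounded Ω) (k : ℕ)
    {v : Plane → ℝ} (hv : Measurable v) {C : ℝ} (hb : ∀ x, ‖v x‖ ≤ C) :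
    ∫⁻ x in shrink Ω (2 * radius k), ‖mollify k v x - v x‖ₑ ≤
      ENNReal.ofReal (radius k) * tv Ω v := by
  have hr := radius_pos k
  have hρ := (bump k).integrable_normed (μ := (volume : Measure Plane))
  have hi : ∀ x, Integrable (fun h => (bump k).normed volume h * v (x - h)) volume := fun x =>
    (hρ.bdd_mul (f := fun h => v (x - h)) (c := C)
      (hv.comp (measurable_const.sub measurable_id)).aestronglyMeasurable
      (Eventually.of_forall fun _ => hb _)).congr (Eventually.of_forall fun _ => mul_comm _ _)
  have h1 : ∀ x, ‖mollify k v x - v x‖ₑ ≤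
      ∫⁻ h, ENNReal.ofReal ((bump k).normed volume h) * ‖v (x + -h) - v x‖ₑ := fun x => by
    have : mollify k v x - v x = ∫ h, (bump k).normed volume h * (v (x + -h) - v x) := by
      simp_rw [mul_sub, ← sub_eq_add_neg]
      rw [integral_sub (hi x) (hρ.mul_const _), integral_mul_const, (bump k).integral_normed,
        one_mul]
      rfl
    rw [this]
    refine (enorm_integral_le_lintegral_enorm _).trans (lintegral_mono fun h => ?_)
    rw [enorm_mul, Real.enorm_of_nonneg ((bump k).nonneg_normed h)]
  calc _ ≤ ∫⁻ x in shrink Ω (2 * radius k),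
        ∫⁻ h, ENNReal.ofReal ((bump k).normed volume h) * ‖v (x + -h) - v x‖ₑ :=
        lintegral_mono h1
    _ = ∫⁻ h, ∫⁻ x in shrink Ω (2 * radius k),
        ENNReal.ofReal ((bump k).normed volume h) * ‖v (x + -h) - v x‖ₑ := by
        refine lintegral_lintegral_swap (Measurable.aemeasurable ?_)
        have m1 : Measurable fun q : Plane × Plane =>
            ENNReal.ofReal ((bump k).normed volume q.2) :=
          ENNReal.measurable_ofReal.comp ((bump k).continuous_normed.measurable.comp measurable_snd)
        have m2 : Measurable fun q : Plane × Plane => ‖v (q.1 + -q.2) - v q.1‖ₑ :=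
          ((hv.comp (measurable_fst.add measurable_snd.neg)).sub (hv.comp measurable_fst)).enorm
        exact m1.mul m2
    _ ≤ ∫⁻ h, ENNReal.ofReal ((bump k).normed volume h) *
        (ENNReal.ofReal (radius k) * tv Ω v) := by
        refine lintegral_mono fun h => ?_
        rw [lintegral_const_mul' _ _ ENNReal.ofReal_ne_top]
        rcases le_or_gt ‖h‖ (radius k) with hh | hh
        · gcongr
          refine (lintegral_translate_sub_le hΩ hv hb (h := -h) ?_).trans ?_
          · rw [norm_neg]; linarith
          · gcongr
            rw [enorm_neg, ← ofReal_norm]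
            exact ENNReal.ofReal_le_ofReal hh
        · simp [bump_eq_zero hh]
    _ = _ := by
        have m1 : Measurable fun h => ENNReal.ofReal ((bump k).normed volume h) :=
          ENNReal.measurable_ofReal.comp (bump k).continuous_normed.measurable
        rw [lintegral_mul_const _ m1, lintegral_bump, one_mul]

lemma iUnion_shrink {Ω : Set Plane} (hΩ : IsOpen Ω) (c : ℝ) :
    ⋃ k, shrink Ω (c * radius k) = Ω := by
  refine Subset.antisymm (iUnion_subset fun k => shrink_subset _ _) fun x hx => ?_
  obtain ⟨δ, hδ, h⟩ := exists_subset_shrink hΩ (isCompact_singleton (x := x)) (by simpa using hx)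
  have ht : Tendsto (fun k => c * radius k) atTop (𝓝 0) := by
    simpa using tendsto_radius.const_mul c
  obtain ⟨k, hk⟩ := (ht.eventually_le_const hδ).exists
  exact mem_iUnion.2 ⟨k, h _ hk rfl⟩

lemma tendsto_volume_diff_shrink {Ω : Set Plane} (hΩo : IsOpen Ω) (hΩ : Bornology.IsBounded Ω)
    {c : ℝ} (hc : 0 < c) :
    Tendsto (fun k => volume (Ω \ shrink Ω (c * radius k))) atTop (𝓝 0) := by
  have hanti : Antitone fun k => Ω \ shrink Ω (c * radius k) := by
    intro k l hkl
    refine sdiff_subset_sdiff_right (shrink_anti Ω ?_)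
    have : radius l ≤ radius k := Nat.one_div_le_one_div hkl
    gcongr
  have h := tendsto_measure_iInter_atTop (μ := volume) (s := fun k => Ω \ shrink Ω (c * radius k))
    (fun k => (hΩo.measurableSet.diff (isOpen_shrink _ _).measurableSet).nullMeasurableSet) hanti
    ⟨0, (measure_mono sdiff_subset |>.trans_lt hΩ.measure_lt_top).ne⟩
  have e : ⋂ k, Ω \ shrink Ω (c * radius k) = ∅ := by
    rw [← sdiff_iUnion, iUnion_shrink hΩo c, sdiff_self]
  rwa [e, measure_empty] at h

lemma memLp_of_bdd {α : Type*} [MeasurableSpace α] {μ : Measure α} {S : Set α}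
    (hS : μ S ≠ ∞) (hSm : MeasurableSet S) {v : α → ℝ} (hv : AEStronglyMeasurable v μ) {C : ℝ}
    (hb : ∀ x, ‖v x‖ ≤ C) (h0 : ∀ x ∉ S, v x = 0) (p : ℝ≥0∞) : MemLp v p μ := by
  have : MemLp (S.indicator fun _ => C) p μ := memLp_indicator_const p hSm C (Or.inr hS)
  refine this.mono hv (Eventually.of_forall fun x => ?_)
  by_cases hx : x ∈ S
  · rw [indicator_of_mem hx]
    exact (hb x).trans (le_abs_self _)
  · rw [h0 x hx, indicator_of_notMem hx]

/-- Bounded sequences in a separable Hilbert space have weakly convergent subsequences. -/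
lemma exists_subseq_tendsto_inner {H : Type*} [NormedAddCommGroup H] [InnerProductSpace ℝ H]
    [CompleteSpace H] [TopologicalSpace.SeparableSpace H] (u : ℕ → H) {C : ℝ}
    (hu : ∀ n, ‖u n‖ ≤ C) :
    ∃ w : H, ∃ σ : ℕ → ℕ, StrictMono σ ∧
      ∀ g, Tendsto (fun n => inner ℝ (u (σ n)) g) atTop (𝓝 (inner ℝ w g)) := by
  have hs := WeakDual.isSeqCompact_closedBall ℝ H (0 : StrongDual ℝ H) C
  obtain ⟨l, _, σ, hσ, hl⟩ := hs (x := fun n =>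
    StrongDual.toWeakDual (InnerProductSpace.toDual ℝ H (u n))) fun n => by
      simpa using hu n
  refine ⟨(InnerProductSpace.toDual ℝ H).symm (WeakDual.toStrongDual l), σ, hσ, fun g => ?_⟩
  have := ((WeakDual.eval_continuous g).tendsto l).comp hl
  rw [InnerProductSpace.toDual_symm_apply]
  exact this

lemma mollify_eq_integral_mul (k : ℕ) (v : Plane → ℝ) (x : Plane) :
    mollify k v x = ∫ y, v y * (bump k).normed volume (x - y) := by
  rw [mollify, ← integral_sub_left_eq_self _ volume x]
  congr 1 with y
  rw [sub_sub_cancel, mul_comm]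

/-- A uniformly bounded sequence supported in a set of finite measure has a subsequence all of
whose mollifications converge pointwise. -/
lemma exists_subseq_tendsto_mollify {Ω : Set Plane} (hΩo : IsOpen Ω)
    (hΩ : Bornology.IsBounded Ω) (w : ℕ → Plane → ℝ) (hw : ∀ n, Measurable (w n))
    (hb : ∀ n x, ‖w n x‖ ≤ 1) (h0 : ∀ n, ∀ x ∉ Ω, w n x = 0) :
    ∃ σ : ℕ → ℕ, StrictMono σ ∧ ∃ L : ℕ → Plane → ℝ,
      ∀ k x, Tendsto (fun n => mollify k (w (σ n)) x) atTop (𝓝 (L k x)) := by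
  have : Fact ((2 : ℝ≥0∞) ≠ ∞) := ⟨ENNReal.ofNat_ne_top⟩
  have hm : ∀ n, MemLp (w n) 2 volume := fun n =>
    memLp_of_bdd hΩ.measure_lt_top.ne hΩo.measurableSet (hw n).aestronglyMeasurable (hb n) (h0 n) 2
  have h1 : MemLp (Ω.indicator fun _ => (1 : ℝ)) 2 volume :=
    memLp_indicator_const 2 hΩo.measurableSet 1 (Or.inr hΩ.measure_lt_top.ne)
  obtain ⟨f, σ, hσ, hf⟩ := exists_subseq_tendsto_inner (fun n => (hm n).toLp (w n))
    (C := ‖h1.toLp _‖) fun n => by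
      refine Lp.norm_le_norm_of_ae_le ?_
      filter_upwards [(hm n).coeFn_toLp, h1.coeFn_toLp] with x e1 e2
      rw [e1, e2]
      by_cases hx : x ∈ Ω
      · rw [indicator_of_mem hx]
        simpa using hb n x
      · simp [h0 n x hx, hx]
  have hg : ∀ k x, MemLp (fun y => (bump k).normed volume (x - y)) 2
      (volume : Measure Plane) := fun k x => by
    have hc : Continuous fun y => (bump k).normed volume (x - y) :=
      (bump k).continuous_normed.comp (continuous_const.sub continuous_id)
    refine hc.memLp_of_hasCompactSupport ?_
    exact (bump k).hasCompactSupport_normed.comp_homeomorph (Homeomorph.subLeft x)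
  -- The value of a mollification at `x` is the `L²` inner product with a fixed kernel, so weak
  -- convergence becomes pointwise convergence.
  refine ⟨σ, hσ, fun k x => inner ℝ f ((hg k x).toLp _), fun k x => ?_⟩
  refine (hf ((hg k x).toLp _)).congr fun n => ?_
  rw [L2.inner_def, mollify_eq_integral_mul]
  refine integral_congr_ae ?_
  filter_upwards [(hm (σ n)).coeFn_toLp, (hg k x).coeFn_toLp] with y e1 e2
  rw [e1, e2]
  simp [mul_comm]

/-- Compactness: a sequence of `[0,1]`-valued functions of uniformly bounded variation has an
a.e. convergent subsequence. -/
theorem exists_subseq_ae_tendsto {Ω : Set Plane} (hΩo : IsOpen Ω) (hΩ : Bornology.IsBounded Ω)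
    (v : ℕ → Plane → ℝ) (hv : ∀ n, Measurable (v n)) (h01 : ∀ n x, v n x ∈ Icc (0 : ℝ) 1)
    {K : ℝ≥0∞} (hK : K ≠ ∞) (ht : ∀ n, tv Ω (v n) ≤ K) :
    ∃ u : Plane → ℝ, Measurable u ∧ (∀ x, u x ∈ Icc (0 : ℝ) 1) ∧
      ∃ σ : ℕ → ℕ, StrictMono σ ∧
        ∀ᵐ x ∂volume.restrict Ω, Tendsto (fun n => v (σ n) x) atTop (𝓝 (u x)) := by
  let w : ℕ → Plane → ℝ := fun n => Ω.indicator (v n)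
  have hw : ∀ n, Measurable (w n) := fun n => (hv n).indicator hΩo.measurableSet
  have hb : ∀ n x, ‖w n x‖ ≤ 1 := fun n x => by
    refine (norm_indicator_le_norm_self _ _).trans ?_
    rw [Real.norm_of_nonneg (h01 n x).1]
    exact (h01 n x).2
  have h0 : ∀ n, ∀ x ∉ Ω, w n x = 0 := fun n x hx => indicator_of_notMem hx _
  have htw : ∀ n, tv Ω (w n) ≤ K := fun n => by
    refine le_of_eq_of_le (tv_congr ?_) (ht n)
    filter_upwards [ae_restrict_mem hΩo.measurableSet] with x hx
    exact indicator_of_mem hx _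
  obtain ⟨σ, hσ, L, hL⟩ := exists_subseq_tendsto_mollify hΩo hΩ w hw hb h0
  let S : ℕ → Set Plane := fun k => shrink Ω (2 * radius k)
  have hSm : ∀ k, MeasurableSet (S k) := fun k => (isOpen_shrink _ _).measurableSet
  have hcm : ∀ k n, Measurable (mollify k (w n)) := fun k n =>
    (contDiff_mollify k (locallyIntegrable_of_bdd (hw n) (hb n))).continuous.measurable
  have hLm : ∀ k, Measurable (L k) := fun k =>
    measurable_of_tendsto_metrizable (fun n => hcm k (σ n)) (tendsto_pi_nhds.2 (hL k))
  have hLb : ∀ k x, ‖L k x‖ ≤ 1 := fun k x =>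
    le_of_tendsto (hL k x).norm (Eventually.of_forall fun n => norm_mollify_le k (hb _) x)
  have hD : ∀ k, Tendsto (fun n => ∫⁻ x in S k, ‖mollify k (w (σ n)) x - L k x‖ₑ) atTop
      (𝓝 0) := by
    intro k
    have := tendsto_lintegral_of_dominated_convergence (μ := volume.restrict (S k))
      (F := fun n x => ‖mollify k (w (σ n)) x - L k x‖ₑ) (f := fun _ => 0) (fun _ => 2)
      (fun n => ((hcm k (σ n)).sub (hLm k)).enorm)
      (fun n => Eventually.of_forall fun x => by
        change ‖mollify k (w (σ n)) x - L k x‖ₑ ≤ 2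
        rw [← ofReal_norm, ← ENNReal.ofReal_ofNat 2]
        refine ENNReal.ofReal_le_ofReal ((norm_sub_le _ _).trans ?_)
        linarith [norm_mollify_le k (hb (σ n)) x, hLb k x])
      (by
        rw [lintegral_const, Measure.restrict_apply_univ]
        exact ENNReal.mul_ne_top ENNReal.ofNat_ne_top
          ((measure_mono (shrink_subset _ _)).trans_lt hΩ.measure_lt_top).ne)
      (Eventually.of_forall fun x => by
        simpa using ((hL k x).sub_const (L k x)).enorm)
    simpa using this
  have hm : ∀ n, MemLp (w n) 1 volume := fun n =>
    memLp_of_bdd hΩ.measure_lt_top.ne hΩo.measurableSet (hw n).aestronglyMeasurable (hb n) (h0 n) 1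
  let f : ℕ → Lp ℝ 1 (volume : Measure Plane) := fun n => (hm (σ n)).toLp _
  -- The `L¹` distance splits into two mollification errors on the inner set, uniform in the index,
  -- the volume of the boundary layer, and the distances of the mollified functions to their common
  -- limit. The first two are made small by `k`, the last by `n` and `m`.
  have hedist : ∀ k n m, edist (f n) (f m) ≤ (2 * (ENNReal.ofReal (radius k) * K) +
      volume (Ω \ S k)) + ((∫⁻ x in S k, ‖mollify k (w (σ n)) x - L k x‖ₑ) +
      ∫⁻ x in S k, ‖mollify k (w (σ m)) x - L k x‖ₑ) := by
    intro k n m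
    have hmol : ∀ n, ∫⁻ x in S k, ‖mollify k (w n) x - w n x‖ₑ ≤
        ENNReal.ofReal (radius k) * K := fun n =>
      (lintegral_mollify_sub_le hΩ k (hw n) (hb n)).trans (by gcongr; exact htw n)
    rw [Lp.edist_toLp_toLp, eLpNorm_one_eq_lintegral_enorm]
    have e : ∫⁻ x, ‖(w (σ n) - w (σ m)) x‖ₑ =
        (∫⁻ x in S k, ‖(w (σ n) - w (σ m)) x‖ₑ) +
          ∫⁻ x in Ω \ S k, ‖(w (σ n) - w (σ m)) x‖ₑ := by
      rw [← lintegral_union (hΩo.measurableSet.diff (hSm k)) disjoint_sdiff_right,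
        union_sdiff_cancel (shrink_subset _ _)]
      refine (setLIntegral_eq_of_support_subset fun x hx => ?_).symm
      by_contra h
      apply hx
      simp [h0 _ x h]
    have e1 : ∫⁻ x in Ω \ S k, ‖(w (σ n) - w (σ m)) x‖ₑ ≤ volume (Ω \ S k) := by
      rw [← setLIntegral_one]
      refine setLIntegral_mono measurable_const fun x hx => ?_
      rw [← ofReal_norm, ← ENNReal.ofReal_one]
      refine ENNReal.ofReal_le_ofReal ?_
      have h1 := h01 (σ n) x
      have h2 := h01 (σ m) x
      simp only [w, Pi.sub_apply, indicator_of_mem hx.1, Real.norm_eq_abs, abs_le]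
      constructor <;> linarith [h1.1, h1.2, h2.1, h2.2]
    have e2 : ∫⁻ x in S k, ‖(w (σ n) - w (σ m)) x‖ₑ ≤
        ∫⁻ x in S k, (‖mollify k (w (σ n)) x - w (σ n) x‖ₑ +
          ‖mollify k (w (σ m)) x - w (σ m) x‖ₑ) + (‖mollify k (w (σ n)) x - L k x‖ₑ +
          ‖mollify k (w (σ m)) x - L k x‖ₑ) := by
      refine lintegral_mono fun x => ?_
      have : (w (σ n) - w (σ m)) x = (-(mollify k (w (σ n)) x - w (σ n) x) +
          (mollify k (w (σ m)) x - w (σ m) x)) + ((mollify k (w (σ n)) x - L k x) +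
          -(mollify k (w (σ m)) x - L k x)) := by
        simp only [Pi.sub_apply]; ring
      rw [this]
      refine (enorm_add_le _ _).trans ?_
      gcongr <;> refine (enorm_add_le _ _).trans ?_ <;> rw [enorm_neg]
    have m1 : ∀ n, Measurable fun x => ‖mollify k (w n) x - w n x‖ₑ := fun n =>
      ((hcm k n).sub (hw n)).enorm
    have m2 : ∀ n, Measurable fun x => ‖mollify k (w n) x - L k x‖ₑ := fun n =>
      ((hcm k n).sub (hLm k)).enorm
    have m3 : Measurable fun x => ‖mollify k (w (σ n)) x - w (σ n) x‖ₑ +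
        ‖mollify k (w (σ m)) x - w (σ m) x‖ₑ := (m1 _).add (m1 _)
    rw [lintegral_add_left m3, lintegral_add_left (m1 _),
      lintegral_add_left (m2 _)] at e2
    rw [e]
    calc _ ≤ ((ENNReal.ofReal (radius k) * K + ENNReal.ofReal (radius k) * K) + _) +
          volume (Ω \ S k) := add_le_add (e2.trans
            (add_le_add (add_le_add (hmol _) (hmol _)) le_rfl)) e1
      _ = _ := by rw [two_mul]; abel
  have hcau : CauchySeq f := by
    refine EMetric.cauchySeq_iff.2 fun ε hε => ?_
    have ht : Tendsto (fun k => 2 * (ENNReal.ofReal (radius k) * K) + volume (Ω \ S k)) atTop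
        (𝓝 0) := by
      have t1 : Tendsto (fun k => ENNReal.ofReal (radius k)) atTop (𝓝 0) := by
        simpa [Function.comp_def] using
          (ENNReal.continuous_ofReal.tendsto 0).comp tendsto_radius
      have t2 := ENNReal.Tendsto.mul_const t1 (Or.inr hK)
      have t3 := ENNReal.Tendsto.const_mul t2 (a := 2) (Or.inr ENNReal.ofNat_ne_top)
      simpa using t3.add (tendsto_volume_diff_shrink hΩo hΩ (c := 2) two_pos)
    have hε2 : (0 : ℝ≥0∞) < ε / 2 / 2 := ENNReal.half_pos (ENNReal.half_pos hε.ne').ne'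
    obtain ⟨k, hk⟩ := (ht.eventually_lt_const (ENNReal.half_pos hε.ne')).exists
    obtain ⟨N, hN⟩ := eventually_atTop.1 ((hD k).eventually_lt_const hε2)
    refine ⟨N, fun n hn m hm => (hedist k n m).trans_lt ?_⟩
    calc _ < ε / 2 + (ε / 2 / 2 + ε / 2 / 2) :=
          ENNReal.add_lt_add hk (ENNReal.add_lt_add (hN n hn) (hN m hm))
      _ = ε := by rw [ENNReal.add_halves, ENNReal.add_halves]
  obtain ⟨F, hF⟩ := cauchySeq_tendsto_of_complete hcau
  obtain ⟨τ, hτ, hae⟩ := (tendstoInMeasure_of_tendsto_Lp hF).exists_seq_tendsto_ae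
  have hae' : ∀ᵐ x, Tendsto (fun n => w (σ (τ n)) x) atTop (𝓝 (F x)) := by
    filter_upwards [hae, ae_all_iff.2 fun n => (hm (σ (τ n))).coeFn_toLp] with x hx h1
    exact hx.congr fun n => h1 n
  -- Truncation provides values in `[0,1]` at every point without changing the limit almost
  -- everywhere on `Ω`.
  refine ⟨fun x => max 0 (min 1 (F x)), ?_, fun x => ⟨le_max_left _ _, ?_⟩, σ ∘ τ, hσ.comp hτ, ?_⟩
  · exact measurable_const.max (measurable_const.min (Lp.stronglyMeasurable F).measurable)
  · exact max_le zero_le_one (min_le_left _ _)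
  · filter_upwards [ae_restrict_of_ae hae', ae_restrict_mem hΩo.measurableSet] with x hx hxΩ
    have h2 : Tendsto (fun n => v (σ (τ n)) x) atTop (𝓝 (F x)) :=
      hx.congr fun n => indicator_of_mem hxΩ _
    have h3 : F x ∈ Icc (0 : ℝ) 1 := isClosed_Icc.mem_of_tendsto h2
      (Eventually.of_forall fun n => h01 _ x)
    rwa [min_eq_right h3.2, max_eq_right h3.1]

/-! ### Kantorovich duality -/

/-- Continuous admissible potentials. -/
def contDual (c : Gray → Gray → ℝ) : Set ((Gray → ℝ) × (Gray → ℝ)) :=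
  {p | Continuous p.1 ∧ Continuous p.2 ∧ ∀ γ₁ γ₂, p.1 γ₁ - p.2 γ₂ ≤ c γ₁ γ₂}

lemma integrable_of_continuous {α : Type*} [TopologicalSpace α] [CompactSpace α]
    [MeasurableSpace α] [BorelSpace α] [SecondCountableTopology α] {μ : Measure α}
    [IsFiniteMeasure μ] {g : α → ℝ} (hg : Continuous g) : Integrable g μ := by
  obtain ⟨C, hC⟩ := isCompact_univ.exists_bound_of_continuousOn hg.continuousOn
  exact Integrable.of_bound hg.aestronglyMeasurable C
    (Eventually.of_forall fun x => hC x (mem_univ x))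

lemma contDual_subset (c : Gray → Gray → ℝ) : contDual c ⊆ dualSet c := fun _ hp =>
  ⟨hp.1.measurable, hp.2.1.measurable, integrable_of_continuous hp.1,
    integrable_of_continuous hp.2.1, hp.2.2⟩

lemma lintegral_sub_lintegral_eq_coe {α : Type*} [MeasurableSpace α] {μ : Measure α} {g : α → ℝ}
    (hg : Integrable g μ) :
    ((∫⁻ a, ENNReal.ofReal (g a) ∂μ : ℝ≥0∞) : EReal) -
      ((∫⁻ a, ENNReal.ofReal (-g a) ∂μ : ℝ≥0∞) : EReal) = ((∫ a, g a ∂μ : ℝ) : EReal) := by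
  rw [integral_eq_lintegral_pos_part_sub_lintegral_neg_part hg, EReal.coe_sub,
    EReal.coe_ennreal_toReal hg.lintegral_lt_top.ne,
    EReal.coe_ennreal_toReal (x := ∫⁻ a, ENNReal.ofReal (-g a) ∂μ) hg.neg.lintegral_lt_top.ne]

lemma dualValue_eq_coe {μ μ' : Measure Gray} {p : (Gray → ℝ) × (Gray → ℝ)}
    (h1 : Integrable p.1 μ) (h2 : Integrable p.2 μ') :
    dualValue μ μ' p = ((∫ γ, p.1 γ ∂μ - ∫ γ, p.2 γ ∂μ' : ℝ) : EReal) := by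
  have a1 := h1.lintegral_lt_top.ne
  have a2 := h1.neg.lintegral_lt_top.ne
  have b1 := h2.lintegral_lt_top.ne
  have b2 := h2.neg.lintegral_lt_top.ne
  simp only [Pi.neg_apply] at a2 b2
  rw [dualValue, integral_eq_lintegral_pos_part_sub_lintegral_neg_part h1,
    integral_eq_lintegral_pos_part_sub_lintegral_neg_part h2,
    ← EReal.coe_ennreal_toReal (ENNReal.add_ne_top.2 ⟨a1, b2⟩),
    ← EReal.coe_ennreal_toReal (ENNReal.add_ne_top.2 ⟨a2, b1⟩), ENNReal.toReal_add a1 b2,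
    ENNReal.toReal_add a2 b1, ← EReal.coe_sub]
  congr 1
  ring

lemma exists_lower_bound {c : Gray → Gray → ℝ}
    (hc : LowerSemicontinuous (fun p : Gray × Gray => c p.1 p.2)) :
    ∃ m : ℝ, ∀ γ₁ γ₂, m ≤ c γ₁ γ₂ := by
  obtain ⟨a, _, ha⟩ := LowerSemicontinuousOn.exists_isMinOn (s := univ) univ_nonempty
    isCompact_univ (hc.lowerSemicontinuousOn univ)
  exact ⟨c a.1 a.2, fun γ₁ γ₂ => ha (mem_univ (γ₁, γ₂))⟩

lemma const_mem_contDual {c : Gray → Gray → ℝ} {m : ℝ} (hm : ∀ γ₁ γ₂, m ≤ c γ₁ γ₂) :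
    ((fun _ => m, fun _ => 0) : (Gray → ℝ) × (Gray → ℝ)) ∈ contDual c :=
  ⟨continuous_const, continuous_const, fun γ₁ γ₂ => by simpa using hm γ₁ γ₂⟩

/-- Weak duality. -/
lemma dualValue_le_transportCost {c : Gray → Gray → ℝ}
    (hc : LowerSemicontinuous (fun p : Gray × Gray => c p.1 p.2)) {μ μ' : Measure Gray}
    {p : (Gray → ℝ) × (Gray → ℝ)} (hp : p ∈ dualSet c) :
    dualValue μ μ' p ≤ transportCost c μ μ' := by
  refine le_iInf₂ fun π hπ => ?_
  obtain ⟨hπ1, hμ, hμ'⟩ := hπ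
  obtain ⟨m, hm⟩ := exists_lower_bound hc
  have hcm : Measurable fun q : Gray × Gray => c q.1 q.2 := hc.measurable
  have l1 : ∀ g : Gray → ℝ, Measurable g → ∫⁻ γ, ENNReal.ofReal (g γ) ∂μ =
      ∫⁻ q, ENNReal.ofReal (g q.1) ∂π := fun g hg => by
    rw [← hμ, lintegral_map hg.ennreal_ofReal measurable_fst]
  have l2 : ∀ g : Gray → ℝ, Measurable g → ∫⁻ γ, ENNReal.ofReal (g γ) ∂μ' =
      ∫⁻ q, ENNReal.ofReal (g q.2) ∂π := fun g hg => by
    rw [← hμ', lintegral_map hg.ennreal_ofReal measurable_snd]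
  have hp1 := hp.1
  have hp2 := hp.2.1
  rw [dualValue, l1 _ hp1, l1 (fun γ => -p.1 γ) hp1.neg, l2 _ hp2, l2 (fun γ => -p.2 γ) hp2.neg]
  -- The constraint `ψ - ψ' ≤ c` with all negative parts moved across, so that it can be integrated
  -- in `[0,∞]` without any integrability assumption.
  have key : ((∫⁻ q, ENNReal.ofReal (p.1 q.1) ∂π) + ∫⁻ q, ENNReal.ofReal (-p.2 q.2) ∂π) +
      (∫⁻ q, ENNReal.ofReal (-c q.1 q.2) ∂π) ≤ (∫⁻ q, ENNReal.ofReal (c q.1 q.2) ∂π) +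
      ((∫⁻ q, ENNReal.ofReal (-p.1 q.1) ∂π) + ∫⁻ q, ENNReal.ofReal (p.2 q.2) ∂π) := by
    have m1 : Measurable fun q : Gray × Gray => ENNReal.ofReal (p.1 q.1) :=
      (hp1.comp measurable_fst).ennreal_ofReal
    have m1' : Measurable fun q : Gray × Gray => ENNReal.ofReal (-p.1 q.1) :=
      (hp1.comp measurable_fst).neg.ennreal_ofReal
    have m2 : Measurable fun q : Gray × Gray => ENNReal.ofReal (-p.2 q.2) :=
      (hp2.comp measurable_snd).neg.ennreal_ofReal
    have m12 : Measurable fun q : Gray × Gray =>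
      ENNReal.ofReal (p.1 q.1) + ENNReal.ofReal (-p.2 q.2) := m1.add m2
    rw [← lintegral_add_left m1, ← lintegral_add_left m12, ← lintegral_add_left m1',
      ← lintegral_add_left hcm.ennreal_ofReal]
    refine lintegral_mono fun q => ?_
    have h1 := hp.2.2.2.2 q.1 q.2
    simp only [ENNReal.ofReal]
    norm_cast
    rw [← NNReal.coe_le_coe]
    push_cast
    simp only [Real.coe_toNNReal']
    rcases le_total (p.1 q.1) 0 with h | h <;> rcases le_total (p.2 q.2) 0 with h' | h' <;>
      rcases le_total (c q.1 q.2) 0 with h'' | h'' <;>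
      simp [h, h', h''] <;> linarith
  have hCn : ∫⁻ q, ENNReal.ofReal (-c q.1 q.2) ∂π ≠ ∞ := by
    refine ne_top_of_le_ne_top ?_ (lintegral_mono (g := fun _ => ENNReal.ofReal (-m))
      fun q => ENNReal.ofReal_le_ofReal (neg_le_neg (hm q.1 q.2)))
    simp
  generalize ((∫⁻ q, ENNReal.ofReal (p.1 q.1) ∂π) + ∫⁻ q, ENNReal.ofReal (-p.2 q.2) ∂π) = P at *
  generalize ((∫⁻ q, ENNReal.ofReal (-p.1 q.1) ∂π) + ∫⁻ q, ENNReal.ofReal (p.2 q.2) ∂π) = N at *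
  generalize (∫⁻ q, ENNReal.ofReal (c q.1 q.2) ∂π) = A at *
  generalize (∫⁻ q, ENNReal.ofReal (-c q.1 q.2) ∂π) = B at *
  -- An infinite negative part makes the dual value `-∞` by convention. If `N` and the cost are
  -- finite, the integrated inequality forces `P` to be finite and can be subtracted.
  rcases eq_or_ne N ∞ with hN | hN
  · simp [hN]
  rcases eq_or_ne A ∞ with hA | hA
  · rw [hA, ← EReal.coe_ennreal_toReal hCn]
    simp
  have hP : P ≠ ∞ := by
    rintro rfl
    simp [hA, hN] at key
  rw [← EReal.coe_ennreal_toReal hCn, ← EReal.coe_ennreal_toReal hA,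
    ← EReal.coe_ennreal_toReal hN, ← EReal.coe_ennreal_toReal hP, ← EReal.coe_sub,
    ← EReal.coe_sub, EReal.coe_le_coe_iff]
  have := ENNReal.toReal_mono (ENNReal.add_ne_top.2 ⟨hA, hN⟩) key
  rw [ENNReal.toReal_add hP hCn, ENNReal.toReal_add hA hN] at this
  linarith

/-- Lipschitz regularisation (Pasch–Hausdorff envelope). -/
def lipReg {α : Type*} [PseudoMetricSpace α] (g : α → ℝ) (k : ℕ) (p : α) : ℝ :=
  ⨅ q, (g q + k * dist p q)

lemma bddBelow_lipReg {α : Type*} [PseudoMetricSpace α] {g : α → ℝ} {m : ℝ} (hm : ∀ q, m ≤ g q)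
    (k : ℕ) (p : α) : BddBelow (range fun q => g q + k * dist p q) :=
  ⟨m, by rintro _ ⟨q, rfl⟩; exact le_add_of_le_of_nonneg (hm q) (by positivity)⟩

lemma lipReg_le {α : Type*} [PseudoMetricSpace α] {g : α → ℝ} {m : ℝ} (hm : ∀ q, m ≤ g q)
    (k : ℕ) (p : α) : lipReg g k p ≤ g p :=
  (ciInf_le (bddBelow_lipReg hm k p) p).trans (by simp)

lemma le_lipReg {α : Type*} [PseudoMetricSpace α] {g : α → ℝ} {m : ℝ} (hm : ∀ q, m ≤ g q)
    (k : ℕ) (p : α) : m ≤ lipReg g k p :=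
  have : Nonempty α := ⟨p⟩
  le_ciInf fun q => le_add_of_le_of_nonneg (hm q) (by positivity)

lemma continuous_lipReg {α : Type*} [PseudoMetricSpace α] {g : α → ℝ} {m : ℝ}
    (hm : ∀ q, m ≤ g q) (k : ℕ) : Continuous (lipReg g k) := by
  refine (LipschitzWith.of_le_add_mul (k : NNReal) fun x y => ?_).continuous
  have : Nonempty α := ⟨x⟩
  rw [← sub_le_iff_le_add]
  refine le_ciInf fun q => ?_
  rw [sub_le_iff_le_add]
  refine (ciInf_le (bddBelow_lipReg hm k x) q).trans ?_
  have := dist_triangle x y q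
  push_cast
  nlinarith [Nat.cast_nonneg (α := ℝ) k]

/-- Points near `p` are controlled by lower semicontinuity. For points at distance at least `δ` the
penalty `k δ` eventually outweighs the lower bound `m`. -/
lemma tendsto_lipReg {α : Type*} [PseudoMetricSpace α] {g : α → ℝ} {m : ℝ}
    (hm : ∀ q, m ≤ g q) (hg : LowerSemicontinuous g) (p : α) :
    Tendsto (fun k => lipReg g k p) atTop (𝓝 (g p)) := by
  have : Nonempty α := ⟨p⟩
  refine tendsto_order.2 ⟨fun a ha => ?_, fun a ha =>
    Eventually.of_forall fun k => (lipReg_le hm k p).trans_lt ha⟩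
  obtain ⟨b, hab, hb⟩ := exists_between ha
  obtain ⟨δ, hδ, hball⟩ := Metric.eventually_nhds_iff.1 (hg p b hb)
  obtain ⟨N, hN⟩ := exists_nat_gt ((b - m) / δ)
  filter_upwards [eventually_ge_atTop N] with k hk
  refine hab.trans_le (le_ciInf fun q => ?_)
  rcases lt_or_ge (dist q p) δ with h | h
  · exact le_add_of_le_of_nonneg (hball h).le (by positivity)
  · have h1 : (N : ℝ) ≤ k := by exact_mod_cast hk
    rw [div_lt_iff₀ hδ] at hN
    rw [dist_comm] at h
    have h2 : (N : ℝ) * δ ≤ k * dist p q := by gcongr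
    linarith [hm q]

/-! ### Construction of a plan by Hahn–Banach and Riesz representation -/

section Kantorovich

open ContinuousMap

variable (μ μ' : Measure Gray) (c : Gray → Gray → ℝ) (s : ℝ)

/-- The upper bounds of a continuous function on the square by `ξ(x) + η(y) + t c(x,y)`,
measured by `∫ ξ dμ + ∫ η dμ' + t s`. -/
def majorants (h : C(Gray × Gray, ℝ)) : Set ℝ :=
  {r | ∃ t : ℝ, 0 ≤ t ∧ ∃ ξ η : Gray → ℝ, Continuous ξ ∧ Continuous η ∧
    (∀ x y, h (x, y) ≤ ξ x + η y + t * c x y) ∧ r = ∫ x, ξ x ∂μ + ∫ y, η y ∂μ' + t * s}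

variable {μ μ' c s}

lemma majorants_nonempty (h : C(Gray × Gray, ℝ)) : (majorants μ μ' c s h).Nonempty :=
  ⟨_, 0, le_rfl, fun _ => ‖h‖, fun _ => 0, continuous_const, continuous_const,
    fun x y => by simpa using (le_abs_self _).trans (h.norm_coe_le_norm (x, y)), rfl⟩

lemma smul_mem_majorants {h : C(Gray × Gray, ℝ)} {r a : ℝ} (ha : 0 ≤ a)
    (hr : r ∈ majorants μ μ' c s h) : a * r ∈ majorants μ μ' c s (a • h) := by
  obtain ⟨t, ht, ξ, η, hξ, hη, hle, rfl⟩ := hr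
  refine ⟨a * t, by positivity, fun x => a * ξ x, fun y => a * η y, by fun_prop, by fun_prop,
    fun x y => ?_, ?_⟩
  · have := mul_le_mul_of_nonneg_left (hle x y) ha
    simp only [ContinuousMap.smul_apply, smul_eq_mul]
    linarith
  · rw [integral_const_mul, integral_const_mul]
    ring

variable [IsProbabilityMeasure μ] [IsProbabilityMeasure μ']

/-- For `t > 0` the pair `(-ξ/t, η/t)` is admissible, and the bound `s` on its dual value is the
claim. For `t = 0` the inequality `ξ + η ≥ 0` is averaged in each variable. -/
lemma nonneg_of_majorant
    (hs : ∀ p ∈ contDual c, ∫ x, p.1 x ∂μ - ∫ y, p.2 y ∂μ' ≤ s)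
    {t : ℝ} (ht : 0 ≤ t) {ξ η : Gray → ℝ} (hξ : Continuous ξ) (hη : Continuous η)
    (h : ∀ x y, 0 ≤ ξ x + η y + t * c x y) :
    0 ≤ ∫ x, ξ x ∂μ + ∫ y, η y ∂μ' + t * s := by
  have iξ : Integrable ξ μ := integrable_of_continuous hξ
  have iη : Integrable η μ' := integrable_of_continuous hη
  rcases ht.eq_or_lt with rfl | ht
  · have h1 : ∀ y, -η y ≤ ∫ x, ξ x ∂μ := fun y => by
      have : ∫ _ : Gray, -η y ∂μ ≤ ∫ x, ξ x ∂μ :=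
        integral_mono (integrable_const _) iξ fun x => by
          have := h x y
          simp only
          linarith
      simpa using this
    have : ∫ _ : Gray, -(∫ x, ξ x ∂μ) ∂μ' ≤ ∫ y, η y ∂μ' :=
      integral_mono (integrable_const _) iη fun y => by
        have := h1 y
        simp only
        linarith
    simp only [integral_const, probReal_univ, one_smul] at this
    linarith
  · have := hs (fun x => -ξ x / t, fun y => η y / t)
      ⟨hξ.neg.div_const t, hη.div_const t, fun x y => by
        have := h x y
        simp only
        rw [← sub_div, div_le_iff₀ ht]
        linarith⟩
    simp only [integral_div, integral_neg] at this
    rw [← sub_div, div_le_iff₀ ht] at this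
    linarith

/-- Adding `‖h‖` to `ξ` gives a majorant of zero. The infimum of the majorants is thereby finite, as
the Hahn–Banach step requires. -/
lemma neg_norm_le_majorant
    (hs : ∀ p ∈ contDual c, ∫ x, p.1 x ∂μ - ∫ y, p.2 y ∂μ' ≤ s) {h : C(Gray × Gray, ℝ)} {r : ℝ}
    (hr : r ∈ majorants μ μ' c s h) : -‖h‖ ≤ r := by
  obtain ⟨t, ht, ξ, η, hξ, hη, hle, rfl⟩ := hr
  have := nonneg_of_majorant hs ht (ξ := fun x => ξ x + ‖h‖)
    (hξ.add continuous_const) hη fun x y => by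
    have h1 := hle x y
    have h2 := (neg_le_abs _).trans (h.norm_coe_le_norm (x, y))
    linarith
  rw [integral_add (integrable_of_continuous hξ) (integrable_const _)] at this
  simp only [integral_const, probReal_univ, one_smul] at this
  linarith

lemma add_mem_majorants {h₁ h₂ : C(Gray × Gray, ℝ)} {r₁ r₂ : ℝ}
    (hr₁ : r₁ ∈ majorants μ μ' c s h₁) (hr₂ : r₂ ∈ majorants μ μ' c s h₂) :
    r₁ + r₂ ∈ majorants μ μ' c s (h₁ + h₂) := by
  obtain ⟨t, ht, ξ, η, hξ, hη, hle, rfl⟩ := hr₁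
  obtain ⟨t', ht', ξ', η', hξ', hη', hle', rfl⟩ := hr₂
  refine ⟨t + t', by positivity, fun x => ξ x + ξ' x, fun y => η y + η' y, hξ.add hξ',
    hη.add hη', fun x y => ?_, ?_⟩
  · have := hle x y
    have := hle' x y
    simp only [ContinuousMap.add_apply]
    linarith
  · rw [integral_add (integrable_of_continuous hξ) (integrable_of_continuous hξ'),
      integral_add (integrable_of_continuous hη) (integrable_of_continuous hη')]
    ring

/-- The Hahn–Banach step of Kantorovich duality. -/
lemma exists_linear_le_majorants
    (hs : ∀ p ∈ contDual c, ∫ x, p.1 x ∂μ - ∫ y, p.2 y ∂μ' ≤ s) :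
    ∃ g : C(Gray × Gray, ℝ) →ₗ[ℝ] ℝ, ∀ h, ∀ r ∈ majorants μ μ' c s h, g h ≤ r := by
  have hbdd : ∀ h, BddBelow (majorants μ μ' c s h) := fun h =>
    ⟨-‖h‖, fun _ hr => neg_norm_le_majorant hs hr⟩
  have hsm : ∀ a : ℝ, 0 < a → ∀ h, sInf (majorants μ μ' c s (a • h)) ≤
      a * sInf (majorants μ μ' c s h) := fun a ha h => by
    rw [← div_le_iff₀' ha]
    refine le_csInf (majorants_nonempty h) fun r hr => ?_
    rw [div_le_iff₀' ha]
    exact csInf_le (hbdd _) (smul_mem_majorants ha.le hr)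
  -- The infimum of the majorants is sublinear and nonnegative at zero, so the zero functional on
  -- the trivial subspace extends below it.
  obtain ⟨g, -, hg⟩ := exists_extension_of_le_sublinear (E := C(Gray × Gray, ℝ))
    ⟨⊥, 0⟩ (fun h => sInf (majorants μ μ' c s h))
    (fun a ha h => le_antisymm (hsm a ha h) (by
      have := hsm a⁻¹ (inv_pos.2 ha) (a • h)
      rw [smul_smul, inv_mul_cancel₀ ha.ne', one_smul] at this
      rwa [← div_eq_inv_mul, le_div_iff₀' ha] at this))
    (fun h₁ h₂ => by
      rw [← sub_le_iff_le_add]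
      refine le_csInf (majorants_nonempty h₁) fun r₁ hr₁ => ?_
      rw [sub_le_iff_le_add, ← sub_le_iff_le_add']
      refine le_csInf (majorants_nonempty h₂) fun r₂ hr₂ => ?_
      rw [sub_le_iff_le_add']
      exact csInf_le (hbdd _) (add_mem_majorants hr₁ hr₂))
    (fun x => by
      have hx : (x : C(Gray × Gray, ℝ)) = 0 := (Submodule.mem_bot ℝ).1 x.2
      rw [hx]
      refine le_csInf (majorants_nonempty 0) fun r hr => ?_
      simpa using neg_norm_le_majorant hs hr)
  exact ⟨g, fun h r hr => (hg h).trans (csInf_le (hbdd _) hr)⟩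

/-- Kantorovich duality: a bound on all continuous admissible potentials yields a plan. -/
lemma exists_plan_of_forall_contDual_le
    (hs : ∀ p ∈ contDual c, ∫ x, p.1 x ∂μ - ∫ y, p.2 y ∂μ' ≤ s) :
    ∃ π ∈ plans μ μ', ∀ h : Gray × Gray → ℝ, Continuous h → (∀ x y, h (x, y) ≤ c x y) →
      ∫ q, h q ∂π ≤ s := by
  obtain ⟨g, hg⟩ := exists_linear_le_majorants hs
  let Λ : CompactlySupportedContinuousMap (Gray × Gray) ℝ →ₗ[ℝ] ℝ :=
    { toFun := fun h => g h.toContinuousMap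
      map_add' := fun h₁ h₂ => g.map_add h₁.toContinuousMap h₂.toContinuousMap
      map_smul' := fun a h => g.map_smul a h.toContinuousMap }
  -- Positivity holds because `-h ≤ 0` has the majorant `0`.
  let Λp := PositiveLinearMap.mk₀ Λ fun h hh => by
    have h1 : g (-h.toContinuousMap) ≤ 0 :=
      hg (-h.toContinuousMap) 0 ⟨0, le_rfl, fun _ => 0, fun _ => 0, continuous_const,
        continuous_const, fun x y => by
          have : 0 ≤ h (x, y) := hh (x, y)
          simpa using this, by simp⟩
    rw [map_neg] at h1
    change 0 ≤ g h.toContinuousMap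
    linarith
  let π := RealRMK.rieszMeasure Λp
  have hint : ∀ h : C(Gray × Gray, ℝ), ∫ q, h q ∂π = g h := fun h =>
    RealRMK.integral_rieszMeasure Λp ⟨h, HasCompactSupport.of_compactSpace _⟩
  -- Both `ξ + η` and its negative are their own majorants with `t = 0`, which fixes the value of
  -- the functional. Hence the represented measure has the prescribed marginals.
  have hle : ∀ ξ η : Gray → ℝ, Continuous ξ → Continuous η → ∀ h : C(Gray × Gray, ℝ),
      (∀ x y, h (x, y) = ξ x + η y) → g h = ∫ x, ξ x ∂μ + ∫ y, η y ∂μ' := by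
    intro ξ η hξ hη h hh
    refine le_antisymm (hg h _ ⟨0, le_rfl, ξ, η, hξ, hη, fun x y => by simp [hh], by simp⟩) ?_
    have := hg (-h) _ ⟨0, le_rfl, fun x => -ξ x, fun y => -η y, hξ.neg, hη.neg,
      fun x y => by simp [hh, add_comm], rfl⟩
    simp only [map_neg, integral_neg] at this
    linarith
  have hprob : IsProbabilityMeasure π := by
    have h1 := hint 1
    rw [hle (fun _ => 1) (fun _ => 0) continuous_const continuous_const 1 (by simp)] at h1
    simp only [ContinuousMap.one_apply, integral_const, smul_eq_mul, mul_one, probReal_univ,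
      mul_zero, add_zero] at h1
    refine ⟨?_⟩
    rw [← ENNReal.ofReal_toReal (measure_ne_top π univ)]
    change ENNReal.ofReal (π.real univ) = 1
    rw [h1, ENNReal.ofReal_one]
  refine ⟨π, ⟨hprob, ?_, ?_⟩, fun h hh hhc => ?_⟩
  · have : IsProbabilityMeasure (π.map Prod.fst) :=
      Measure.isProbabilityMeasure_map measurable_fst.aemeasurable
    refine ext_of_forall_integral_eq_of_IsFiniteMeasure fun f => ?_
    rw [integral_map measurable_fst.aemeasurable f.continuous.aestronglyMeasurable]
    have h1 := hint ⟨fun q => f q.1, f.continuous.comp continuous_fst⟩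
    rw [hle f (fun _ => 0) f.continuous continuous_const _ (by simp)] at h1
    simpa using h1
  · have : IsProbabilityMeasure (π.map Prod.snd) :=
      Measure.isProbabilityMeasure_map measurable_snd.aemeasurable
    refine ext_of_forall_integral_eq_of_IsFiniteMeasure fun f => ?_
    rw [integral_map measurable_snd.aemeasurable f.continuous.aestronglyMeasurable]
    have h1 := hint ⟨fun q => f q.2, f.continuous.comp continuous_snd⟩
    rw [hle (fun _ => 0) f continuous_const f.continuous _ (by simp)] at h1
    simpa using h1
  · have h1 := hint ⟨h, hh⟩
    -- Taking `t = 1` and zero potentials makes `s` itself a majorant of every continuous `h ≤ c`.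
    have h2 := hg ⟨h, hh⟩ s ⟨1, zero_le_one, fun _ => 0, fun _ => 0, continuous_const,
      continuous_const, fun x y => by simpa using hhc x y, by simp⟩
    simp only [ContinuousMap.coe_mk] at h1
    rwa [h1]

end Kantorovich

/-- Strong duality, with continuous potentials. -/
theorem transportCost_le_iSup_contDual {c : Gray → Gray → ℝ}
    (hc : LowerSemicontinuous (fun p : Gray × Gray => c p.1 p.2)) (μ μ' : Measure Gray)
    [IsProbabilityMeasure μ] [IsProbabilityMeasure μ'] :
    transportCost c μ μ' ≤ ⨆ p ∈ contDual c, dualValue μ μ' p := by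
  obtain ⟨m, hm⟩ := exists_lower_bound hc
  have hdv : ∀ p ∈ contDual c, dualValue μ μ' p =
      ((∫ γ, p.1 γ ∂μ - ∫ γ, p.2 γ ∂μ' : ℝ) : EReal) := fun p hp =>
    dualValue_eq_coe (integrable_of_continuous hp.1) (integrable_of_continuous hp.2.1)
  set S := ⨆ p ∈ contDual c, dualValue μ μ' p with hS
  have hle : ∀ p ∈ contDual c, dualValue μ μ' p ≤ S := fun p hp =>
    le_iSup₂ (f := fun p (_ : p ∈ contDual c) => dualValue μ μ' p) p hp
  rcases eq_or_ne S ⊤ with hT | hT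
  · rw [hT]; exact le_top
  have hB : S ≠ ⊥ := by
    intro h
    have := hle _ (const_mem_contDual hm)
    rw [hdv _ (const_mem_contDual hm), h, le_bot_iff] at this
    exact EReal.coe_ne_bot _ this
  lift S to ℝ using ⟨hT, hB⟩ with s
  obtain ⟨π, hπ, hπs⟩ := exists_plan_of_forall_contDual_le (μ := μ) (μ' := μ') (c := c) (s := s)
    fun p hp => by
      have := hle p hp
      rwa [hdv p hp, EReal.coe_le_coe_iff] at this
  refine (iInf₂_le π hπ).trans ?_
  have := hπ.1
  let g : Gray × Gray → ℝ := fun q => c q.1 q.2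
  have hgm : ∀ q, m ≤ g q := fun q => hm q.1 q.2
  have hcm : Measurable g := hc.measurable
  -- The plan is only tested against continuous functions below the cost. Lipschitz regularisations
  -- and Fatou extend the bound to the cost, with `m` subtracted to make all integrands nonnegative.
  have hfin : ∫⁻ q, ENNReal.ofReal (g q - m) ∂π ≤ ENNReal.ofReal (s - m) := by
    calc _ ≤ ∫⁻ q, liminf (fun k => ENNReal.ofReal (lipReg g k q - m)) atTop ∂π := by
          refine lintegral_mono fun q => ?_
          have := (ENNReal.continuous_ofReal.tendsto _).comp
            ((tendsto_lipReg hgm hc q).sub_const m)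
          exact this.liminf_eq.ge
      _ ≤ liminf (fun k => ∫⁻ q, ENNReal.ofReal (lipReg g k q - m) ∂π) atTop :=
          lintegral_liminf_le fun k =>
            ((continuous_lipReg hgm k).measurable.sub_const m).ennreal_ofReal
      _ ≤ liminf (fun _ : ℕ => ENNReal.ofReal (s - m)) atTop := by
          refine liminf_le_liminf (Eventually.of_forall fun k => ?_)
          have hk := continuous_lipReg hgm k
          have hi : Integrable (lipReg g k) π := integrable_of_continuous hk
          have hi2 : Integrable (fun q => lipReg g k q - m) π := hi.sub (integrable_const m)
          rw [← ofReal_integral_eq_lintegral_ofReal hi2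
            (Eventually.of_forall fun q => sub_nonneg.2 (le_lipReg hgm k q)),
            integral_sub hi (integrable_const m)]
          refine ENNReal.ofReal_le_ofReal ?_
          have := hπs _ hk fun x y => lipReg_le hgm k (x, y)
          simpa using this
      _ = _ := liminf_const _
  have hi' : Integrable (fun q => g q - m) π :=
    ⟨(hcm.sub_const m).aestronglyMeasurable, by
      rw [hasFiniteIntegral_iff_ofReal (Eventually.of_forall fun q => sub_nonneg.2 (hgm q))]
      exact hfin.trans_lt ENNReal.ofReal_lt_top⟩
  have hi : Integrable g π :=
    (hi'.add (integrable_const m)).congr (Eventually.of_forall fun q => sub_add_cancel _ _)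
  have := lintegral_sub_lintegral_eq_coe hi
  refine this.trans_le (EReal.coe_le_coe_iff.2 ?_)
  rw [← ofReal_integral_eq_lintegral_ofReal hi'
    (Eventually.of_forall fun q => sub_nonneg.2 (hgm q)), integral_sub hi (integrable_const m)]
    at hfin
  have hsm : m ≤ s := by
    have := hle _ (const_mem_contDual hm)
    rw [hdv _ (const_mem_contDual hm), EReal.coe_le_coe_iff] at this
    simpa using this
  have := (ENNReal.ofReal_le_ofReal_iff (by linarith)).1 hfin
  simp only [integral_const, probReal_univ, one_smul] at this
  linarith

lemma transportCost_eq_iSup {c : Gray → Gray → ℝ}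
    (hc : LowerSemicontinuous (fun p : Gray × Gray => c p.1 p.2)) (μ μ' : Measure Gray)
    [IsProbabilityMeasure μ] [IsProbabilityMeasure μ'] :
    transportCost c μ μ' = ⨆ p ∈ contDual c, dualValue μ μ' p :=
  le_antisymm (transportCost_le_iSup_contDual hc μ μ')
    (iSup₂_le fun _ hp => dualValue_le_transportCost hc (contDual_subset c hp))

/-! ### Vertical derivatives -/

instance : (volume : Measure (Plane × ℝ)).IsAddHaarMeasure := by
  rw [Measure.volume_eq_prod]
  infer_instance

lemma restrict_cyl (Ω : Set Plane) :
    (volume : Measure (Plane × ℝ)).restrict (cyl Ω) = (volume.restrict Ω).prod volume := by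
  rw [cyl, Measure.volume_eq_prod, ← Measure.prod_restrict, Measure.restrict_univ]

lemma isOpen_cyl {Ω : Set Plane} (hΩ : IsOpen Ω) : IsOpen (cyl Ω) := hΩ.prod isOpen_univ

/-- The vertical derivative measure is unique. -/
lemma IsNegVertDeriv.unique {Ω : Set Plane} (hΩ : IsOpen Ω) {φ : Plane × ℝ → ℝ}
    {m₁ m₂ : Measure (Plane × ℝ)} (h₁ : IsNegVertDeriv Ω φ m₁) (h₂ : IsNegVertDeriv Ω φ m₂) :
    m₁ = m₂ := by
  have := h₁.1
  have := h₂.1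
  -- Both measures have densities with respect to their sum. The difference of the densities
  -- annihilates smooth functions with compact support in the cylinder, hence vanishes almost
  -- everywhere there.
  obtain ⟨μ, hμ⟩ : ∃ μ, μ = m₁ + m₂ := ⟨_, rfl⟩
  have : IsFiniteMeasure μ := by rw [hμ]; infer_instance
  have : m₁.HaveLebesgueDecomposition μ := Measure.haveLebesgueDecomposition_of_sigmaFinite m₁ μ
  have : m₂.HaveLebesgueDecomposition μ := Measure.haveLebesgueDecomposition_of_sigmaFinite m₂ μ
  have ac₁ : m₁ ≪ μ := hμ ▸ Measure.AbsolutelyContinuous.rfl.add_right _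
  have ac₂ : m₂ ≪ μ := by
    rw [hμ, add_comm]
    exact Measure.AbsolutelyContinuous.rfl.add_right _
  have i₁ : Integrable (fun p => (m₁.rnDeriv μ p).toReal) μ := Measure.integrable_toReal_rnDeriv
  have i₂ : Integrable (fun p => (m₂.rnDeriv μ p).toReal) μ := Measure.integrable_toReal_rnDeriv
  have hz := (isOpen_cyl hΩ).ae_eq_zero_of_integral_contDiff_smul_eq_zero (μ := μ)
    (f := fun p => (m₁.rnDeriv μ p).toReal - (m₂.rnDeriv μ p).toReal)
    ((i₁.sub i₂).locallyIntegrable.locallyIntegrableOn _) fun ζ hζ hζc hζs => by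
      have hζ1 : ContDiff ℝ 1 ζ := hζ.of_le (by exact_mod_cast le_top)
      obtain ⟨C, hC⟩ := hζ.continuous.bounded_above_of_compact_support hζc
      have e₁ := integral_rnDeriv_smul (f := ζ) ac₁
      have e₂ := integral_rnDeriv_smul (f := ζ) ac₂
      have e := (h₁.2.2 ζ hζ1 hζc hζs).symm.trans (h₂.2.2 ζ hζ1 hζc hζs)
      have j₁ : Integrable (fun p => (m₁.rnDeriv μ p).toReal • ζ p) μ :=
        i₁.mul_bdd hζ.continuous.aestronglyMeasurable (Eventually.of_forall hC)
      have j₂ : Integrable (fun p => (m₂.rnDeriv μ p).toReal • ζ p) μ :=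
        i₂.mul_bdd hζ.continuous.aestronglyMeasurable (Eventually.of_forall hC)
      rw [← e₁, ← e₂] at e
      rw [← sub_eq_zero, ← integral_sub j₁ j₂] at e
      refine Eq.trans ?_ e
      congr 1 with p
      simp only [smul_eq_mul]
      ring
  have hnull : ∀ᵐ p ∂μ, p ∈ cyl Ω := by
    rw [ae_iff]
    change μ (cyl Ω)ᶜ = 0
    rw [hμ, Measure.add_apply, h₁.2.1, h₂.2.1, add_zero]
  rw [← Measure.withDensity_rnDeriv_eq m₁ μ ac₁, ← Measure.withDensity_rnDeriv_eq m₂ μ ac₂]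
  refine withDensity_congr_ae ?_
  filter_upwards [hz, hnull, m₁.rnDeriv_lt_top μ, m₂.rnDeriv_lt_top μ] with p hp hpc f₁ f₂
  exact (ENNReal.toReal_eq_toReal_iff' f₁.ne f₂.ne).1 (sub_eq_zero.1 (hp hpc))

lemma negVertDeriv_eq {Ω : Set Plane} (hΩ : IsOpen Ω) {φ : Plane × ℝ → ℝ}
    {m : Measure (Plane × ℝ)} (h : IsNegVertDeriv Ω φ m) : negVertDeriv Ω φ = m := by
  have hex : ∃ m, IsNegVertDeriv Ω φ m := ⟨m, h⟩
  rw [negVertDeriv, dif_pos hex]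
  exact hex.choose_spec.unique hΩ h

lemma IsNegVertDeriv.congr {Ω : Set Plane} {φ φ' : Plane × ℝ → ℝ} {m : Measure (Plane × ℝ)}
    (h : IsNegVertDeriv Ω φ m) (he : φ =ᵐ[volume.restrict (cyl Ω)] φ') :
    IsNegVertDeriv Ω φ' m := by
  refine ⟨h.1, h.2.1, fun ζ h1 h2 h3 => ?_⟩
  rw [← h.2.2 ζ h1 h2 h3]
  refine integral_congr_ae ?_
  filter_upwards [he] with p hp
  rw [hp]

lemma tv₃_congr {Ω : Set Plane} {φ φ' : Plane × ℝ → ℝ}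
    (he : φ =ᵐ[volume.restrict (cyl Ω)] φ') : tv₃ Ω φ = tv₃ Ω φ' := by
  unfold tv₃
  refine iSup_congr fun X => iSup_congr fun _ => ?_
  congr 1
  refine integral_congr_ae ?_
  filter_upwards [he] with x hx
  rw [hx]

/-- Functions on the cylinder that satisfy the constraints everywhere. -/
structure IsLift (φ : Plane × ℝ → ℝ) : Prop where
  measurable : Measurable φ
  mem_Icc : ∀ p, φ p ∈ Icc (0 : ℝ) 1
  eq_one : ∀ p : Plane × ℝ, p.2 ≤ 0 → φ p = 1
  eq_zero : ∀ p : Plane × ℝ, 1 ≤ p.2 → φ p = 0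

lemma IsLift.norm_le {φ : Plane × ℝ → ℝ} (h : IsLift φ) (p : Plane × ℝ) : ‖φ p‖ ≤ 1 := by
  rw [Real.norm_of_nonneg (h.mem_Icc p).1]
  exact (h.mem_Icc p).2

lemma exists_isLift {Ω : Set Plane} {φ : Plane × ℝ → ℝ}
    (h1 : AEMeasurable φ (volume.restrict (cyl Ω)))
    (h2 : ∀ᵐ p ∂(volume.restrict (cyl Ω)), φ p ∈ Icc (0 : ℝ) 1)
    (h3 : ∀ᵐ p ∂(volume.restrict (cyl Ω)), p.2 ≤ 0 → φ p = 1)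
    (h4 : ∀ᵐ p ∂(volume.restrict (cyl Ω)), 1 ≤ p.2 → φ p = 0) :
    ∃ φ', IsLift φ' ∧ φ =ᵐ[volume.restrict (cyl Ω)] φ' := by
  refine ⟨fun p => if p.2 ≤ 0 then 1 else if 1 ≤ p.2 then 0 else max 0 (min 1 (h1.mk φ p)),
    ⟨?_, ?_, ?_, ?_⟩, ?_⟩
  · refine Measurable.ite (measurableSet_le measurable_snd measurable_const) measurable_const
      (Measurable.ite (measurableSet_le measurable_const measurable_snd) measurable_const ?_)
    exact measurable_const.max (measurable_const.min h1.measurable_mk)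
  · intro p
    split_ifs
    · simp
    · simp
    · exact ⟨le_max_left _ _, max_le zero_le_one (min_le_left _ _)⟩
  · intro p hp
    simp [hp]
  · intro p hp
    have : ¬p.2 ≤ 0 := by linarith
    simp [hp, this]
  · filter_upwards [h1.ae_eq_mk, h2, h3, h4] with p e1 e2 e3 e4
    split_ifs with a b
    · exact e3 a
    · exact e4 b
    · rw [← e1, min_eq_right e2.2, max_eq_right e2.1]

/-! ### Monotonicity in the vertical direction -/

/-- Smooth bump functions on `ℝ² × ℝ`. -/
def bump₃ (k : ℕ) : ContDiffBump (0 : Plane × ℝ) where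
  rIn := radius k / 2
  rOut := radius k
  rIn_pos := half_pos (radius_pos k)
  rIn_lt_rOut := half_lt_self (radius_pos k)

/-- Mollification on `ℝ² × ℝ`. -/
def mollify₃ (k : ℕ) (φ : Plane × ℝ → ℝ) : Plane × ℝ → ℝ :=
  convolution ((bump₃ k).normed volume) φ (ContinuousLinearMap.lsmul ℝ ℝ) volume

lemma IsLift.locallyIntegrable {φ : Plane × ℝ → ℝ} (h : IsLift φ) :
    LocallyIntegrable φ volume :=
  (locallyIntegrable_const (1 : ℝ)).mono h.measurable.aestronglyMeasurable
    (Eventually.of_forall fun p => by simpa using h.norm_le p)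

lemma ae_tendsto_mollify₃ {φ : Plane × ℝ → ℝ} (h : LocallyIntegrable φ volume) :
    ∀ᵐ p, Tendsto (fun k => mollify₃ k φ p) atTop (𝓝 (φ p)) :=
  ContDiffBump.ae_convolution_tendsto_right_of_locallyIntegrable (φ := bump₃) (K := 2)
    tendsto_radius (Eventually.of_forall fun k => by
      change radius k ≤ 2 * (radius k / 2); linarith) h

/-- The test function `y ↦ ρ_k(p - y)` has compact support in the cylinder. -/
lemma bump₃_sub {Ω : Set Plane} {k : ℕ} {p : Plane × ℝ} (hp : p.1 ∈ shrink Ω (radius k)) :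
    ContDiff ℝ 1 (fun y => (bump₃ k).normed volume (p - y)) ∧
    HasCompactSupport (fun y => (bump₃ k).normed volume (p - y)) ∧
    tsupport (fun y => (bump₃ k).normed volume (p - y)) ⊆ cyl Ω := by
  have hs : tsupport (fun y => (bump₃ k).normed volume (p - y)) =
      (Homeomorph.subLeft p) ⁻¹' tsupport ((bump₃ k).normed volume) :=
    tsupport_comp_eq_preimage ((bump₃ k).normed volume) (Homeomorph.subLeft p)
  refine ⟨(bump₃ k).contDiff_normed.comp (contDiff_const.sub contDiff_id),
    (bump₃ k).hasCompactSupport_normed.comp_homeomorph (Homeomorph.subLeft p), ?_⟩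
  rw [hs, (bump₃ k).tsupport_normed_eq]
  intro y hy
  refine ⟨?_, mem_univ _⟩
  have h1 : ‖p - y‖ ≤ radius k := by simpa [bump₃] using hy
  have h2 : ‖-(p.1 - y.1)‖ ≤ radius k := by
    rw [norm_neg]
    exact (norm_fst_le (p - y)).trans h1
  have := add_mem_of_mem_shrink hp h2
  simpa using this

/-- The derivative is moved onto the kernel and written with the test function `y ↦ ρ_k(p - y)`. The
minus sign from the reflection is what lets `VertNonincr` determine its sign. -/
lemma hasFDerivAt_mollify₃ {φ : Plane × ℝ → ℝ} (h : LocallyIntegrable φ volume) (k : ℕ)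
    (p : Plane × ℝ) : ∃ L : Plane × ℝ →L[ℝ] ℝ, HasFDerivAt (mollify₃ k φ) L p ∧
      L (0, 1) = -∫ y, φ y * fderiv ℝ (fun y => (bump₃ k).normed volume (p - y)) y (0, 1) := by
  have hc := (bump₃ k).hasCompactSupport_normed (μ := volume)
  have hd : ContDiff ℝ 1 ((bump₃ k).normed volume) := (bump₃ k).contDiff_normed
  refine ⟨_, hc.hasFDerivAt_convolution_left (ContinuousLinearMap.lsmul ℝ ℝ) hd h p, ?_⟩
  have hex := (hc.fderiv ℝ).convolutionExists_left
    ((ContinuousLinearMap.lsmul ℝ ℝ).precompL (Plane × ℝ)) (hd.continuous_fderiv one_ne_zero) h p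
  rw [convolution_def, ContinuousLinearMap.integral_apply hex, ← integral_neg,
    ← integral_sub_left_eq_self _ volume p]
  congr 1 with y
  have : fderiv ℝ (fun y => (bump₃ k).normed volume (p - y)) y =
      -fderiv ℝ ((bump₃ k).normed volume) (p - y) := by
    have h1 : HasFDerivAt (fun y => p - y) (-ContinuousLinearMap.id ℝ (Plane × ℝ)) y :=
      (hasFDerivAt_id y).const_sub p
    have h2 := ((hd.differentiable one_ne_zero (p - y)).hasFDerivAt).comp y h1
    exact h2.fderiv.trans (by simp)
  rw [this]
  simp [ContinuousLinearMap.precompL_apply, mul_comm]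

/-- The vertical distributional derivative is nonpositive. -/
def VertNonincr (Ω : Set Plane) (φ : Plane × ℝ → ℝ) : Prop :=
  ∀ ζ : Plane × ℝ → ℝ, ContDiff ℝ 1 ζ → HasCompactSupport ζ → tsupport ζ ⊆ cyl Ω →
    (∀ p, 0 ≤ ζ p) → 0 ≤ ∫ p in cyl Ω, φ p * fderiv ℝ ζ p (0, 1)

lemma IsNegVertDeriv.vertNonincr {Ω : Set Plane} {φ : Plane × ℝ → ℝ} {m : Measure (Plane × ℝ)}
    (h : IsNegVertDeriv Ω φ m) : VertNonincr Ω φ := fun ζ h1 h2 h3 h4 => by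
  rw [h.2.2 ζ h1 h2 h3]
  exact integral_nonneg h4

lemma setIntegral_cyl_mul_fderiv {Ω : Set Plane} {ζ : Plane × ℝ → ℝ} (hζ : tsupport ζ ⊆ cyl Ω)
    (φ : Plane × ℝ → ℝ) (w : Plane × ℝ) :
    ∫ p in cyl Ω, φ p * fderiv ℝ ζ p w = ∫ p, φ p * fderiv ℝ ζ p w :=
  setIntegral_eq_integral_of_forall_compl_eq_zero fun p hp => by
    have : fderiv ℝ ζ p = 0 := by
      by_contra h
      exact hp (hζ (support_fderiv_subset ℝ h))
    simp [this]

lemma antitone_mollify₃ {Ω : Set Plane} {φ : Plane × ℝ → ℝ} (h : LocallyIntegrable φ volume)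
    (hφ : VertNonincr Ω φ) {k : ℕ} {x : Plane} (hx : x ∈ shrink Ω (radius k)) :
    Antitone fun γ => mollify₃ k φ (x, γ) := by
  have hd : ∀ γ : ℝ, ∃ a ≤ (0 : ℝ), HasDerivAt (fun γ => mollify₃ k φ (x, γ)) a γ := fun γ => by
    obtain ⟨L, hL, hL1⟩ := hasFDerivAt_mollify₃ h k (x, γ)
    obtain ⟨c1, c2, c3⟩ := bump₃_sub (p := (x, γ)) hx
    refine ⟨L (0, 1), ?_, hL.comp_hasDerivAt γ ((hasDerivAt_const γ x).prodMk (hasDerivAt_id γ))⟩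
    rw [hL1, ← setIntegral_cyl_mul_fderiv c3, neg_nonpos]
    exact hφ _ c1 c2 c3 fun y => (bump₃ k).nonneg_normed _
  refine antitone_of_deriv_nonpos (fun γ => ?_) fun γ => ?_
  · obtain ⟨a, _, ha⟩ := hd γ
    exact ha.differentiableAt
  · obtain ⟨a, ha0, ha⟩ := hd γ
    rw [ha.deriv]
    exact ha0

/-- A function with nonpositive vertical derivative is, on almost every vertical line, antitone
on a set of full measure. -/
lemma ae_antitoneOn {Ω : Set Plane} (hΩ : IsOpen Ω) {φ : Plane × ℝ → ℝ}
    (h : LocallyIntegrable φ volume) (hφ : VertNonincr Ω φ) :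
    ∀ᵐ x ∂volume.restrict Ω, ∃ G : Set ℝ, (∀ᵐ γ, γ ∈ G) ∧ AntitoneOn (fun γ => φ (x, γ)) G := by
  have h1 : ∀ᵐ x : Plane, ∀ᵐ γ : ℝ, Tendsto (fun k => mollify₃ k φ (x, γ)) atTop
      (𝓝 (φ (x, γ))) := by
    have := ae_tendsto_mollify₃ h
    rw [Measure.volume_eq_prod] at this
    exact Measure.ae_ae_of_ae_prod this
  filter_upwards [ae_restrict_of_ae h1, ae_restrict_mem hΩ.measurableSet] with x hx hxΩ
  -- Mollifications are antitone on lines through the inner set, and the inequality survives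
  -- wherever they converge to `φ`.
  refine ⟨{γ | Tendsto (fun k => mollify₃ k φ (x, γ)) atTop (𝓝 (φ (x, γ)))}, hx,
    fun γ₁ h₁ γ₂ h₂ hle => ?_⟩
  obtain ⟨δ, hδ, hs⟩ := exists_subset_shrink hΩ (isCompact_singleton (x := x)) (by simpa using hxΩ)
  refine le_of_tendsto_of_tendsto h₂ h₁ ?_
  filter_upwards [tendsto_radius.eventually_le_const hδ] with k hk
  exact antitone_mollify₃ h hφ (hs _ hk rfl) hle

/-! ### Layer representation -/

/-- The measure of the set of gray values where `φ(x, ·)` exceeds `t`. -/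
def quantile (φ : Plane × ℝ → ℝ) (q : Plane × ℝ) : Gray :=
  ⟨volume.real {γ | γ ∈ Icc (0 : ℝ) 1 ∧ q.2 < φ (q.1, γ)}, measureReal_nonneg, by
    have h : volume.real {γ | γ ∈ Icc (0 : ℝ) 1 ∧ q.2 < φ (q.1, γ)} ≤
        volume.real (Icc (0 : ℝ) 1) := measureReal_mono (fun γ hγ => hγ.1) (by simp)
    simpa using h⟩

lemma measurable_quantile {φ : Plane × ℝ → ℝ} (hφ : Measurable φ) : Measurable (quantile φ) := by
  refine Measurable.subtype_mk (Measurable.ennreal_toReal ?_)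
  have : MeasurableSet {r : (Plane × ℝ) × ℝ | r.2 ∈ Icc (0 : ℝ) 1 ∧ r.1.2 < φ (r.1.1, r.2)} := by
    have h1 : MeasurableSet {r : (Plane × ℝ) × ℝ | r.1.2 < φ (r.1.1, r.2)} :=
      measurableSet_lt (measurable_snd.comp measurable_fst)
        (hφ.comp ((measurable_fst.comp measurable_fst).prodMk measurable_snd))
    exact (measurable_snd measurableSet_Icc).inter h1
  exact measurable_measure_prodMk_left this

/-- `U(x, t)` is the height of the superlevel set of `φ(x, ·)` at level `t`. -/
def IsLayered (Ω : Set Plane) (φ : Plane × ℝ → ℝ) (U : Plane × ℝ → Gray) : Prop :=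
  ∀ᵐ x ∂volume.restrict Ω, ∀ t ∈ Ico (0 : ℝ) 1, ∀ᵐ γ : ℝ, t < φ (x, γ) ↔ γ < U (x, t)

/-- Since `φ(x, ·)` is antitone on a set of full measure, its superlevel set within `[0,1]` is, up
to a null set, an initial segment. Its right end is its length, which is the quantile. -/
lemma isLayered_quantile {Ω : Set Plane} (hΩ : IsOpen Ω) {φ : Plane × ℝ → ℝ} (h : IsLift φ)
    (hφ : VertNonincr Ω φ) : IsLayered Ω φ (quantile φ) := by
  filter_upwards [ae_antitoneOn hΩ h.locallyIntegrable hφ] with x hx t ht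
  obtain ⟨G, hG, hanti⟩ := hx
  have hGc : volume Gᶜ = 0 := hG
  have hne : ∀ᵐ γ : ℝ, γ ≠ quantile φ (x, t) := by
    rw [ae_iff]; simp
  have hne0 : ∀ᵐ γ : ℝ, γ ≠ 0 := by
    rw [ae_iff]; simp
  filter_upwards [hG, hne, hne0] with γ hγ hγU hγ0
  have hU0 := (quantile φ (x, t)).2.1
  have hU1 := (quantile φ (x, t)).2.2
  -- Below `0` the value `1` exceeds `t` because `t < 1`. Above `1` the value `0` does not, because
  -- `t ≥ 0`. This is why levels range over `Ico 0 1`.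
  rcases lt_or_gt_of_ne hγ0 with h0 | h0
  · rw [h.eq_one (x, γ) h0.le]
    exact ⟨fun _ => h0.trans_le hU0, fun _ => ht.2⟩
  rcases le_or_gt 1 γ with h1 | h1
  · rw [h.eq_zero (x, γ) h1]
    exact ⟨fun hh => absurd hh ht.1.not_gt, fun hh => absurd (hh.trans_le hU1) h1.not_gt⟩
  have hfin : volume {γ | γ ∈ Icc (0 : ℝ) 1 ∧ t < φ (x, γ)} ≠ ∞ :=
    ((measure_mono (fun γ hγ => hγ.1)).trans_lt (by simp : volume (Icc (0 : ℝ) 1) < ∞)).ne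
  constructor
  · intro hlt
    refine lt_of_le_of_ne ?_ hγU
    have hsub : Ioo 0 γ ⊆ {γ | γ ∈ Icc (0 : ℝ) 1 ∧ t < φ (x, γ)} ∪ Gᶜ := by
      intro γ' hγ'
      by_cases hg : γ' ∈ G
      · exact Or.inl ⟨⟨hγ'.1.le, (hγ'.2.trans h1).le⟩, hlt.trans_le (hanti hg hγ hγ'.2.le)⟩
      · exact Or.inr hg
    have h2 := (measure_mono (μ := volume) hsub).trans (measure_union_le _ _)
    rw [hGc, add_zero, Real.volume_Ioo, sub_zero] at h2
    exact (ENNReal.ofReal_le_iff_le_toReal hfin).1 h2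
  · intro hlt
    by_contra hge
    rw [not_lt] at hge
    have hsub : {γ | γ ∈ Icc (0 : ℝ) 1 ∧ t < φ (x, γ)} ⊆ Icc 0 γ ∪ Gᶜ := by
      intro γ' hγ'
      by_cases hg : γ' ∈ G
      · refine Or.inl ⟨hγ'.1.1, ?_⟩
        by_contra hc
        rw [not_le] at hc
        exact absurd (hγ'.2.trans_le ((hanti hγ hg hc.le).trans hge)) (lt_irrefl _)
      · exact Or.inr hg
    have h2 := (measure_mono (μ := volume) hsub).trans (measure_union_le _ _)
    rw [hGc, add_zero, Real.volume_Icc, sub_zero] at h2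
    exact absurd (hlt.trans_le (ENNReal.toReal_le_of_le_ofReal h0.le h2)) (lt_irrefl _)

/-- Lebesgue measure on `Ω × [0,1]`, the second factor being the set of levels. -/
def layerMeasure (Ω : Set Plane) : Measure (Plane × ℝ) :=
  (volume.restrict Ω).prod (volume.restrict (Icc (0 : ℝ) 1))

lemma isFiniteMeasure_restrict {Ω : Set Plane} (hΩ : Bornology.IsBounded Ω) :
    IsFiniteMeasure (volume.restrict Ω) :=
  ⟨by rw [Measure.restrict_apply_univ]; exact hΩ.measure_lt_top⟩

lemma isFiniteMeasure_layerMeasure {Ω : Set Plane} (hΩ : Bornology.IsBounded Ω) :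
    IsFiniteMeasure (layerMeasure Ω) := by
  have := isFiniteMeasure_restrict hΩ
  unfold layerMeasure
  infer_instance

lemma ae_mem_Ico : ∀ᵐ t ∂volume.restrict (Icc (0 : ℝ) 1), t ∈ Ico (0 : ℝ) 1 := by
  have : ∀ᵐ t : ℝ, t ≠ 1 := by
    rw [ae_iff]; simp
  filter_upwards [ae_restrict_of_ae this, ae_restrict_mem measurableSet_Icc] with t h1 h2
  exact ⟨h2.1, lt_of_le_of_ne h2.2 h1⟩

lemma fderiv_vert {ζ : Plane × ℝ → ℝ} (hζ : ContDiff ℝ 1 ζ) (x : Plane) (γ : ℝ) :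
    deriv (fun γ => ζ (x, γ)) γ = fderiv ℝ ζ (x, γ) (0, 1) :=
  ((hζ.differentiable one_ne_zero (x, γ)).hasFDerivAt.comp_hasDerivAt γ
    ((hasDerivAt_const γ x).prodMk (hasDerivAt_id γ))).deriv

lemma hasCompactSupport_slice {E : Type*} [Zero E] {ζ : Plane × ℝ → E}
    (hζ : HasCompactSupport ζ) (x : Plane) : HasCompactSupport fun γ => ζ (x, γ) := by
  refine HasCompactSupport.intro (hζ.image continuous_snd) fun γ hγ => ?_
  by_contra hne
  exact hγ ⟨(x, γ), subset_tsupport _ hne, rfl⟩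

/-- Integration by parts on a vertical line, through the layers. -/
lemma integral_mul_vert {φ : Plane × ℝ → ℝ} (h : IsLift φ) {U : Plane × ℝ → Gray}
    {x : Plane} (hx : ∀ t ∈ Ico (0 : ℝ) 1, ∀ᵐ γ : ℝ, t < φ (x, γ) ↔ γ < U (x, t))
    {ζ : Plane × ℝ → ℝ} (hζ : ContDiff ℝ 1 ζ) (hζc : HasCompactSupport ζ) :
    ∫ γ, φ (x, γ) * fderiv ℝ ζ (x, γ) (0, 1) = ∫ t in Icc (0 : ℝ) 1, ζ (x, U (x, t)) := by
  have hz : ContDiff ℝ 1 fun γ => ζ (x, γ) := hζ.comp (contDiff_const.prodMk contDiff_id)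
  have hzc := hasCompactSupport_slice hζc x
  simp_rw [← fderiv_vert hζ]
  set g := deriv fun γ => ζ (x, γ) with hg
  have hgi : Integrable g volume :=
    (hz.continuous_deriv le_rfl).integrable_of_hasCompactSupport hzc.deriv
  -- Layer cake in the value of `φ`. After Fubini, each level integrates the derivative of `ζ` over
  -- the half-line ending at `U(x, t)`, leaving the value of `ζ` at that point.
  have e1 : ∀ γ, φ (x, γ) * g γ =
      ∫ t in Icc (0 : ℝ) 1, (if t < φ (x, γ) then (1 : ℝ) else 0) * g γ := fun γ => by
    rw [integral_mul_const, integral_ite_lt (h.mem_Icc _)]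
  simp_rw [e1]
  rw [integral_integral_swap]
  · refine integral_congr_ae ?_
    filter_upwards [ae_mem_Ico] with t ht
    rw [← hzc.integral_Iic_deriv_eq hz, ← integral_indicator measurableSet_Iic]
    refine integral_congr_ae ?_
    have hne : ∀ᵐ γ : ℝ, γ ≠ U (x, t) := by
      rw [ae_iff]; simp
    filter_upwards [hx t ht, hne] with γ h1 h2
    by_cases hc : t < φ (x, γ)
    · rw [if_pos hc, one_mul, indicator_of_mem (show γ ∈ Iic (U (x, t) : ℝ) from (h1.1 hc).le)]
    · rw [if_neg hc, zero_mul, indicator_of_notMem]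
      intro hle
      exact hc (h1.2 (lt_of_le_of_ne hle h2))
  · have m : Measurable fun r : ℝ × ℝ => if r.2 < φ (x, r.1) then (1 : ℝ) else 0 :=
      Measurable.ite (measurableSet_lt measurable_snd
        (h.measurable.comp (measurable_const.prodMk measurable_fst))) measurable_const
        measurable_const
    refine Integrable.bdd_mul (c := 1) ?_ m.aestronglyMeasurable
      (Eventually.of_forall fun r => by split_ifs <;> simp)
    simpa using hgi.mul_prod (integrable_const (1 : ℝ) (μ := volume.restrict (Icc (0 : ℝ) 1)))

/-- The central representation: `-D_γ φ` is Lebesgue measure on pairs of a point and a level,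
transported to the graphs of the layers. Fubini reduces it to one vertical line. -/
lemma isNegVertDeriv_of_isLayered {Ω : Set Plane} (hΩo : IsOpen Ω) (hΩ : Bornology.IsBounded Ω)
    {φ : Plane × ℝ → ℝ} (h : IsLift φ) {U : Plane × ℝ → Gray} (hU : Measurable U)
    (hl : IsLayered Ω φ U) :
    IsNegVertDeriv Ω φ ((layerMeasure Ω).map fun q => (q.1, (U q : ℝ))) := by
  have := isFiniteMeasure_restrict hΩ
  have := isFiniteMeasure_layerMeasure hΩ
  have hm : Measurable fun q : Plane × ℝ => (q.1, (U q : ℝ)) :=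
    measurable_fst.prodMk (measurable_subtype_coe.comp hU)
  refine ⟨inferInstance, ?_, fun ζ hζ hζc hζs => ?_⟩
  · rw [Measure.map_apply hm (isOpen_cyl hΩo).measurableSet.compl]
    have : (fun q : Plane × ℝ => (q.1, (U q : ℝ))) ⁻¹' (cyl Ω)ᶜ = Ωᶜ ×ˢ univ := by
      ext q
      simp [cyl]
    rw [this, layerMeasure, Measure.prod_prod, Measure.restrict_apply hΩo.measurableSet.compl]
    simp
  · obtain ⟨C, hC⟩ := hζ.continuous.bounded_above_of_compact_support hζc
    have hζm : Measurable fun q : Plane × ℝ => ζ (q.1, (U q : ℝ)) := hζ.continuous.measurable.comp hm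
    have hi2 : Integrable (fun q : Plane × ℝ => ζ (q.1, (U q : ℝ))) (layerMeasure Ω) :=
      Integrable.of_bound hζm.aestronglyMeasurable C (Eventually.of_forall fun q => hC _)
    have hi1 : Integrable (fun p => φ p * fderiv ℝ ζ p (0, 1)) ((volume.restrict Ω).prod volume) := by
      have hd : Integrable (fun p => fderiv ℝ ζ p (0, 1)) (volume.restrict (cyl Ω)) := by
        refine Integrable.restrict (Continuous.integrable_of_hasCompactSupport ?_
          (hζc.fderiv_apply ℝ _))
        have := hζ.continuous_fderiv one_ne_zero
        fun_prop
      rw [← restrict_cyl]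
      exact hd.bdd_mul (c := 1) h.measurable.aestronglyMeasurable (Eventually.of_forall h.norm_le)
    rw [integral_map hm.aemeasurable hζ.continuous.aestronglyMeasurable, restrict_cyl,
      integral_prod _ hi1]
    have e := integral_prod _ hi2
    refine Eq.trans ?_ e.symm
    refine integral_congr_ae ?_
    filter_upwards [hl] with x hx
    exact integral_mul_vert h hx hζ hζc

/-- The layers take values in `[0,1]`, so restricting the derivative to `Ω × [0,1]` loses no mass.
-/
lemma grayDeriv_eq {Ω : Set Plane} (hΩo : IsOpen Ω) {φ : Plane × ℝ → ℝ} {U : Plane × ℝ → Gray}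
    (hU : Measurable U)
    (h : IsNegVertDeriv Ω φ ((layerMeasure Ω).map fun q => (q.1, (U q : ℝ)))) :
    grayDeriv Ω φ = (layerMeasure Ω).map fun q => (q.1, U q) := by
  have he : MeasurableEmbedding (Prod.map id Subtype.val : Plane × Gray → Plane × ℝ) :=
    MeasurableEmbedding.id.prodMap (MeasurableEmbedding.subtype_coe measurableSet_Icc)
  have hm : Measurable fun q : Plane × ℝ => (q.1, U q) := measurable_fst.prodMk hU
  rw [grayDeriv, negVertDeriv_eq hΩo h]
  have : (fun q : Plane × ℝ => (q.1, (U q : ℝ))) =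
      (Prod.map id Subtype.val : Plane × Gray → Plane × ℝ) ∘ fun q => (q.1, U q) := rfl
  rw [this, ← Measure.map_map he.measurable hm, he.comap_map]

lemma liftHist_eq {Ω : Set Plane} (hΩo : IsOpen Ω) {φ : Plane × ℝ → ℝ} {U : Plane × ℝ → Gray}
    (hU : Measurable U)
    (h : IsNegVertDeriv Ω φ ((layerMeasure Ω).map fun q => (q.1, (U q : ℝ)))) :
    liftHist Ω φ = (volume Ω)⁻¹ • (layerMeasure Ω).map U := by
  rw [liftHist, grayDeriv_eq hΩo hU h, Measure.map_map measurable_snd (measurable_fst.prodMk hU)]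
  rfl

lemma layerMeasure_univ (Ω : Set Plane) : layerMeasure Ω univ = volume Ω := by
  rw [layerMeasure, ← univ_prod_univ, Measure.prod_prod]
  simp

lemma map_fst_layerMeasure (Ω : Set Plane) :
    (layerMeasure Ω).map Prod.fst = volume.restrict Ω := by
  rw [layerMeasure, Measure.map_fst_prod]
  simp

/-! ### The lift of a gray value function -/

/-- The characteristic function of the subgraph of `u`. -/
def subgraph (u : Plane → Gray) (p : Plane × ℝ) : ℝ :=
  -- The first alternative matters only at height `0` where `u` vanishes. There `IsLift` demands the
  -- value `1`.
  if p.2 ≤ 0 ∨ p.2 < u p.1 then 1 else 0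

lemma isLift_subgraph {u : Plane → Gray} (hu : Measurable u) : IsLift (subgraph u) := by
  refine ⟨?_, fun p => ?_, fun p hp => ?_, fun p hp => ?_⟩
  · refine Measurable.ite (MeasurableSet.union (measurableSet_le measurable_snd measurable_const)
      (measurableSet_lt measurable_snd ?_)) measurable_const measurable_const
    exact measurable_subtype_coe.comp (hu.comp measurable_fst)
  · unfold subgraph
    split_ifs <;> simp
  · simp [subgraph, hp]
  · have h1 : ¬p.2 ≤ 0 := by linarith
    have h2 : ¬p.2 < u p.1 := not_lt.2 ((u p.1).2.2.trans hp)
    simp [subgraph, h1, h2]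

lemma isLayered_subgraph (Ω : Set Plane) (u : Plane → Gray) :
    IsLayered Ω (subgraph u) fun q => u q.1 := by
  refine Eventually.of_forall fun x t ht => ?_
  have hne0 : ∀ᵐ γ : ℝ, γ ≠ 0 := by
    rw [ae_iff]; simp
  filter_upwards [hne0] with γ hγ
  have h0 := (u x).2.1
  unfold subgraph
  constructor
  · intro h
    split_ifs at h with hc
    · rcases hc with hc | hc
      · exact (lt_of_le_of_ne hc hγ).trans_le h0
      · exact hc
    · exact absurd h ht.1.not_gt
  · intro h
    rw [if_pos (Or.inr h)]
    exact ht.2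

lemma subgraph_slice (u : Plane → Gray) {γ : ℝ} (hγ : 0 < γ) :
    (fun x => subgraph u (x, γ)) = superlevel (fun x => (u x : ℝ)) γ := by
  ext x
  simp [subgraph, superlevel, hγ.not_ge]

/-- The sliced total variation `∫₀¹ TV(φ(·, γ)) dγ`. -/
def sliceTV (Ω : Set Plane) (φ : Plane × ℝ → ℝ) : ℝ≥0∞ :=
  ∫⁻ γ in Icc (0 : ℝ) 1, tv Ω fun x => φ (x, γ)

/-- For positive heights the slices are the superlevel indicators of `u`, and the hard half of the
coarea formula applies. Only this inequality is needed for the relaxation to be a lower bound. -/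
lemma sliceTV_subgraph_le {Ω : Set Plane} (hΩo : IsOpen Ω) (hΩ : Bornology.IsBounded Ω)
    {u : Plane → Gray} (hu : Measurable u) :
    sliceTV Ω (subgraph u) ≤ tv Ω fun x => (u x : ℝ) := by
  refine le_of_eq_of_le ?_ (lintegral_tv_superlevel_le hΩo hΩ (measurable_subtype_coe.comp hu)
    (C := 1) fun x => ?_)
  · refine lintegral_congr_ae ?_
    have hne0 : ∀ᵐ γ : ℝ, γ ≠ 0 := by
      rw [ae_iff]; simp
    filter_upwards [ae_restrict_of_ae hne0, ae_restrict_mem measurableSet_Icc] with γ h1 h2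
    rw [subgraph_slice u (lt_of_le_of_ne h2.1 h1.symm)]
  · rw [Real.norm_of_nonneg (u x).2.1]
    exact (u x).2.2

lemma ae_slice_of_ae_cyl {Ω : Set Plane} {P : Plane × ℝ → Prop}
    (h : ∀ᵐ p ∂volume.restrict (cyl Ω), P p) :
    ∀ᵐ γ : ℝ, ∀ᵐ x ∂volume.restrict Ω, P (x, γ) := by
  rw [restrict_cyl] at h
  exact Measure.ae_ae_of_ae_prod
    ((Measure.measurePreserving_swap (μ := volume) (ν := volume.restrict Ω)).quasiMeasurePreserving.ae
      h)

lemma sliceTV_congr {Ω : Set Plane} {φ φ' : Plane × ℝ → ℝ}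
    (h : φ =ᵐ[volume.restrict (cyl Ω)] φ') : sliceTV Ω φ = sliceTV Ω φ' := by
  refine lintegral_congr_ae (ae_restrict_of_ae ?_)
  filter_upwards [ae_slice_of_ae_cyl h] with γ hγ
  exact tv_congr hγ

/-! ### Total variation on the cylinder -/

lemma slice_mem_testFields {Ω : Set Plane} {X : Plane × ℝ → Plane × ℝ} (hX : X ∈ testFields₃ Ω)
    (γ : ℝ) : (fun x => (X (x, γ)).1) ∈ testFields Ω := by
  refine ⟨contDiff_fst.comp (hX.1.comp (contDiff_id.prodMk contDiff_const)), ?_, ?_, fun x => ?_⟩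
  · refine HasCompactSupport.intro (hX.2.1.image continuous_fst) fun x hx => ?_
    by_contra hne
    refine hx ⟨(x, γ), subset_tsupport _ fun h0 => hne ?_, rfl⟩
    rw [h0]
    rfl
  · have hs : tsupport (fun x => (X (x, γ)).1) ⊆ (fun x => (x, γ)) ⁻¹' tsupport X := by
      refine closure_minimal (fun x hx => ?_)
        ((isClosed_tsupport X).preimage (continuous_id.prodMk continuous_const))
      refine subset_tsupport _ fun h0 => hx ?_
      simp only
      rw [h0]
      rfl
    exact hs.trans fun x hx => (hX.2.2.1 hx).1
  · have := hX.2.2.2 (x, γ)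
    have h2 : ‖(X (x, γ)).1‖ ^ 2 ≤ 1 := by nlinarith [sq_nonneg (X (x, γ)).2]
    simpa using (sq_le_one_iff₀ (norm_nonneg _)).1 h2

lemma divergence_slice {X : Plane × ℝ → Plane × ℝ} (hX : ContDiff ℝ 1 X) (x : Plane) (γ : ℝ) :
    divergence (fun x => (X (x, γ)).1) x =
      ∑ i : Fin 2, (fderiv ℝ X (x, γ) (EuclideanSpace.single i 1, 0)).1 i := by
  have h1 : HasFDerivAt (fun x : Plane => (x, γ))
      ((ContinuousLinearMap.id ℝ Plane).prod 0) x := (hasFDerivAt_id x).prodMk (hasFDerivAt_const γ x)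
  have h2 := ((hX.differentiable one_ne_zero (x, γ)).hasFDerivAt.comp x h1).fst
  unfold divergence
  refine Finset.sum_congr rfl fun i _ => ?_
  have h3 : fderiv ℝ (fun x => (X (x, γ)).1) x = _ := h2.fderiv
  rw [h3]
  rfl

lemma divergence₃_eq {X : Plane × ℝ → Plane × ℝ} (hX : ContDiff ℝ 1 X) (p : Plane × ℝ) :
    divergence₃ X p = divergence (fun x => (X (x, p.2)).1) p.1 +
      fderiv ℝ (fun q => (X q).2) p (0, 1) := by
  rw [divergence_slice hX, divergence₃]
  congr 1
  rw [((hX.differentiable one_ne_zero p).hasFDerivAt.snd).fderiv]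
  rfl

/-- A field on the cylinder is split into horizontal and vertical parts. The horizontal part is
tested slice by slice, with constant slices outside `[0,1]`, and the vertical part is integrated
against the derivative measure. This turns finite sliced variation into membership in `C''`. -/
lemma tv₃_le {Ω : Set Plane} {φ : Plane × ℝ → ℝ} (h : IsLift φ) {m : Measure (Plane × ℝ)}
    (hm : IsNegVertDeriv Ω φ m) : tv₃ Ω φ ≤ sliceTV Ω φ + m univ := by
  refine iSup₂_le fun X hX => ?_
  have hfin := hm.1
  have hXf := hX.1.continuous_fderiv one_ne_zero
  have hcont : Continuous fun p : Plane × ℝ => divergence (fun x => (X (x, p.2)).1) p.1 := by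
    simp_rw [divergence_slice hX.1]
    fun_prop
  have hcs : HasCompactSupport fun p : Plane × ℝ => divergence (fun x => (X (x, p.2)).1) p.1 := by
    refine HasCompactSupport.intro hX.2.1 fun p hp => ?_
    have : fderiv ℝ X p = 0 := by
      by_contra h
      exact hp (support_fderiv_subset ℝ h)
    rw [divergence_slice hX.1]
    simp [this]
  have hY : ContDiff ℝ 1 fun q => (X q).2 := contDiff_snd.comp hX.1
  have hYs : tsupport (fun q => (X q).2) ⊆ tsupport X :=
    closure_mono fun q hq h0 => hq (by simp only; rw [h0]; rfl)
  have hYc : HasCompactSupport fun q => (X q).2 :=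
    HasCompactSupport.of_support_subset_isCompact hX.2.1 ((subset_tsupport _).trans hYs)
  have i1 : Integrable (fun p : Plane × ℝ => φ p * divergence (fun x => (X (x, p.2)).1) p.1)
      (volume.restrict (cyl Ω)) :=
    (hcont.integrable_of_hasCompactSupport hcs).restrict.bdd_mul (c := 1)
      h.measurable.aestronglyMeasurable (Eventually.of_forall h.norm_le)
  have i2 : Integrable (fun p : Plane × ℝ => φ p * fderiv ℝ (fun q => (X q).2) p (0, 1))
      (volume.restrict (cyl Ω)) := by
    have hd : Continuous fun p => fderiv ℝ (fun q => (X q).2) p (0, 1) := by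
      have := hY.continuous_fderiv one_ne_zero
      fun_prop
    exact (hd.integrable_of_hasCompactSupport (hYc.fderiv_apply ℝ _)).restrict.bdd_mul (c := 1)
      h.measurable.aestronglyMeasurable (Eventually.of_forall h.norm_le)
  have e : ∫ p in cyl Ω, φ p * divergence₃ X p =
      (∫ p in cyl Ω, φ p * divergence (fun x => (X (x, p.2)).1) p.1) + ∫ p, (X p).2 ∂m := by
    rw [← hm.2.2 _ hY hYc (hYs.trans hX.2.2.1), ← integral_add i1 i2]
    congr 1 with p
    rw [divergence₃_eq hX.1]
    ring
  rw [e]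
  refine ENNReal.ofReal_add_le.trans (add_le_add ?_ ?_)
  · rw [restrict_cyl] at i1 ⊢
    rw [integral_prod_symm _ i1]
    refine (ofReal_integral_le_lintegral_ofReal i1.integral_prod_right).trans ?_
    rw [sliceTV, ← lintegral_indicator measurableSet_Icc]
    refine lintegral_mono fun γ => ?_
    refine (le_tv (slice_mem_testFields hX γ) fun x => φ (x, γ)).trans ?_
    by_cases hγ : γ ∈ Icc (0 : ℝ) 1
    · rw [indicator_of_mem hγ]
    · rw [indicator_of_notMem hγ]
      rw [mem_Icc, not_and_or, not_le, not_le] at hγ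
      rcases hγ with hγ | hγ
      · rw [show (fun x => φ (x, γ)) = fun _ => 1 from funext fun x => h.eq_one (x, γ) hγ.le,
          tv_const]
      · rw [show (fun x => φ (x, γ)) = fun _ => 0 from funext fun x => h.eq_zero (x, γ) hγ.le,
          tv_const]
  · refine (Real.ofReal_le_enorm _).trans ((enorm_integral_le_lintegral_enorm _).trans ?_)
    rw [← lintegral_one]
    refine lintegral_mono fun p => ?_
    rw [← ofReal_norm, ← ENNReal.ofReal_one]
    refine ENNReal.ofReal_le_ofReal ?_
    have := hX.2.2.2 p
    rw [Real.norm_eq_abs, ← sq_le_one_iff_abs_le_one]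
    nlinarith [sq_nonneg ‖(X p).1‖]

/-! ### Extended real arithmetic -/

lemma EReal_coe_mul_add {a : ℝ} (ha : 0 ≤ a) (x y : EReal) :
    (a : EReal) * (x + y) = a * x + a * y := by
  rcases ha.eq_or_lt with rfl | ha
  · simp
  induction x with
  | bot => simp [EReal.coe_mul_bot_of_pos ha]
  | top =>
    induction y with
    | bot => simp [EReal.coe_mul_bot_of_pos ha, EReal.coe_mul_top_of_pos ha]
    | top => simp [EReal.coe_mul_top_of_pos ha]
    | coe y => simp [EReal.coe_mul_top_of_pos ha, ← EReal.coe_mul]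
  | coe x =>
    induction y with
    | bot => simp [EReal.coe_mul_bot_of_pos ha, ← EReal.coe_mul]
    | top => simp [EReal.coe_mul_top_of_pos ha, ← EReal.coe_mul]
    | coe y => norm_cast; ring

lemma EReal_coe_mul_sub {a : ℝ} (ha : 0 ≤ a) (P N : ℝ≥0∞) :
    (a : EReal) * ((P : EReal) - (N : EReal)) =
      ((ENNReal.ofReal a * P : ℝ≥0∞) : EReal) - ((ENNReal.ofReal a * N : ℝ≥0∞) : EReal) := by
  rw [sub_eq_add_neg, EReal_coe_mul_add ha, mul_neg, ← sub_eq_add_neg, EReal.coe_ennreal_mul,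
    EReal.coe_ennreal_mul, EReal.coe_ennreal_ofReal, max_eq_left ha]

lemma ENNReal_coe_sub_ne_bot {P N : ℝ≥0∞} (hN : N ≠ ∞) : (P : EReal) - (N : EReal) ≠ ⊥ := by
  rw [← EReal.coe_ennreal_toReal hN]
  rcases eq_or_ne P ∞ with rfl | hP
  · simp
  · rw [← EReal.coe_ennreal_toReal hP, ← EReal.coe_sub]
    exact EReal.coe_ne_bot _

/-- An identity without finiteness assumptions: under `∞ - ∞ = -∞`, an infinite `N₁` or `N₂` makes
both sides `-∞`. -/
lemma ENNReal_coe_add_sub_add (P₁ P₂ N₁ N₂ : ℝ≥0∞) :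
    ((P₁ + P₂ : ℝ≥0∞) : EReal) - ((N₁ + N₂ : ℝ≥0∞) : EReal) =
      ((P₁ : EReal) - (N₁ : EReal)) + ((P₂ : EReal) - (N₂ : EReal)) := by
  rcases eq_or_ne N₁ ∞ with rfl | h1
  · simp
  rcases eq_or_ne N₂ ∞ with rfl | h2
  · simp
  rcases eq_or_ne P₁ ∞ with rfl | h3
  · rw [top_add, EReal.coe_ennreal_top, ← EReal.coe_ennreal_toReal h1,
      ← EReal.coe_ennreal_toReal (ENNReal.add_ne_top.2 ⟨h1, h2⟩), EReal.top_sub_coe,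
      EReal.top_sub_coe, EReal.top_add_of_ne_bot (ENNReal_coe_sub_ne_bot h2)]
  rcases eq_or_ne P₂ ∞ with rfl | h4
  · rw [add_top, EReal.coe_ennreal_top, ← EReal.coe_ennreal_toReal h2,
      ← EReal.coe_ennreal_toReal (ENNReal.add_ne_top.2 ⟨h1, h2⟩), EReal.top_sub_coe,
      EReal.top_sub_coe, EReal.add_top_of_ne_bot (ENNReal_coe_sub_ne_bot h1)]
  rw [← EReal.coe_ennreal_toReal h1, ← EReal.coe_ennreal_toReal h2,
    ← EReal.coe_ennreal_toReal h3, ← EReal.coe_ennreal_toReal h4,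
    ← EReal.coe_ennreal_toReal (ENNReal.add_ne_top.2 ⟨h1, h2⟩),
    ← EReal.coe_ennreal_toReal (ENNReal.add_ne_top.2 ⟨h3, h4⟩), ENNReal.toReal_add h1 h2,
    ENNReal.toReal_add h3 h4]
  norm_cast
  ring

/-- The two differences agree when everything is finite. If cancellation fails because `N'` is
infinite, the left side is `-∞`. If instead `P` is infinite, the right side is `∞`. -/
lemma ENNReal_coe_sub_le_of_add_eq {P N P' N' : ℝ≥0∞} (h : P + N' = N + P') (hN : N ≤ N') :
    (P' : EReal) - (N' : EReal) ≤ (P : EReal) - (N : EReal) := by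
  rcases eq_or_ne N' ∞ with rfl | h1
  · simp
  have h2 : N ≠ ∞ := ne_top_of_le_ne_top h1 hN
  rcases eq_or_ne P ∞ with rfl | h3
  · rw [EReal.coe_ennreal_top, ← EReal.coe_ennreal_toReal h2, EReal.top_sub_coe]
    exact le_top
  have h4 : P' ≠ ∞ := by
    rintro rfl
    rw [add_top, ENNReal.add_eq_top] at h
    tauto
  have := congrArg ENNReal.toReal h
  rw [ENNReal.toReal_add h3 h1, ENNReal.toReal_add h2 h4] at this
  rw [← EReal.coe_ennreal_toReal h1, ← EReal.coe_ennreal_toReal h2,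
    ← EReal.coe_ennreal_toReal h3, ← EReal.coe_ennreal_toReal h4, ← EReal.coe_sub,
    ← EReal.coe_sub, EReal.coe_le_coe_iff]
  linarith

/-! ### Convexity of the lifted energy -/

/-- The terms in the fixed measure `μ'` distribute over the combination because `a + b = 1`. The
dual value is hence affine in the first measure, infinite values included. -/
lemma dualValue_combo {μ₁ μ₂ μ' : Measure Gray} {p : (Gray → ℝ) × (Gray → ℝ)} {a b : ℝ}
    (ha : 0 ≤ a) (hb : 0 ≤ b) (hab : a + b = 1) :
    dualValue (ENNReal.ofReal a • μ₁ + ENNReal.ofReal b • μ₂) μ' p =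
      a * dualValue μ₁ μ' p + b * dualValue μ₂ μ' p := by
  have hone : ENNReal.ofReal a + ENNReal.ofReal b = 1 := by
    rw [← ENNReal.ofReal_add ha hb, hab, ENNReal.ofReal_one]
  have e : ∀ A₁ A₂ k : ℝ≥0∞, ENNReal.ofReal a * A₁ + ENNReal.ofReal b * A₂ + k =
      ENNReal.ofReal a * (A₁ + k) + ENNReal.ofReal b * (A₂ + k) := fun A₁ A₂ k => by
    conv_lhs => rw [← one_mul k, ← hone]
    ring
  simp only [dualValue, lintegral_add_measure, lintegral_smul_measure, smul_eq_mul]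
  rw [EReal_coe_mul_sub ha, EReal_coe_mul_sub hb, ← ENNReal_coe_add_sub_add, e, e]

/-- Taking parts after combining decreases the positive and the negative part by the same amount.
For finite integrals the dual value would be affine. Cancellation of infinite parts can only raise
it above `-∞`, so concavity is what remains. -/
lemma dualValue_concave {μ μ' : Measure Gray} {p q : (Gray → ℝ) × (Gray → ℝ)}
    (hp1 : Measurable p.1) (hp2 : Measurable p.2) (hq1 : Measurable q.1) (hq2 : Measurable q.2)
    {a b : ℝ} (ha : 0 ≤ a) (hb : 0 ≤ b) :
    a * dualValue μ μ' p + b * dualValue μ μ' q ≤ dualValue μ μ' (a • p + b • q) := by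
  have pt : ∀ x y : ℝ, ENNReal.ofReal (a * x + b * y) +
      (ENNReal.ofReal a * ENNReal.ofReal (-x) + ENNReal.ofReal b * ENNReal.ofReal (-y)) =
      ENNReal.ofReal (-(a * x + b * y)) +
      (ENNReal.ofReal a * ENNReal.ofReal x + ENNReal.ofReal b * ENNReal.ofReal y) := by
    intro x y
    simp only [ENNReal.ofReal]
    norm_cast
    rw [← NNReal.coe_inj]
    push_cast
    simp only [Real.coe_toNNReal', max_eq_left ha, max_eq_left hb]
    have h1 : ∀ z : ℝ, max z 0 = max (-z) 0 + z := fun z => by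
      rcases le_total z 0 with h | h
      · rw [max_eq_right h, max_eq_left (by linarith)]; ring
      · rw [max_eq_left h, max_eq_right (by linarith)]; ring
    rw [h1 (a * x + b * y), h1 x, h1 y]
    ring
  have pt' : ∀ x y : ℝ, ENNReal.ofReal (-(a * x + b * y)) ≤
      ENNReal.ofReal a * ENNReal.ofReal (-x) + ENNReal.ofReal b * ENNReal.ofReal (-y) := by
    intro x y
    rw [← ENNReal.ofReal_mul ha, ← ENNReal.ofReal_mul hb]
    refine le_trans (ENNReal.ofReal_le_ofReal (le_of_eq ?_)) ENNReal.ofReal_add_le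
    ring
  have key : ∀ (μ : Measure Gray) (g h : Gray → ℝ), Measurable g → Measurable h →
      (∫⁻ γ, ENNReal.ofReal (a * g γ + b * h γ) ∂μ) +
        (ENNReal.ofReal a * (∫⁻ γ, ENNReal.ofReal (-g γ) ∂μ) +
          ENNReal.ofReal b * ∫⁻ γ, ENNReal.ofReal (-h γ) ∂μ) =
      (∫⁻ γ, ENNReal.ofReal (-(a * g γ + b * h γ)) ∂μ) +
        (ENNReal.ofReal a * (∫⁻ γ, ENNReal.ofReal (g γ) ∂μ) +
          ENNReal.ofReal b * ∫⁻ γ, ENNReal.ofReal (h γ) ∂μ) := by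
    intro μ g h hg hh
    have ng : Measurable fun γ => ENNReal.ofReal (-g γ) := hg.neg.ennreal_ofReal
    have nh : Measurable fun γ => ENNReal.ofReal (-h γ) := hh.neg.ennreal_ofReal
    have m1 : Measurable fun γ => a * g γ + b * h γ := (hg.const_mul a).add (hh.const_mul b)
    have nm : Measurable fun γ => ENNReal.ofReal (-(a * g γ + b * h γ)) := m1.neg.ennreal_ofReal
    rw [← lintegral_const_mul _ hg.ennreal_ofReal, ← lintegral_const_mul _ hh.ennreal_ofReal,
      ← lintegral_const_mul _ ng, ← lintegral_const_mul _ nh,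
      ← lintegral_add_left (ng.const_mul _),
      ← lintegral_add_left (hg.ennreal_ofReal.const_mul _),
      ← lintegral_add_left m1.ennreal_ofReal, ← lintegral_add_left nm]
    exact lintegral_congr fun γ => pt _ _
  have key' : ∀ (μ : Measure Gray) (g h : Gray → ℝ), Measurable g → Measurable h →
      (∫⁻ γ, ENNReal.ofReal (-(a * g γ + b * h γ)) ∂μ) ≤
        ENNReal.ofReal a * (∫⁻ γ, ENNReal.ofReal (-g γ) ∂μ) +
          ENNReal.ofReal b * ∫⁻ γ, ENNReal.ofReal (-h γ) ∂μ := by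
    intro μ g h hg hh
    have ng : Measurable fun γ => ENNReal.ofReal (-g γ) := hg.neg.ennreal_ofReal
    have nh : Measurable fun γ => ENNReal.ofReal (-h γ) := hh.neg.ennreal_ofReal
    rw [← lintegral_const_mul _ ng, ← lintegral_const_mul _ nh,
      ← lintegral_add_left (ng.const_mul _)]
    exact lintegral_mono fun γ => pt' _ _
  simp only [dualValue]
  rw [EReal_coe_mul_sub ha, EReal_coe_mul_sub hb, ← ENNReal_coe_add_sub_add]
  have e2 : ∀ γ, -(a * p.2 γ + b * q.2 γ) = a * -p.2 γ + b * -q.2 γ := fun γ => by ring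
  have k1 := key μ p.1 q.1 hp1 hq1
  have k2 := key μ' (fun γ => -p.2 γ) (fun γ => -q.2 γ) hp2.neg hq2.neg
  have k1' := key' μ p.1 q.1 hp1 hq1
  have k2' := key' μ' (fun γ => -p.2 γ) (fun γ => -q.2 γ) hp2.neg hq2.neg
  simp only [← e2, neg_neg] at k2 k2'
  simp only [Prod.fst_add, Prod.snd_add, Prod.smul_fst, Prod.smul_snd, Pi.add_apply,
    Pi.smul_apply, smul_eq_mul]
  refine ENNReal_coe_sub_le_of_add_eq ?_ ?_
  · calc _ = (∫⁻ γ, ENNReal.ofReal (a * p.1 γ + b * q.1 γ) ∂μ) +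
        (ENNReal.ofReal a * (∫⁻ γ, ENNReal.ofReal (-p.1 γ) ∂μ) +
          ENNReal.ofReal b * ∫⁻ γ, ENNReal.ofReal (-q.1 γ) ∂μ) +
        ((∫⁻ γ, ENNReal.ofReal (-(a * p.2 γ + b * q.2 γ)) ∂μ') +
        (ENNReal.ofReal a * (∫⁻ γ, ENNReal.ofReal (p.2 γ) ∂μ') +
          ENNReal.ofReal b * ∫⁻ γ, ENNReal.ofReal (q.2 γ) ∂μ')) := by ring
      _ = _ := by rw [k1, k2]; ring
  · calc _ ≤ _ := add_le_add k1' k2'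
      _ = _ := by ring

lemma convex_dualSet (c : Gray → Gray → ℝ) : Convex ℝ (dualSet c) := by
  intro p hp q hq a b ha hb hab
  refine ⟨(hp.1.const_smul a).add (hq.1.const_smul b),
    (hp.2.1.const_smul a).add (hq.2.1.const_smul b),
    (hp.2.2.1.smul a).add (hq.2.2.1.smul b), (hp.2.2.2.1.smul a).add (hq.2.2.2.1.smul b),
    fun γ₁ γ₂ => ?_⟩
  have h1 := mul_le_mul_of_nonneg_left (hp.2.2.2.2 γ₁ γ₂) ha
  have h2 := mul_le_mul_of_nonneg_left (hq.2.2.2.2 γ₁ γ₂) hb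
  simp only [Prod.fst_add, Prod.snd_add, Prod.smul_fst, Prod.smul_snd, Pi.add_apply,
    Pi.smul_apply, smul_eq_mul]
  calc _ = a * (p.1 γ₁ - p.2 γ₂) + b * (q.1 γ₁ - q.2 γ₂) := by ring
    _ ≤ a * c γ₁ γ₂ + b * c γ₁ γ₂ := add_le_add h1 h2
    _ = c γ₁ γ₂ := by rw [← add_mul, hab, one_mul]

lemma EReal_combo_self {a b : ℝ} (ha : 0 ≤ a) (hb : 0 ≤ b) (hab : a + b = 1) (x : EReal) :
    (a : EReal) * x + b * x = x := by
  rw [← EReal.right_distrib_of_nonneg (EReal.coe_nonneg.2 ha) (EReal.coe_nonneg.2 hb),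
    ← EReal.coe_add, hab, EReal.coe_one, one_mul]

theorem econcaveOn_liftEnergy (Ω : Set Plane) (f : Gray → Plane → ℝ) (lam : ℝ) {ν : ℝ}
    (hν : 0 ≤ ν) (c : Gray → Gray → ℝ) (μ₀ : Measure Gray) (φ : Plane × ℝ → ℝ) :
    EConcaveOn (dualSet c) fun p => liftEnergy Ω f lam ν μ₀ φ p := by
  refine ⟨convex_dualSet c, fun p hp q hq a b ha hb hab => ?_⟩
  simp only [liftEnergy]
  rw [EReal_coe_mul_add ha, EReal_coe_mul_add hb, add_add_add_comm,
    EReal_combo_self ha hb hab]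
  gcongr
  have h := dualValue_concave (μ := liftHist Ω φ) (μ' := μ₀) hp.1 hp.2.1 hq.1 hq.2.1 ha hb
  calc _ = (ν : EReal) * (a * dualValue (liftHist Ω φ) μ₀ p + b * dualValue (liftHist Ω φ) μ₀ q) := by
        rw [EReal_coe_mul_add hν, mul_left_comm (ν : EReal) (a : EReal),
          mul_left_comm (ν : EReal) (b : EReal)]
    _ ≤ _ := mul_le_mul_of_nonneg_left h (EReal.coe_nonneg.2 hν)

/-! ### Normal forms of lifted functions -/

lemma exists_isLift_of_mem {Ω : Set Plane} {φ : Plane × ℝ → ℝ} (h : φ ∈ liftSet Ω) :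
    ∃ φ', IsLift φ' ∧ φ =ᵐ[volume.restrict (cyl Ω)] φ' :=
  exists_isLift h.1 h.2.2.1 h.2.2.2.1 h.2.2.2.2.1

lemma mem_liftSet_of_congr {Ω : Set Plane} {φ φ' : Plane × ℝ → ℝ}
    (he : φ =ᵐ[volume.restrict (cyl Ω)] φ') (h : IsLift φ') (ht : tv₃ Ω φ' < ∞)
    {m : Measure (Plane × ℝ)} (hm : IsNegVertDeriv Ω φ' m) : φ ∈ liftSet Ω := by
  refine ⟨h.measurable.aemeasurable.congr he.symm, by rwa [tv₃_congr he], ?_, ?_, ?_,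
    m, hm.congr he.symm⟩
  · filter_upwards [he] with p hp
    rw [hp]; exact h.mem_Icc p
  · filter_upwards [he] with p hp h0
    rw [hp]; exact h.eq_one p h0
  · filter_upwards [he] with p hp h0
    rw [hp]; exact h.eq_zero p h0

lemma exists_isNegVertDeriv {Ω : Set Plane} {φ φ' : Plane × ℝ → ℝ} (h : φ ∈ liftSet Ω)
    (he : φ =ᵐ[volume.restrict (cyl Ω)] φ') : ∃ m, IsNegVertDeriv Ω φ' m := by
  obtain ⟨m, hm⟩ := h.2.2.2.2.2
  exact ⟨m, hm.congr he⟩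

/-- Every lifted function agrees almost everywhere with one that is made of monotone layers. -/
lemma exists_layers {Ω : Set Plane} (hΩo : IsOpen Ω) (hΩ : Bornology.IsBounded Ω)
    {φ : Plane × ℝ → ℝ} (h : φ ∈ liftSet Ω) :
    ∃ φ', IsLift φ' ∧ φ =ᵐ[volume.restrict (cyl Ω)] φ' ∧ VertNonincr Ω φ' ∧
      IsLayered Ω φ' (quantile φ') ∧
      IsNegVertDeriv Ω φ ((layerMeasure Ω).map fun q => (q.1, (quantile φ' q : ℝ))) := by
  obtain ⟨φ', hl, he⟩ := exists_isLift_of_mem h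
  obtain ⟨m, hm⟩ := exists_isNegVertDeriv h he
  have hlay := isLayered_quantile hΩo hl hm.vertNonincr
  exact ⟨φ', hl, he, hm.vertNonincr, hlay, (isNegVertDeriv_of_isLayered hΩo hΩ hl
    (measurable_quantile hl.measurable) hlay).congr he.symm⟩

/-! ### Convex combinations of lifted functions -/

lemma IsLift.combo {φ φ' : Plane × ℝ → ℝ} (h : IsLift φ) (h' : IsLift φ') {a b : ℝ}
    (ha : 0 ≤ a) (hb : 0 ≤ b) (hab : a + b = 1) : IsLift (a • φ + b • φ') := by
  refine ⟨(h.measurable.const_smul a).add (h'.measurable.const_smul b), fun p => ?_,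
    fun p hp => ?_, fun p hp => ?_⟩
  · exact convex_Icc (0 : ℝ) 1 (h.mem_Icc p) (h'.mem_Icc p) ha hb hab
  · simp [h.eq_one p hp, h'.eq_one p hp, hab]
  · simp [h.eq_zero p hp, h'.eq_zero p hp]

lemma IsLift.integrable_mul {φ g : Plane × ℝ → ℝ} (h : IsLift φ) (hg : Continuous g)
    (hc : HasCompactSupport g) : Integrable (fun p => φ p * g p) :=
  (hg.integrable_of_hasCompactSupport hc).bdd_mul h.measurable.aestronglyMeasurable
    (Eventually.of_forall h.norm_le)

lemma IsLift.integral_combo {φ φ' g : Plane × ℝ → ℝ} (h : IsLift φ) (h' : IsLift φ')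
    (hg : Continuous g) (hc : HasCompactSupport g) (s : Set (Plane × ℝ)) (a b : ℝ) :
    ∫ p in s, (a • φ + b • φ') p * g p =
      a * (∫ p in s, φ p * g p) + b * ∫ p in s, φ' p * g p := by
  rw [← integral_const_mul, ← integral_const_mul, ← integral_add
    ((h.integrable_mul hg hc).restrict.const_mul a) ((h'.integrable_mul hg hc).restrict.const_mul b)]
  refine integral_congr_ae (Eventually.of_forall fun p => ?_)
  simp only [Pi.add_apply, Pi.smul_apply, smul_eq_mul]
  ring

lemma IsNegVertDeriv.combo {Ω : Set Plane} {φ φ' : Plane × ℝ → ℝ} (h : IsLift φ) (h' : IsLift φ')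
    {m m' : Measure (Plane × ℝ)} (hm : IsNegVertDeriv Ω φ m) (hm' : IsNegVertDeriv Ω φ' m')
    {a b : ℝ} (ha : 0 ≤ a) (hb : 0 ≤ b) :
    IsNegVertDeriv Ω (a • φ + b • φ') (ENNReal.ofReal a • m + ENNReal.ofReal b • m') := by
  have := hm.1
  have := hm'.1
  have fa : IsFiniteMeasure (ENNReal.ofReal a • m) := m.smul_finite ENNReal.ofReal_ne_top
  have fb : IsFiniteMeasure (ENNReal.ofReal b • m') := m'.smul_finite ENNReal.ofReal_ne_top
  refine ⟨inferInstance, by simp [hm.2.1, hm'.2.1], fun ζ h1 h2 h3 => ?_⟩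
  have hcont : Continuous fun p => fderiv ℝ ζ p (0, 1) :=
    (h1.continuous_fderiv one_ne_zero).clm_apply continuous_const
  have hcs : HasCompactSupport fun p => fderiv ℝ ζ p (0, 1) :=
    (h2.fderiv ℝ).comp_left (g := fun L : Plane × ℝ →L[ℝ] ℝ => L (0, 1)) rfl
  have iζ : ∀ (κ : Measure (Plane × ℝ)) [IsFiniteMeasure κ], Integrable ζ κ := fun κ _ =>
    h1.continuous.integrable_of_hasCompactSupport h2
  rw [h.integral_combo h' hcont hcs, hm.2.2 ζ h1 h2 h3, hm'.2.2 ζ h1 h2 h3,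
    integral_add_measure (iζ _) (iζ _), integral_smul_measure, integral_smul_measure,
    ENNReal.toReal_ofReal ha, ENNReal.toReal_ofReal hb, smul_eq_mul, smul_eq_mul]

lemma tv₃_combo_le {Ω : Set Plane} {φ φ' : Plane × ℝ → ℝ} (h : IsLift φ) (h' : IsLift φ')
    {a b : ℝ} (ha : 0 ≤ a) (hb : 0 ≤ b) :
    tv₃ Ω (a • φ + b • φ') ≤ ENNReal.ofReal a * tv₃ Ω φ + ENNReal.ofReal b * tv₃ Ω φ' := by
  refine iSup₂_le fun X hX => ?_
  have hXf := hX.1.continuous_fderiv one_ne_zero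
  have hcont : Continuous (divergence₃ X) := by
    unfold divergence₃
    refine (continuous_finsetSum _ fun i _ => ?_).add
      (continuous_snd.comp (hXf.clm_apply continuous_const))
    exact (EuclideanSpace.proj (𝕜 := ℝ) i).continuous.comp
      (continuous_fst.comp (hXf.clm_apply continuous_const))
  have hcs : HasCompactSupport (divergence₃ X) :=
    (hX.2.1.fderiv ℝ).comp_left (g := fun L : Plane × ℝ →L[ℝ] Plane × ℝ =>
      (∑ i : Fin 2, (L (EuclideanSpace.single i 1, 0)).1 i) + (L (0, 1)).2) (by simp)
  rw [h.integral_combo h' hcont hcs]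
  refine ENNReal.ofReal_add_le.trans ?_
  rw [ENNReal.ofReal_mul ha, ENNReal.ofReal_mul hb]
  gcongr
  · exact le_iSup₂ (f := fun X (_ : X ∈ testFields₃ Ω) =>
      ENNReal.ofReal (∫ p in cyl Ω, φ p * divergence₃ X p)) X hX
  · exact le_iSup₂ (f := fun X (_ : X ∈ testFields₃ Ω) =>
      ENNReal.ofReal (∫ p in cyl Ω, φ' p * divergence₃ X p)) X hX

lemma combo_congr {Ω : Set Plane} {φ φ' ρ ρ' : Plane × ℝ → ℝ}
    (h : φ =ᵐ[volume.restrict (cyl Ω)] ρ) (h' : φ' =ᵐ[volume.restrict (cyl Ω)] ρ') (a b : ℝ) :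
    a • φ + b • φ' =ᵐ[volume.restrict (cyl Ω)] a • ρ + b • ρ' :=
  (h.const_smul a).add (h'.const_smul b)

theorem convex_liftSet (Ω : Set Plane) : Convex ℝ (liftSet Ω) := by
  intro φ hφ φ' hφ' a b ha hb hab
  obtain ⟨ρ, hρ, he⟩ := exists_isLift_of_mem hφ
  obtain ⟨ρ', hρ', he'⟩ := exists_isLift_of_mem hφ'
  obtain ⟨m, hm⟩ := exists_isNegVertDeriv hφ he
  obtain ⟨m', hm'⟩ := exists_isNegVertDeriv hφ' he'
  refine mem_liftSet_of_congr (combo_congr he he' a b) (hρ.combo hρ' ha hb hab)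
    ((tv₃_combo_le hρ hρ' ha hb).trans_lt ?_) (hm.combo hρ hρ' hm' ha hb)
  rw [← tv₃_congr he, ← tv₃_congr he']
  exact ENNReal.add_lt_top.2 ⟨ENNReal.mul_lt_top ENNReal.ofReal_lt_top hφ.2.1,
    ENNReal.mul_lt_top ENNReal.ofReal_lt_top hφ'.2.1⟩

lemma grayDeriv_combo {Ω : Set Plane} (hΩo : IsOpen Ω) {φ φ' : Plane × ℝ → ℝ}
    (hφ : φ ∈ liftSet Ω) (hφ' : φ' ∈ liftSet Ω) {a b : ℝ} (ha : 0 ≤ a) (hb : 0 ≤ b) :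
    grayDeriv Ω (a • φ + b • φ') =
      ENNReal.ofReal a • grayDeriv Ω φ + ENNReal.ofReal b • grayDeriv Ω φ' := by
  obtain ⟨ρ, hρ, he⟩ := exists_isLift_of_mem hφ
  obtain ⟨ρ', hρ', he'⟩ := exists_isLift_of_mem hφ'
  obtain ⟨m, hm⟩ := exists_isNegVertDeriv hφ he
  obtain ⟨m', hm'⟩ := exists_isNegVertDeriv hφ' he'
  have hemb : MeasurableEmbedding (Prod.map id Subtype.val : Plane × Gray → Plane × ℝ) :=
    MeasurableEmbedding.id.prodMap (MeasurableEmbedding.subtype_coe measurableSet_Icc)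
  unfold grayDeriv
  rw [negVertDeriv_eq hΩo (hm.congr he.symm), negVertDeriv_eq hΩo (hm'.congr he'.symm),
    negVertDeriv_eq hΩo ((hm.combo hρ hρ' hm' ha hb).congr (combo_congr he he' a b).symm),
    hemb.comap_add, Measure.comap_smul, Measure.comap_smul]

lemma liftHist_combo {Ω : Set Plane} (hΩo : IsOpen Ω) {φ φ' : Plane × ℝ → ℝ}
    (hφ : φ ∈ liftSet Ω) (hφ' : φ' ∈ liftSet Ω) {a b : ℝ} (ha : 0 ≤ a) (hb : 0 ≤ b) :
    liftHist Ω (a • φ + b • φ') =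
      ENNReal.ofReal a • liftHist Ω φ + ENNReal.ofReal b • liftHist Ω φ' := by
  unfold liftHist
  rw [grayDeriv_combo hΩo hφ hφ' ha hb, Measure.map_add _ _ measurable_snd, Measure.map_smul,
    Measure.map_smul, smul_add, smul_comm, smul_comm _ (ENNReal.ofReal b)]

lemma sliceTV_combo_le {Ω : Set Plane} {φ φ' : Plane × ℝ → ℝ}
    (hφ : φ ∈ liftSet Ω) (hφ' : φ' ∈ liftSet Ω) {a b : ℝ} (ha : 0 ≤ a) (hb : 0 ≤ b) :
    sliceTV Ω (a • φ + b • φ') ≤ ENNReal.ofReal a * sliceTV Ω φ + ENNReal.ofReal b * sliceTV Ω φ' := by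
  obtain ⟨ρ, hρ, he⟩ := exists_isLift_of_mem hφ
  obtain ⟨ρ', hρ', he'⟩ := exists_isLift_of_mem hφ'
  rw [sliceTV_congr he, sliceTV_congr he', sliceTV_congr (combo_congr he he' a b)]
  unfold sliceTV
  have m1 : Measurable fun γ => tv Ω fun x => ρ (x, γ) := measurable_tv Ω hρ.measurable hρ.norm_le
  have m2 : Measurable fun γ => tv Ω fun x => ρ' (x, γ) := measurable_tv Ω hρ'.measurable hρ'.norm_le
  rw [← lintegral_const_mul _ m1, ← lintegral_const_mul _ m2,
    ← lintegral_add_left (m1.const_mul _)]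
  refine lintegral_mono fun γ => ?_
  exact tv_add_le (hρ.measurable.comp measurable_prodMk_right).aestronglyMeasurable
    (Eventually.of_forall fun x => hρ.norm_le _)
    (hρ'.measurable.comp measurable_prodMk_right).aestronglyMeasurable
    (Eventually.of_forall fun x => hρ'.norm_le _) ha hb

/-! ### The data term -/

lemma integrable_data {Ω : Set Plane} (hΩo : IsOpen Ω) {f : Gray → Plane → ℝ}
    (hf : ContinuousOn (fun q : Gray × Plane => f q.1 q.2) (univ ×ˢ Ω)) {M : ℝ}
    (hM : ∀ γ, ∀ x ∈ Ω, |f γ x| ≤ M) {m : Measure (Plane × Gray)} [IsFiniteMeasure m]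
    (hm : ∀ᵐ q ∂m, q.1 ∈ Ω) : Integrable (fun q => f q.2 q.1) m := by
  have hs : MeasurableSet (Ω ×ˢ (univ : Set Gray)) := hΩo.measurableSet.prod MeasurableSet.univ
  have hr : m.restrict (Ω ×ˢ univ) = m := Measure.restrict_eq_self_of_ae_mem <| by
    filter_upwards [hm] with q hq using ⟨hq, mem_univ _⟩
  refine Integrable.of_bound (C := M) ?_ ?_
  · rw [← hr]
    refine ContinuousOn.aestronglyMeasurable (hf.comp continuous_swap.continuousOn ?_) hs
    exact fun q hq => ⟨mem_univ _, hq.1⟩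
  · filter_upwards [hm] with q hq
    exact hM _ _ hq

lemma ae_fst_mem_layerMeasure {Ω : Set Plane} (hΩo : IsOpen Ω) :
    ∀ᵐ q ∂layerMeasure Ω, q.1 ∈ Ω := by
  have : ∀ᵐ x ∂(layerMeasure Ω).map Prod.fst, x ∈ Ω := by
    rw [map_fst_layerMeasure]; exact ae_restrict_mem hΩo.measurableSet
  exact ae_of_ae_map measurable_fst.aemeasurable this

lemma grayDeriv_finite_and_ae {Ω : Set Plane} (hΩo : IsOpen Ω) (hΩ : Bornology.IsBounded Ω)
    {φ : Plane × ℝ → ℝ} (h : φ ∈ liftSet Ω) :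
    IsFiniteMeasure (grayDeriv Ω φ) ∧ ∀ᵐ q ∂grayDeriv Ω φ, q.1 ∈ Ω := by
  obtain ⟨φ', hl, he, _, hlay, hm⟩ := exists_layers hΩo hΩ h
  have hq := measurable_quantile hl.measurable
  have := isFiniteMeasure_layerMeasure hΩ
  rw [grayDeriv_eq hΩo hq hm]
  refine ⟨inferInstance, ?_⟩
  rw [ae_map_iff (measurable_fst.prodMk hq).aemeasurable (measurable_fst hΩo.measurableSet)]
  exact ae_fst_mem_layerMeasure hΩo

lemma integral_grayDeriv_combo {Ω : Set Plane} (hΩo : IsOpen Ω) (hΩ : Bornology.IsBounded Ω)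
    {f : Gray → Plane → ℝ}
    (hf : ContinuousOn (fun q : Gray × Plane => f q.1 q.2) (univ ×ˢ Ω)) {M : ℝ}
    (hM : ∀ γ, ∀ x ∈ Ω, |f γ x| ≤ M) {φ φ' : Plane × ℝ → ℝ}
    (hφ : φ ∈ liftSet Ω) (hφ' : φ' ∈ liftSet Ω) {a b : ℝ} (ha : 0 ≤ a) (hb : 0 ≤ b) :
    ∫ q, f q.2 q.1 ∂grayDeriv Ω (a • φ + b • φ') =
      a * ∫ q, f q.2 q.1 ∂grayDeriv Ω φ + b * ∫ q, f q.2 q.1 ∂grayDeriv Ω φ' := by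
  obtain ⟨h1, h2⟩ := grayDeriv_finite_and_ae hΩo hΩ hφ
  obtain ⟨h3, h4⟩ := grayDeriv_finite_and_ae hΩo hΩ hφ'
  rw [grayDeriv_combo hΩo hφ hφ' ha hb, integral_add_measure
    ((integrable_data hΩo hf hM h2).smul_measure ENNReal.ofReal_ne_top)
    ((integrable_data hΩo hf hM h4).smul_measure ENNReal.ofReal_ne_top), integral_smul_measure,
    integral_smul_measure, ENNReal.toReal_ofReal ha, ENNReal.toReal_ofReal hb, smul_eq_mul,
    smul_eq_mul]

/-- Data term and dual term are affine in `φ`, since the vertical derivative is linear. The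
inequality comes only from the sliced variation. -/
theorem econvexOn_liftEnergy {Ω : Set Plane} (hΩo : IsOpen Ω) (hΩ : Bornology.IsBounded Ω)
    {f : Gray → Plane → ℝ}
    (hf : ContinuousOn (fun q : Gray × Plane => f q.1 q.2) (univ ×ˢ Ω)) {M : ℝ}
    (hM : ∀ γ, ∀ x ∈ Ω, |f γ x| ≤ M) {lam ν : ℝ} (hlam : 0 ≤ lam) (hν : 0 ≤ ν)
    (μ₀ : Measure Gray) (p : (Gray → ℝ) × (Gray → ℝ)) :
    EConvexOn (liftSet Ω) fun φ => liftEnergy Ω f lam ν μ₀ φ p := by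
  refine ⟨convex_liftSet Ω, fun φ hφ φ' hφ' a b ha hb hab => ?_⟩
  have hS : ((sliceTV Ω (a • φ + b • φ') : ℝ≥0∞) : EReal) ≤
      a * (sliceTV Ω φ : EReal) + b * (sliceTV Ω φ' : EReal) := by
    have := EReal.coe_ennreal_le_coe_ennreal_iff.2 (sliceTV_combo_le hφ hφ' ha hb)
    rwa [EReal.coe_ennreal_add, EReal.coe_ennreal_mul, EReal.coe_ennreal_mul,
      EReal.coe_ennreal_ofReal, EReal.coe_ennreal_ofReal, max_eq_left ha, max_eq_left hb] at this
  have hS' := mul_le_mul_of_nonneg_left hS (EReal.coe_nonneg.2 hlam)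
  simp only [liftEnergy]
  rw [integral_grayDeriv_combo hΩo hΩ hf hM hφ hφ' ha hb, liftHist_combo hΩo hφ hφ' ha hb,
    dualValue_combo ha hb hab]
  refine (add_le_add_left (add_le_add_right hS' _) _).trans_eq ?_
  simp only [EReal.coe_add, EReal.coe_mul, EReal_coe_mul_add ha, EReal_coe_mul_add hb,
    EReal_coe_mul_add hν, EReal_coe_mul_add hlam, mul_left_comm (lam : EReal),
    mul_left_comm (ν : EReal)]
  simp only [sliceTV]
  abel

/-! ### Energies as suprema over potentials -/

lemma isProbabilityMeasure_map_normalized {T : Type*} [MeasurableSpace T] {κ : Measure T}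
    (h0 : κ univ ≠ 0) (h1 : κ univ ≠ ∞) {U : T → Gray} (hU : AEMeasurable U κ) :
    IsProbabilityMeasure ((κ univ)⁻¹ • κ.map U) := ⟨by
  rw [Measure.smul_apply, Measure.map_apply_of_aemeasurable hU MeasurableSet.univ, preimage_univ,
    smul_eq_mul, ENNReal.inv_mul_cancel h0 h1]⟩

lemma isProbabilityMeasure_hist {Ω : Set Plane} (hΩo : IsOpen Ω) (hΩ : Bornology.IsBounded Ω)
    (hne : Ω.Nonempty) {u : Plane → Gray} (hu : AEMeasurable u (volume.restrict Ω)) :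
    IsProbabilityMeasure (hist Ω u) := by
  have h := isProbabilityMeasure_map_normalized (κ := volume.restrict Ω)
    (by simpa using (hΩo.measure_pos volume hne).ne') (by simpa using hΩ.measure_lt_top.ne) hu
  rwa [Measure.restrict_apply_univ] at h

lemma isProbabilityMeasure_layers {Ω : Set Plane} (hΩo : IsOpen Ω) (hΩ : Bornology.IsBounded Ω)
    (hne : Ω.Nonempty) {U : Plane × ℝ → Gray} (hU : Measurable U) :
    IsProbabilityMeasure ((volume Ω)⁻¹ • (layerMeasure Ω).map U) := by
  have h := isProbabilityMeasure_map_normalized (κ := layerMeasure Ω)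
    (by rw [layerMeasure_univ]; exact (hΩo.measure_pos volume hne).ne')
    (by rw [layerMeasure_univ]; exact hΩ.measure_lt_top.ne) hU.aemeasurable
  rwa [layerMeasure_univ] at h

lemma isProbabilityMeasure_liftHist {Ω : Set Plane} (hΩo : IsOpen Ω) (hΩ : Bornology.IsBounded Ω)
    (hne : Ω.Nonempty) {φ : Plane × ℝ → ℝ} (h : φ ∈ liftSet Ω) :
    IsProbabilityMeasure (liftHist Ω φ) := by
  obtain ⟨φ', hl, he, _, hlay, hm⟩ := exists_layers hΩo hΩ h
  have hq := measurable_quantile hl.measurable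
  rw [liftHist_eq hΩo hq hm]
  exact isProbabilityMeasure_layers hΩo hΩ hne hq

lemma EReal_top_add_coe_mul {A : ℝ} {lam : ℝ} (hlam : 0 < lam) :
    (A : EReal) + (lam : EReal) * ((∞ : ℝ≥0∞) : EReal) = ⊤ := by
  rw [EReal.coe_ennreal_top, EReal.coe_mul_top_of_pos hlam, EReal.coe_add_top]

/-- Kantorovich duality inside the energy, for any class between the continuous potentials and `D`.
The full class gives the stated problem and the continuous one gives lower semicontinuity. Infinite
`B` is treated apart, since the finite summand can then not be moved across the supremum. -/
lemma iSup_add_mul_dualValue {c : Gray → Gray → ℝ}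
    (hc : LowerSemicontinuous (fun p : Gray × Gray => c p.1 p.2)) (μ μ' : Measure Gray)
    [IsProbabilityMeasure μ] [IsProbabilityMeasure μ'] {D : Set ((Gray → ℝ) × (Gray → ℝ))}
    (h1 : contDual c ⊆ D) (h2 : D ⊆ dualSet c) {lam ν : ℝ} (hlam : 0 < lam) (hν : 0 < ν)
    (A : ℝ) (B : ℝ≥0∞) :
    ⨆ p ∈ D, ((A : EReal) + (lam : EReal) * (B : EReal) + (ν : EReal) * dualValue μ μ' p) =
      (A : EReal) + (lam : EReal) * (B : EReal) + (ν : EReal) * transportCost c μ μ' := by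
  have hν' : (0 : EReal) ≤ ν := EReal.coe_nonneg.2 hν.le
  refine le_antisymm (iSup₂_le fun p hp => ?_) ?_
  · gcongr
    exact dualValue_le_transportCost hc (h2 hp)
  obtain ⟨m, hm⟩ := exists_lower_bound hc
  rcases eq_or_ne B ∞ with rfl | hB
  · have hp := const_mem_contDual hm
    refine le_trans ?_ (le_iSup₂_of_le _ (h1 hp) le_rfl)
    rw [dualValue_eq_coe (integrable_of_continuous hp.1) (integrable_of_continuous hp.2.1),
      EReal_top_add_coe_mul hlam, ← EReal.coe_mul, EReal.top_add_coe]
    exact le_top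
  · obtain ⟨a, ha⟩ : ∃ a : ℝ, (a : EReal) = (A : EReal) + (lam : EReal) * (B : EReal) :=
      ⟨A + lam * B.toReal, by rw [EReal.coe_add, EReal.coe_mul, EReal.coe_ennreal_toReal hB]⟩
    rw [← ha, add_comm, ← EReal.le_sub_iff_add_le (by simp) (by simp), mul_comm,
      ← EReal.le_div_iff_mul_le (EReal.coe_pos.2 hν) (EReal.coe_ne_top _),
      transportCost_eq_iSup hc μ μ']
    refine iSup₂_le fun p hp => ?_
    rw [EReal.le_div_iff_mul_le (EReal.coe_pos.2 hν) (EReal.coe_ne_top _),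
      EReal.le_sub_iff_add_le (by simp) (by simp), add_comm, mul_comm]
    exact le_iSup₂_of_le p (h1 hp) le_rfl

lemma energy_eq_iSup {Ω : Set Plane} (hΩo : IsOpen Ω) (hΩ : Bornology.IsBounded Ω)
    (hne : Ω.Nonempty) (f : Gray → Plane → ℝ) {lam ν : ℝ} (hlam : 0 < lam) (hν : 0 < ν)
    {c : Gray → Gray → ℝ} (hc : LowerSemicontinuous (fun p : Gray × Gray => c p.1 p.2))
    (μ₀ : Measure Gray) [IsProbabilityMeasure μ₀] {D : Set ((Gray → ℝ) × (Gray → ℝ))}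
    (h1 : contDual c ⊆ D) (h2 : D ⊆ dualSet c) {u : Plane → Gray}
    (hu : AEMeasurable u (volume.restrict Ω)) :
    energy Ω f lam ν c μ₀ u = ⨆ p ∈ D, energyDual Ω f lam ν μ₀ u p := by
  have := isProbabilityMeasure_hist hΩo hΩ hne hu
  exact (iSup_add_mul_dualValue hc _ _ h1 h2 hlam hν _ _).symm

lemma relaxedEnergy_eq {Ω : Set Plane} (hΩo : IsOpen Ω) (hΩ : Bornology.IsBounded Ω)
    (hne : Ω.Nonempty) (f : Gray → Plane → ℝ) {lam ν : ℝ} (hlam : 0 < lam) (hν : 0 < ν)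
    {c : Gray → Gray → ℝ} (hc : LowerSemicontinuous (fun p : Gray × Gray => c p.1 p.2))
    (μ₀ : Measure Gray) [IsProbabilityMeasure μ₀] {φ : Plane × ℝ → ℝ} (hφ : φ ∈ liftSet Ω) :
    relaxedEnergy Ω f lam ν c μ₀ φ = ((∫ q, f q.2 q.1 ∂(grayDeriv Ω φ) : ℝ) : EReal) +
      (lam : EReal) * (sliceTV Ω φ : EReal) +
      (ν : EReal) * transportCost c (liftHist Ω φ) μ₀ := by
  have := isProbabilityMeasure_liftHist hΩo hΩ hne hφ
  exact iSup_add_mul_dualValue hc _ _ (contDual_subset c) le_rfl hlam hν _ _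

lemma relaxedEnergy_eq_iSup {Ω : Set Plane} (hΩo : IsOpen Ω) (hΩ : Bornology.IsBounded Ω)
    (hne : Ω.Nonempty) (f : Gray → Plane → ℝ) {lam ν : ℝ} (hlam : 0 < lam) (hν : 0 < ν)
    {c : Gray → Gray → ℝ} (hc : LowerSemicontinuous (fun p : Gray × Gray => c p.1 p.2))
    (μ₀ : Measure Gray) [IsProbabilityMeasure μ₀] {φ : Plane × ℝ → ℝ} (hφ : φ ∈ liftSet Ω) :
    relaxedEnergy Ω f lam ν c μ₀ φ = ⨆ p ∈ contDual c, liftEnergy Ω f lam ν μ₀ φ p := by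
  have := isProbabilityMeasure_liftHist hΩo hΩ hne hφ
  rw [relaxedEnergy_eq hΩo hΩ hne f hlam hν hc μ₀ hφ]
  exact (iSup_add_mul_dualValue hc _ _ le_rfl (contDual_subset c) hlam hν _ _).symm

lemma coe_le_transportCost {c : Gray → Gray → ℝ}
    (hc : LowerSemicontinuous (fun p : Gray × Gray => c p.1 p.2)) {m : ℝ}
    (hm : ∀ γ₁ γ₂, m ≤ c γ₁ γ₂) (μ μ' : Measure Gray) [IsProbabilityMeasure μ]
    [IsProbabilityMeasure μ'] : (m : EReal) ≤ transportCost c μ μ' := by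
  have hp := const_mem_contDual hm
  refine le_of_eq_of_le ?_ (dualValue_le_transportCost hc (contDual_subset c hp))
  rw [dualValue_eq_coe (integrable_of_continuous hp.1) (integrable_of_continuous hp.2.1)]
  simp

lemma ne_top_of_add_mul_ne_top {lam ν : ℝ} (hlam : 0 < lam) (hν : 0 < ν) {A m : ℝ} {B : ℝ≥0∞}
    {T : EReal} (hT : (m : EReal) ≤ T) (h : (A : EReal) + lam * (B : EReal) + ν * T ≠ ⊤) :
    B ≠ ∞ := by
  rintro rfl
  refine h (eq_top_iff.2 (le_trans ?_
    (add_le_add_right (mul_le_mul_of_nonneg_left hT (EReal.coe_nonneg.2 hν.le)) _)))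
  rw [EReal_top_add_coe_mul hlam, ← EReal.coe_mul, EReal.top_add_coe]

/-- Coercivity: data term and cost are bounded below, so an energy bound controls the variation. -/
lemma le_ofReal_of_add_mul_le {lam ν : ℝ} (hlam : 0 < lam) (hν : 0 < ν) {A K m r : ℝ} {B : ℝ≥0∞}
    {T : EReal} (hA : -K ≤ A) (hT : (m : EReal) ≤ T)
    (h : (A : EReal) + lam * (B : EReal) + ν * T ≤ r) :
    B ≤ ENNReal.ofReal ((r + K - ν * m) / lam) := by
  have hB := ne_top_of_add_mul_ne_top hlam hν hT (ne_top_of_le_ne_top (EReal.coe_ne_top r) h)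
  have h1 : (A : EReal) + lam * (B : EReal) + ν * m ≤ r :=
    (add_le_add_right (mul_le_mul_of_nonneg_left hT (EReal.coe_nonneg.2 hν.le)) _).trans h
  rw [← EReal.coe_ennreal_toReal hB] at h1
  norm_cast at h1
  rw [ENNReal.le_ofReal_iff_toReal_le hB, le_div_iff₀ hlam]
  · linarith
  · have : 0 ≤ lam * B.toReal := by positivity
    exact div_nonneg (by linarith) hlam.le

/-! ### Lower semicontinuity -/

/-- Lower semicontinuity at a fixed potential: there the finite part `r n` converges, and only the
variation `B n` is merely lower semicontinuous. -/
lemma add_mul_le_of_tendsto {lam : ℝ} (hlam : 0 < lam) {r : ℕ → ℝ} {r₀ : ℝ}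
    (hr : Tendsto r atTop (𝓝 r₀)) {B : ℕ → ℝ≥0∞} {B₀ : ℝ≥0∞} (hB : B₀ ≤ liminf B atTop)
    {α : ℕ → EReal} {I : EReal} (hα : Tendsto α atTop (𝓝 I))
    (h : ∀ n, (r n : EReal) + lam * (B n : EReal) ≤ α n) :
    (r₀ : EReal) + lam * (B₀ : EReal) ≤ I := by
  refine EReal.le_of_forall_lt_iff_le.1 fun s hs => ?_
  have hev : ∀ᶠ n in atTop, r n ≤ s ∧ B n ≤ ENNReal.ofReal ((s - r n) / lam) := by
    filter_upwards [hα.eventually (gt_mem_nhds hs)] with n hn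
    have h1 := (h n).trans hn.le
    have hBn : B n ≠ ∞ := by
      intro hB
      rw [hB, EReal_top_add_coe_mul hlam] at h1
      exact absurd h1 (by simp)
    rw [← EReal.coe_ennreal_toReal hBn] at h1
    norm_cast at h1
    have h2 : 0 ≤ lam * (B n).toReal := by positivity
    refine ⟨by linarith, ?_⟩
    rw [ENNReal.le_ofReal_iff_toReal_le hBn (div_nonneg (by linarith) hlam.le), le_div_iff₀ hlam]
    linarith
  have h0 : r₀ ≤ s := le_of_tendsto hr (hev.mono fun n hn => hn.1)
  have h1 : B₀ ≤ ENNReal.ofReal ((s - r₀) / lam) := by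
    have ht : Tendsto (fun n => ENNReal.ofReal ((s - r n) / lam)) atTop
        (𝓝 (ENNReal.ofReal ((s - r₀) / lam))) :=
      (ENNReal.continuous_ofReal.tendsto _).comp ((hr.const_sub s).div_const lam)
    exact hB.trans ((liminf_le_liminf (hev.mono fun n hn => hn.2)).trans_eq ht.liminf_eq)
  have hB0 : B₀ ≠ ∞ := ne_top_of_le_ne_top ENNReal.ofReal_ne_top h1
  rw [ENNReal.le_ofReal_iff_toReal_le hB0 (div_nonneg (by linarith) hlam.le), le_div_iff₀ hlam] at h1
  rw [← EReal.coe_ennreal_toReal hB0]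
  norm_cast
  linarith

lemma continuous_data {Ω : Set Plane} {f : Gray → Plane → ℝ}
    (hf : ContinuousOn (fun q : Gray × Plane => f q.1 q.2) (univ ×ˢ Ω)) {x : Plane} (hx : x ∈ Ω) :
    Continuous fun γ => f γ x := by
  rw [← continuousOn_univ]
  exact hf.comp (Continuous.prodMk_left x).continuousOn fun γ _ => ⟨mem_univ _, hx⟩

/-! ### Data terms and histograms under almost everywhere convergence -/

section Layers

variable {T : Type*} [MeasurableSpace T] {κ : Measure T} [IsFiniteMeasure κ] {Ω : Set Plane}
  {f : Gray → Plane → ℝ} {X : T → Plane}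

lemma integrable_data_comp (hΩo : IsOpen Ω)
    (hf : ContinuousOn (fun q : Gray × Plane => f q.1 q.2) (univ ×ˢ Ω)) {M : ℝ}
    (hM : ∀ γ, ∀ x ∈ Ω, |f γ x| ≤ M) (hX : Measurable X) (hXΩ : ∀ᵐ t ∂κ, X t ∈ Ω) {U : T → Gray}
    (hU : Measurable U) : Integrable (fun t => f (U t) (X t)) κ := by
  have hm : Measurable fun t => (X t, U t) := hX.prodMk hU
  have : Integrable (fun q => f q.2 q.1) (κ.map fun t => (X t, U t)) := by
    refine integrable_data hΩo hf hM ?_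
    rw [ae_map_iff hm.aemeasurable (measurable_fst hΩo.measurableSet)]
    exact hXΩ
  exact this.comp_measurable hm

lemma integral_data_map (hΩo : IsOpen Ω)
    (hf : ContinuousOn (fun q : Gray × Plane => f q.1 q.2) (univ ×ˢ Ω)) {M : ℝ}
    (hM : ∀ γ, ∀ x ∈ Ω, |f γ x| ≤ M) (hX : Measurable X) (hXΩ : ∀ᵐ t ∂κ, X t ∈ Ω) {U : T → Gray}
    (hU : Measurable U) :
    ∫ q, f q.2 q.1 ∂(κ.map fun t => (X t, U t)) = ∫ t, f (U t) (X t) ∂κ := by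
  have hm : Measurable fun t => (X t, U t) := hX.prodMk hU
  refine integral_map hm.aemeasurable (integrable_data hΩo hf hM ?_).aestronglyMeasurable
  rw [ae_map_iff hm.aemeasurable (measurable_fst hΩo.measurableSet)]
  exact hXΩ

lemma abs_integral_data_le {M : ℝ}
    (hM : ∀ γ, ∀ x ∈ Ω, |f γ x| ≤ M) (hXΩ : ∀ᵐ t ∂κ, X t ∈ Ω) (U : T → Gray) :
    -(M * κ.real univ) ≤ ∫ t, f (U t) (X t) ∂κ := by
  have := norm_integral_le_of_norm_le_const (μ := κ) (f := fun t => f (U t) (X t)) (C := M)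
    (by filter_upwards [hXΩ] with t ht using hM _ _ ht)
  exact (abs_le.1 this).1

lemma tendsto_integral_data (hΩo : IsOpen Ω)
    (hf : ContinuousOn (fun q : Gray × Plane => f q.1 q.2) (univ ×ˢ Ω)) {M : ℝ}
    (hM : ∀ γ, ∀ x ∈ Ω, |f γ x| ≤ M) (hX : Measurable X) (hXΩ : ∀ᵐ t ∂κ, X t ∈ Ω)
    {U : ℕ → T → Gray} (hU : ∀ n, Measurable (U n)) {U₀ : T → Gray}
    (h : ∀ᵐ t ∂κ, Tendsto (fun n => U n t) atTop (𝓝 (U₀ t))) :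
    Tendsto (fun n => ∫ t, f (U n t) (X t) ∂κ) atTop (𝓝 (∫ t, f (U₀ t) (X t) ∂κ)) := by
  refine tendsto_integral_of_dominated_convergence (fun _ => M)
    (fun n => (integrable_data_comp hΩo hf hM hX hXΩ (hU n)).aestronglyMeasurable)
    (integrable_const M) (fun n => ?_) ?_
  · filter_upwards [hXΩ] with t ht using hM _ _ ht
  · filter_upwards [hXΩ, h] with t ht h1
    exact ((continuous_data hf ht).tendsto _).comp h1

lemma tendsto_integral_potential {ψ : Gray → ℝ} (hψ : Continuous ψ) (a : ℝ≥0∞)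
    {U : ℕ → T → Gray} (hU : ∀ n, Measurable (U n)) {U₀ : T → Gray} (hU₀ : Measurable U₀)
    (h : ∀ᵐ t ∂κ, Tendsto (fun n => U n t) atTop (𝓝 (U₀ t))) :
    Tendsto (fun n => ∫ γ, ψ γ ∂(a • κ.map (U n))) atTop (𝓝 (∫ γ, ψ γ ∂(a • κ.map U₀))) := by
  obtain ⟨C, hC⟩ := isCompact_univ.exists_bound_of_continuousOn hψ.continuousOn
  simp_rw [integral_smul_measure]
  refine Tendsto.const_smul ?_ _
  rw [integral_map hU₀.aemeasurable hψ.aestronglyMeasurable]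
  simp_rw [fun n => integral_map (μ := κ) (hU n).aemeasurable hψ.aestronglyMeasurable]
  refine tendsto_integral_of_dominated_convergence (fun _ => C)
    (fun n => (hψ.measurable.comp (hU n)).aestronglyMeasurable)
    (integrable_const C) (fun n => Eventually.of_forall fun t => hC _ (mem_univ _)) ?_
  filter_upwards [h] with t h1
  exact (hψ.tendsto _).comp h1

end Layers

/-! ### The original problem has a minimizer -/

/-- Staying below `F x₀` gives the uniform energy bound. Monotonicity makes the sublevel sets of the
relaxed problem nested. -/
lemma exists_minimizing_seq {α : Type*} {s : Set α} (F : α → EReal) {x₀ : α} (hx₀ : x₀ ∈ s) :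
    ∃ (x : ℕ → α) (I : EReal), (∀ n, x n ∈ s) ∧ (∀ n, F (x n) ≤ F x₀) ∧
      Antitone (fun n => F (x n)) ∧ Tendsto (fun n => F (x n)) atTop (𝓝 I) ∧ ∀ y ∈ s, I ≤ F y := by
  have hmem : ∀ y ∈ s, F y ≤ F x₀ → F y ∈ F '' (s ∩ {y | F y ≤ F x₀}) := fun y hy h =>
    mem_image_of_mem F ⟨hy, h⟩
  obtain ⟨α, h1, h2, h3⟩ := exists_seq_tendsto_sInf ⟨_, hmem x₀ hx₀ le_rfl⟩ (OrderBot.bddBelow _)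
  choose x hx hxα using h3
  obtain rfl : (fun n => F (x n)) = α := funext hxα
  refine ⟨x, _, fun n => (hx n).1, fun n => (hx n).2, h1, h2, fun y hy => ?_⟩
  rcases le_total (F y) (F x₀) with h | h
  · exact sInf_le (hmem y hy h)
  · exact (sInf_le (hmem x₀ hx₀ le_rfl)).trans h

lemma energy_congr {Ω : Set Plane} {u v : Plane → Gray} (h : u =ᵐ[volume.restrict Ω] v)
    (f : Gray → Plane → ℝ) (lam ν : ℝ) (c : Gray → Gray → ℝ) (μ₀ : Measure Gray) :
    energy Ω f lam ν c μ₀ u = energy Ω f lam ν c μ₀ v := by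
  have h1 : ∫ x in Ω, f (u x) x = ∫ x in Ω, f (v x) x := integral_congr_ae <| by
    filter_upwards [h] with x hx
    rw [hx]
  have h2 : tv Ω (fun x => (u x : ℝ)) = tv Ω fun x => (v x : ℝ) := tv_congr <| by
    filter_upwards [h] with x hx
    rw [hx]
  rw [energy, energy, h1, h2, hist, hist, Measure.map_congr h]

lemma exists_measurable_of_mem {Ω : Set Plane} {u : Plane → Gray} (h : u ∈ bvGray Ω) :
    ∃ v, Measurable v ∧ v ∈ bvGray Ω ∧ u =ᵐ[volume.restrict Ω] v := by
  refine ⟨h.1.mk u, h.1.measurable_mk, ⟨h.1.measurable_mk.aemeasurable, ?_⟩, h.1.ae_eq_mk⟩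
  refine lt_of_eq_of_lt (tv_congr ?_) h.2
  filter_upwards [h.1.ae_eq_mk] with x hx
  rw [hx]

lemma const_mem_bvGray (Ω : Set Plane) (γ : Gray) : (fun _ => γ) ∈ bvGray Ω :=
  ⟨aemeasurable_const, by rw [tv_const]; exact ENNReal.zero_lt_top⟩

/-- The direct method: coercivity bounds the variations of a minimizing sequence, compactness gives
an almost everywhere limit, and lower semicontinuity is checked potential by potential. -/
theorem exists_isMinOn_energy {Ω : Set Plane} (hΩo : IsOpen Ω) (hΩ : Bornology.IsBounded Ω)
    (hne : Ω.Nonempty) {f : Gray → Plane → ℝ}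
    (hf : ContinuousOn (fun q : Gray × Plane => f q.1 q.2) (univ ×ˢ Ω)) {M : ℝ}
    (hM : ∀ γ, ∀ x ∈ Ω, |f γ x| ≤ M) {lam ν : ℝ} (hlam : 0 < lam) (hν : 0 < ν)
    {c : Gray → Gray → ℝ} (hc : LowerSemicontinuous (fun p : Gray × Gray => c p.1 p.2))
    (μ₀ : Measure Gray) [IsProbabilityMeasure μ₀] :
    ∃ u ∈ bvGray Ω, IsMinOn (energy Ω f lam ν c μ₀) (bvGray Ω) u := by
  by_cases htop : ∀ u ∈ bvGray Ω, energy Ω f lam ν c μ₀ u = ⊤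
  · exact ⟨_, const_mem_bvGray Ω 0, fun v hv => by
      rw [mem_ofPred_eq, htop v hv]; exact le_top⟩
  push Not at htop
  obtain ⟨w, hw, hwt⟩ := htop
  have hfin := isFiniteMeasure_restrict hΩ
  have hXΩ : ∀ᵐ x ∂volume.restrict Ω, id x ∈ Ω := ae_restrict_mem hΩo.measurableSet
  obtain ⟨m, hm⟩ := exists_lower_bound hc
  obtain ⟨v', I, hv', hle', -, hlim', hmin⟩ := exists_minimizing_seq (energy Ω f lam ν c μ₀) hw
  choose v hvm hv hvv using fun n => exists_measurable_of_mem (hv' n)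
  simp_rw [fun n => energy_congr (hvv n) f lam ν c μ₀] at hle' hlim'
  obtain ⟨r, hr⟩ : ∃ r : ℝ, energy Ω f lam ν c μ₀ w ≤ r := by
    rcases eq_or_ne (energy Ω f lam ν c μ₀ w) ⊥ with h | h
    · exact ⟨0, by rw [h]; exact bot_le⟩
    · exact ⟨_, (EReal.coe_toReal hwt h).ge⟩
  have hK : ∀ n, tv Ω (fun x => (v n x : ℝ)) ≤
      ENNReal.ofReal ((r + M * (volume.restrict Ω).real univ - ν * m) / lam) := fun n => by
    have := isProbabilityMeasure_hist hΩo hΩ hne (hv n).1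
    exact le_ofReal_of_add_mul_le hlam hν (abs_integral_data_le hM hXΩ (v n))
      (coe_le_transportCost hc hm _ μ₀) ((hle' n).trans hr)
  obtain ⟨u', hu'm, hu'01, σ, hσ, hconv⟩ := exists_subseq_ae_tendsto hΩo hΩ
    (fun n x => (v n x : ℝ)) (fun n => measurable_subtype_coe.comp (hvm n)) (fun n x => (v n x).2)
    ENNReal.ofReal_ne_top hK
  let u : Plane → Gray := fun x => ⟨u' x, hu'01 x⟩
  have hum : Measurable u := hu'm.subtype_mk
  have hconv' : ∀ᵐ x ∂volume.restrict Ω, Tendsto (fun n => v (σ n) x) atTop (𝓝 (u x)) := by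
    filter_upwards [hconv] with x hx
    exact tendsto_subtype_rng.2 hx
  have htv : tv Ω (fun x => (u x : ℝ)) ≤
      liminf (fun n => tv Ω fun x => (v (σ n) x : ℝ)) atTop :=
    tv_le_liminf_of_ae (C := 1)
      (fun n => (measurable_subtype_coe.comp (hvm _)).aestronglyMeasurable)
      (fun n => Eventually.of_forall fun x => by
        rw [Real.norm_of_nonneg (v (σ n) x).2.1]; exact (v (σ n) x).2.2) hconv
  have hu : u ∈ bvGray Ω := by
    refine ⟨hum.aemeasurable, htv.trans_lt ?_⟩
    refine lt_of_le_of_lt (liminf_le_of_frequently_le'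
      (Eventually.of_forall fun n => hK (σ n)).frequently) ENNReal.ofReal_lt_top
  refine ⟨u, hu, fun y hy => le_trans ?_ (hmin y hy)⟩
  -- Continuous potentials suffice for the supremum, and for each of them the histogram integral
  -- converges.
  rw [energy_eq_iSup hΩo hΩ hne f hlam hν hc μ₀ le_rfl (contDual_subset c) hu.1]
  refine iSup₂_le fun p hp => ?_
  have hval : ∀ w ∈ bvGray Ω, energyDual Ω f lam ν μ₀ w p =
      (((∫ x in Ω, f (w x) x) + ν * (∫ γ, p.1 γ ∂hist Ω w - ∫ γ, p.2 γ ∂μ₀) : ℝ) : EReal) +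
        lam * (tv Ω (fun x => (w x : ℝ)) : EReal) := fun w hw => by
    have := isProbabilityMeasure_hist hΩo hΩ hne hw.1
    rw [energyDual, dualValue_eq_coe (integrable_of_continuous hp.1)
      (integrable_of_continuous hp.2.1), EReal.coe_add, EReal.coe_mul, add_right_comm]
  rw [hval u hu]
  refine add_mul_le_of_tendsto hlam (r := fun n => (∫ x in Ω, f (v (σ n) x) x) +
    ν * (∫ γ, p.1 γ ∂hist Ω (v (σ n)) - ∫ γ, p.2 γ ∂μ₀)) ?_ htv
    (hlim'.comp hσ.tendsto_atTop) fun n => ?_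
  · exact (tendsto_integral_data hΩo hf hM measurable_id hXΩ (fun n => hvm (σ n)) hconv').add
      (((tendsto_integral_potential hp.1 _ (fun n => hvm (σ n)) hum hconv').sub_const _).const_mul ν)
  · rw [← hval _ (hv (σ n))]
    simp only [Function.comp]
    rw [energy_eq_iSup hΩo hΩ hne f hlam hν hc μ₀ le_rfl (contDual_subset c) (hv (σ n)).1]
    exact le_iSup₂_of_le p hp le_rfl

/-! ### Convergent selections from nested convex sets -/

/-- Elements of nearly minimal norm are chosen. For `m ≥ n` the midpoint of `y n` and `y m` lies in
`A n`, so its norm is at least `d n`, and the parallelogram law makes the sequence Cauchy because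
the minimal norms converge. The sets need not be closed, and the limit is not claimed to lie in
them. -/
lemma exists_tendsto_of_nested_convex {E : Type*} [NormedAddCommGroup E] [InnerProductSpace ℝ E]
    [CompleteSpace E] {A : ℕ → Set E} (hc : ∀ n, Convex ℝ (A n)) (hne : ∀ n, (A n).Nonempty)
    (ha : Antitone A) {R : ℝ} (hb : ∀ y ∈ A 0, ‖y‖ ≤ R) :
    ∃ (y : ℕ → E) (z : E), (∀ n, y n ∈ A n) ∧ Tendsto y atTop (𝓝 z) := by
  let d : ℕ → ℝ := fun n => sInf (norm '' A n)
  have hbb : ∀ n, BddBelow (norm '' A n) := fun n =>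
    ⟨0, by rintro _ ⟨y, -, rfl⟩; exact norm_nonneg y⟩
  have hd : ∀ n, ∀ y ∈ A n, d n ≤ ‖y‖ := fun n y hy => csInf_le (hbb n) (mem_image_of_mem _ hy)
  have hd0 : ∀ n, 0 ≤ d n := fun n => le_csInf ((hne n).image _) <| by
    rintro _ ⟨y, -, rfl⟩; exact norm_nonneg y
  have hmono : Monotone d := fun n m h =>
    csInf_le_csInf (hbb n) ((hne m).image _) (image_mono (ha h))
  have hbdd : BddAbove (range d) := ⟨R, by
    rintro _ ⟨n, rfl⟩
    obtain ⟨y, hy⟩ := hne n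
    exact (hd n y hy).trans (hb y (ha (Nat.zero_le n) hy))⟩
  have hlim : Tendsto d atTop (𝓝 (⨆ n, d n)) := tendsto_atTop_ciSup hmono hbdd
  have hex : ∀ n : ℕ, ∃ y ∈ A n, ‖y‖ < d n + 1 / ((n : ℝ) + 1) := fun n => by
    obtain ⟨_, ⟨y, hy, rfl⟩, h⟩ := exists_lt_of_csInf_lt ((hne n).image norm)
      (show sInf (norm '' A n) < d n + 1 / ((n : ℝ) + 1) from
        lt_add_of_pos_right _ Nat.one_div_pos_of_nat)
    exact ⟨y, hy, h⟩
  choose y hy hyd using hex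
  obtain ⟨D, hD⟩ : ∃ D, D = ⨆ n, d n := ⟨_, rfl⟩
  have hdD : ∀ n, d n ≤ D := fun n => hD ▸ le_ciSup hbdd n
  rw [← hD] at hlim
  have hε : Tendsto (fun n : ℕ => 1 / ((n : ℝ) + 1)) atTop (𝓝 0) :=
    tendsto_one_div_add_atTop_nhds_zero_nat
  have hcau : CauchySeq y := by
    refine cauchySeq_of_le_tendsto_0' (fun n => Real.sqrt (2 * ((d n + 1 / ((n : ℝ) + 1)) ^ 2 +
      (D + 1 / ((n : ℝ) + 1)) ^ 2) - 4 * d n ^ 2)) (fun n m hnm => ?_) ?_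
    · refine Real.le_sqrt_of_sq_le ?_
      have hp := parallelogram_law_with_norm ℝ (y n) (y m)
      have hmid : d n ≤ ‖(1 / 2 : ℝ) • y n + (1 / 2 : ℝ) • y m‖ :=
        hd n _ (hc n (hy n) (ha hnm (hy m)) (by norm_num) (by norm_num) (by norm_num))
      rw [← smul_add, norm_smul, Real.norm_of_nonneg (by norm_num)] at hmid
      have hm1 : ‖y m‖ ≤ D + 1 / ((n : ℝ) + 1) :=
        (hyd m).le.trans (add_le_add (hdD m) (Nat.one_div_le_one_div hnm))
      have e1 : ‖y n‖ ^ 2 ≤ (d n + 1 / ((n : ℝ) + 1)) ^ 2 :=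
        pow_le_pow_left₀ (norm_nonneg _) (hyd n).le 2
      have e2 : ‖y m‖ ^ 2 ≤ (D + 1 / ((n : ℝ) + 1)) ^ 2 := pow_le_pow_left₀ (norm_nonneg _) hm1 2
      have e3 : (2 * d n) ^ 2 ≤ ‖y n + y m‖ ^ 2 :=
        pow_le_pow_left₀ (by linarith [hd0 n]) (by linarith) 2
      rw [dist_eq_norm]
      nlinarith
    · have : Tendsto (fun n : ℕ => 2 * ((d n + 1 / ((n : ℝ) + 1)) ^ 2 +
          (D + 1 / ((n : ℝ) + 1)) ^ 2) - 4 * d n ^ 2) atTop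
          (𝓝 (2 * ((D + 0) ^ 2 + (D + 0) ^ 2) - 4 * D ^ 2)) :=
        ((((hlim.add hε).pow 2).add ((hε.const_add D).pow 2)).const_mul 2).sub
          ((hlim.pow 2).const_mul 4)
      have h2 := (Real.continuous_sqrt.tendsto _).comp this
      rw [show 2 * ((D + 0) ^ 2 + (D + 0) ^ 2) - 4 * D ^ 2 = 0 by ring, Real.sqrt_zero] at h2
      exact h2
  obtain ⟨z, hz⟩ := cauchySeq_tendsto_of_complete hcau
  exact ⟨y, z, hy, hz⟩

/-! ### Limits of lifted functions -/

lemma layerMeasure_eq_restrict (Ω : Set Plane) :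
    layerMeasure Ω = volume.restrict (Ω ×ˢ Icc (0 : ℝ) 1) := by
  rw [layerMeasure, Measure.prod_restrict, ← Measure.volume_eq_prod]

lemma layerMeasure_le (Ω : Set Plane) : layerMeasure Ω ≤ volume.restrict (cyl Ω) := by
  rw [layerMeasure_eq_restrict]
  exact Measure.restrict_mono (prod_mono le_rfl (subset_univ _)) le_rfl

lemma ae_cyl_of_ae_layerMeasure {Ω : Set Plane} (hΩo : IsOpen Ω) {P : Plane × ℝ → Prop}
    (h : ∀ᵐ p ∂layerMeasure Ω, P p) :
    ∀ᵐ p ∂volume.restrict (cyl Ω), p.2 ∈ Icc (0 : ℝ) 1 → P p := by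
  rw [layerMeasure_eq_restrict, ae_restrict_iff' (hΩo.measurableSet.prod measurableSet_Icc)] at h
  rw [ae_restrict_iff' (isOpen_cyl hΩo).measurableSet]
  filter_upwards [h] with p hp h1 h2
  exact hp ⟨h1.1, h2⟩

lemma vertNonincr_of_tendsto {Ω : Set Plane} {φ : ℕ → Plane × ℝ → ℝ} {φ₀ : Plane × ℝ → ℝ}
    (h : ∀ n, IsLift (φ n)) (hv : ∀ n, VertNonincr Ω (φ n))
    (ht : ∀ᵐ p ∂volume.restrict (cyl Ω), Tendsto (fun n => φ n p) atTop (𝓝 (φ₀ p))) :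
    VertNonincr Ω φ₀ := by
  intro ζ h1 h2 h3 h4
  have hcont : Continuous fun p => fderiv ℝ ζ p (0, 1) :=
    (h1.continuous_fderiv one_ne_zero).clm_apply continuous_const
  have hcs : HasCompactSupport fun p => fderiv ℝ ζ p (0, 1) :=
    (h2.fderiv ℝ).comp_left (g := fun L : Plane × ℝ →L[ℝ] ℝ => L (0, 1)) rfl
  have hi : Integrable fun p => fderiv ℝ ζ p (0, 1) := hcont.integrable_of_hasCompactSupport hcs
  refine ge_of_tendsto' (tendsto_integral_of_dominated_convergence
    (fun p => ‖fderiv ℝ ζ p (0, 1)‖)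
    (fun n => (h n).measurable.aestronglyMeasurable.mul hcont.aestronglyMeasurable)
    hi.norm.restrict (fun n => Eventually.of_forall fun p => ?_) ?_) fun n => hv n ζ h1 h2 h3 h4
  · rw [Pi.mul_apply, norm_mul]
    exact mul_le_of_le_one_left (norm_nonneg _) ((h n).norm_le p)
  · filter_upwards [ht] with p hp
    exact hp.mul_const _

lemma coe_quantile {φ : Plane × ℝ → ℝ} (hφ : Measurable φ) (q : Plane × ℝ) :
    (quantile φ q : ℝ) = ∫ γ in Icc (0 : ℝ) 1, if q.2 < φ (q.1, γ) then (1 : ℝ) else 0 := by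
  have hm : MeasurableSet {γ : ℝ | q.2 < φ (q.1, γ)} :=
    measurableSet_lt measurable_const (hφ.comp measurable_prodMk_left)
  change volume.real (Icc (0 : ℝ) 1 ∩ {γ : ℝ | q.2 < φ (q.1, γ)}) = _
  have : (fun γ => if q.2 < φ (q.1, γ) then (1 : ℝ) else 0) =
      {γ : ℝ | q.2 < φ (q.1, γ)}.indicator fun _ => 1 := by
    ext γ
    simp [indicator_apply]
  rw [this, integral_indicator_const _ hm, smul_eq_mul, mul_one, measureReal_restrict_apply hm,
    inter_comm]

/-- Off the level set `{φ₀(x, ·) = t}` the indicators of the superlevel sets converge. For fixed `x`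
this set is null for almost every `t` by Fubini, and the quantile is the integral of the indicator.
-/
lemma ae_tendsto_quantile {Ω : Set Plane} {φ : ℕ → Plane × ℝ → ℝ} {φ₀ : Plane × ℝ → ℝ}
    (h : ∀ n, IsLift (φ n)) (h₀ : IsLift φ₀)
    (ht : ∀ᵐ p ∂volume.restrict (cyl Ω), Tendsto (fun n => φ n p) atTop (𝓝 (φ₀ p))) :
    ∀ᵐ q ∂layerMeasure Ω, Tendsto (fun n => quantile (φ n) q) atTop (𝓝 (quantile φ₀ q)) := by
  have hms : MeasurableSet {q | Tendsto (fun n => dist (quantile (φ n) q) (quantile φ₀ q)) atTop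
      (𝓝 0)} := measurableSet_tendsto _ fun n =>
    (measurable_quantile (h n).measurable).dist (measurable_quantile h₀.measurable)
  suffices H : ∀ᵐ q ∂layerMeasure Ω, Tendsto (fun n => dist (quantile (φ n) q) (quantile φ₀ q))
      atTop (𝓝 0) from H.mono fun q hq => tendsto_iff_dist_tendsto_zero.2 hq
  refine (Measure.ae_prod_iff_ae_ae hms).2 ?_
  rw [restrict_cyl] at ht
  filter_upwards [Measure.ae_ae_of_ae_prod ht] with x hx
  have hne : ∀ᵐ t : ℝ, ∀ᵐ γ : ℝ, φ₀ (x, γ) ≠ t := by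
    rw [← Measure.ae_ae_comm]
    · refine Eventually.of_forall fun γ => ?_
      rw [ae_iff]
      simp
    · exact (measurableSet_eq_fun (h₀.measurable.comp (measurable_const.prodMk measurable_fst))
        measurable_snd).compl
  filter_upwards [ae_restrict_of_ae hne] with t ht
  rw [← tendsto_iff_dist_tendsto_zero, tendsto_subtype_rng]
  simp_rw [coe_quantile h₀.measurable, fun n => coe_quantile (h n).measurable]
  refine tendsto_integral_of_dominated_convergence (fun _ => 1) (fun n => ?_)
    (integrable_const 1) (fun n => Eventually.of_forall fun γ => ?_) ?_
  · exact (Measurable.ite (measurableSet_lt measurable_const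
      ((h n).measurable.comp measurable_prodMk_left)) measurable_const
      measurable_const).aestronglyMeasurable
  · split_ifs <;> simp
  · filter_upwards [ae_restrict_of_ae hx, ae_restrict_of_ae ht] with γ h1 h2
    refine tendsto_const_nhds.congr' ?_
    rcases lt_or_gt_of_ne h2 with h3 | h3
    · filter_upwards [h1.eventually (gt_mem_nhds h3)] with n hn
      rw [if_neg h3.not_gt, if_neg hn.not_gt]
    · filter_upwards [h1.eventually (lt_mem_nhds h3)] with n hn
      rw [if_pos h3, if_pos hn]

lemma sliceTV_le_liminf {Ω : Set Plane} {φ : ℕ → Plane × ℝ → ℝ} {φ₀ : Plane × ℝ → ℝ}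
    (h : ∀ n, IsLift (φ n))
    (ht : ∀ᵐ p ∂volume.restrict (cyl Ω), Tendsto (fun n => φ n p) atTop (𝓝 (φ₀ p))) :
    sliceTV Ω φ₀ ≤ liminf (fun n => sliceTV Ω (φ n)) atTop := by
  refine le_trans ?_ (lintegral_liminf_le fun n => measurable_tv Ω (h n).measurable (h n).norm_le)
  refine lintegral_mono_ae (ae_restrict_of_ae ?_)
  filter_upwards [ae_slice_of_ae_cyl ht] with γ hγ
  exact tv_le_liminf_of_ae
    (fun n => ((h n).measurable.comp measurable_prodMk_right).aestronglyMeasurable)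
    (fun n => Eventually.of_forall fun x => (h n).norm_le _) hγ

/-! ### The relaxed problem has a minimizer -/

lemma liftEnergy_eq_of_layers {Ω : Set Plane} (hΩo : IsOpen Ω) (hΩ : Bornology.IsBounded Ω)
    (hne : Ω.Nonempty) {f : Gray → Plane → ℝ}
    (hf : ContinuousOn (fun q : Gray × Plane => f q.1 q.2) (univ ×ˢ Ω)) {M : ℝ}
    (hM : ∀ γ, ∀ x ∈ Ω, |f γ x| ≤ M) (lam ν : ℝ) {c : Gray → Gray → ℝ}
    (μ₀ : Measure Gray) [IsProbabilityMeasure μ₀] {φ : Plane × ℝ → ℝ} {U : Plane × ℝ → Gray}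
    (hU : Measurable U)
    (hm : IsNegVertDeriv Ω φ ((layerMeasure Ω).map fun q => (q.1, (U q : ℝ))))
    {p : (Gray → ℝ) × (Gray → ℝ)} (hp : p ∈ contDual c) :
    liftEnergy Ω f lam ν μ₀ φ p = (((∫ q, f (U q) q.1 ∂layerMeasure Ω) +
      ν * (∫ γ, p.1 γ ∂((volume Ω)⁻¹ • (layerMeasure Ω).map U) - ∫ γ, p.2 γ ∂μ₀) : ℝ) : EReal) +
        lam * (sliceTV Ω φ : EReal) := by
  have := isProbabilityMeasure_layers hΩo hΩ hne hU
  have := isFiniteMeasure_layerMeasure hΩ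
  rw [liftEnergy, liftHist_eq hΩo hU hm, grayDeriv_eq hΩo hU hm,
    integral_data_map hΩo hf hM measurable_fst (ae_fst_mem_layerMeasure hΩo) hU,
    dualValue_eq_coe (integrable_of_continuous hp.1)
      (integrable_of_continuous hp.2.1), EReal.coe_add, EReal.coe_mul, add_right_comm]
  rfl

lemma relaxedEnergy_combo_le {Ω : Set Plane} (hΩo : IsOpen Ω) (hΩ : Bornology.IsBounded Ω)
    {f : Gray → Plane → ℝ}
    (hf : ContinuousOn (fun q : Gray × Plane => f q.1 q.2) (univ ×ˢ Ω)) {M : ℝ}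
    (hM : ∀ γ, ∀ x ∈ Ω, |f γ x| ≤ M) {lam ν : ℝ} (hlam : 0 ≤ lam) (hν : 0 ≤ ν)
    (c : Gray → Gray → ℝ) (μ₀ : Measure Gray) {φ φ' : Plane × ℝ → ℝ} (hφ : φ ∈ liftSet Ω)
    (hφ' : φ' ∈ liftSet Ω) {a b : ℝ} (ha : 0 ≤ a) (hb : 0 ≤ b) (hab : a + b = 1) :
    relaxedEnergy Ω f lam ν c μ₀ (a • φ + b • φ') ≤
      a * relaxedEnergy Ω f lam ν c μ₀ φ + b * relaxedEnergy Ω f lam ν c μ₀ φ' := by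
  refine iSup₂_le fun p hp => ((econvexOn_liftEnergy hΩo hΩ hf hM hlam hν μ₀ p).2 φ hφ φ' hφ' a b
    ha hb hab).trans (add_le_add ?_ ?_)
  · exact mul_le_mul_of_nonneg_left (le_iSup₂_of_le p hp le_rfl) (EReal.coe_nonneg.2 ha)
  · exact mul_le_mul_of_nonneg_left (le_iSup₂_of_le p hp le_rfl) (EReal.coe_nonneg.2 hb)

lemma mem_liftSet_of_sliceTV {Ω : Set Plane} (hΩo : IsOpen Ω) (hΩ : Bornology.IsBounded Ω)
    {φ : Plane × ℝ → ℝ} (h : IsLift φ) {U : Plane × ℝ → Gray} (hU : Measurable U)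
    (hl : IsLayered Ω φ U) (hs : sliceTV Ω φ < ∞) : φ ∈ liftSet Ω := by
  have hm := isNegVertDeriv_of_isLayered hΩo hΩ h hU hl
  have := hm.1
  exact mem_liftSet_of_congr (EventuallyEq.refl _ _) h
    ((tv₃_le h hm).trans_lt (ENNReal.add_lt_top.2 ⟨hs, measure_lt_top _ _⟩)) hm

lemma subgraph_mem_liftSet {Ω : Set Plane} (hΩo : IsOpen Ω) (hΩ : Bornology.IsBounded Ω)
    {u : Plane → Gray} (hum : Measurable u) (hu : u ∈ bvGray Ω) : subgraph u ∈ liftSet Ω :=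
  mem_liftSet_of_sliceTV hΩo hΩ (isLift_subgraph hum) (hum.comp measurable_fst)
    (isLayered_subgraph Ω u) ((sliceTV_subgraph_le hΩo hΩ hum).trans_lt hu.2)

/-- All layers of a subgraph are `u`, so data term and histogram coincide, while the sliced
variation does not exceed the variation of `u`. -/
theorem relaxedEnergy_subgraph_le {Ω : Set Plane} (hΩo : IsOpen Ω) (hΩ : Bornology.IsBounded Ω)
    (hne : Ω.Nonempty) {f : Gray → Plane → ℝ}
    (hf : ContinuousOn (fun q : Gray × Plane => f q.1 q.2) (univ ×ˢ Ω)) {M : ℝ}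
    (hM : ∀ γ, ∀ x ∈ Ω, |f γ x| ≤ M) {lam ν : ℝ} (hlam : 0 < lam) (hν : 0 < ν)
    {c : Gray → Gray → ℝ} (hc : LowerSemicontinuous (fun p : Gray × Gray => c p.1 p.2))
    (μ₀ : Measure Gray) [IsProbabilityMeasure μ₀] {u : Plane → Gray} (hum : Measurable u)
    (hu : u ∈ bvGray Ω) :
    relaxedEnergy Ω f lam ν c μ₀ (subgraph u) ≤ energy Ω f lam ν c μ₀ u := by
  have := isFiniteMeasure_layerMeasure hΩ
  have hfin := isFiniteMeasure_restrict hΩ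
  have hU : Measurable fun q : Plane × ℝ => u q.1 := hum.comp measurable_fst
  have hm := isNegVertDeriv_of_isLayered hΩo hΩ (isLift_subgraph hum) hU (isLayered_subgraph Ω u)
  rw [relaxedEnergy_eq hΩo hΩ hne f hlam hν hc μ₀ (subgraph_mem_liftSet hΩo hΩ hum hu), energy,
    liftHist_eq hΩo hU hm, grayDeriv_eq hΩo hU hm,
    integral_data_map hΩo hf hM measurable_fst (ae_fst_mem_layerMeasure hΩo) hU]
  have e1 : (layerMeasure Ω).map (fun q : Plane × ℝ => u q.1) = (volume.restrict Ω).map u := by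
    rw [← map_fst_layerMeasure, Measure.map_map hum measurable_fst]
    rfl
  have e2 : ∫ q, f (u q.1) q.1 ∂layerMeasure Ω = ∫ x in Ω, f (u x) x := by
    have hi := integrable_data_comp (κ := volume.restrict Ω) hΩo hf hM measurable_id
      (ae_restrict_mem hΩo.measurableSet) hum
    rw [← map_fst_layerMeasure] at hi ⊢
    exact (integral_map measurable_fst.aemeasurable hi.aestronglyMeasurable).symm
  rw [e1, e2, hist]
  gcongr
  exact EReal.coe_ennreal_le_coe_ennreal_iff.2 (sliceTV_subgraph_le hΩo hΩ hum)

/-- The direct method with convexity in place of compactness. Strong `L²` convergence of a suitable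
minimizing sequence gives almost everywhere convergence, first of the functions, then of their
quantiles. -/
theorem exists_isMinOn_relaxedEnergy {Ω : Set Plane} (hΩo : IsOpen Ω) (hΩ : Bornology.IsBounded Ω)
    (hne : Ω.Nonempty) {f : Gray → Plane → ℝ}
    (hf : ContinuousOn (fun q : Gray × Plane => f q.1 q.2) (univ ×ˢ Ω)) {M : ℝ}
    (hM : ∀ γ, ∀ x ∈ Ω, |f γ x| ≤ M) {lam ν : ℝ} (hlam : 0 < lam) (hν : 0 < ν)
    {c : Gray → Gray → ℝ} (hc : LowerSemicontinuous (fun p : Gray × Gray => c p.1 p.2))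
    (μ₀ : Measure Gray) [IsProbabilityMeasure μ₀] :
    ∃ φ ∈ liftSet Ω, IsMinOn (relaxedEnergy Ω f lam ν c μ₀) (liftSet Ω) φ := by
  by_cases htop : ∀ φ ∈ liftSet Ω, relaxedEnergy Ω f lam ν c μ₀ φ = ⊤
  · exact ⟨_, subgraph_mem_liftSet hΩo hΩ measurable_const (const_mem_bvGray Ω 0), fun v hv => by
      rw [mem_ofPred_eq, htop v hv]; exact le_top⟩
  push Not at htop
  obtain ⟨w, hw, hwt⟩ := htop
  have hfin := isFiniteMeasure_layerMeasure hΩ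
  have hXΩ := ae_fst_mem_layerMeasure hΩo
  obtain ⟨m, hm⟩ := exists_lower_bound hc
  obtain ⟨v, I, hv, hle, hanti, hlim, hmin⟩ :=
    exists_minimizing_seq (relaxedEnergy Ω f lam ν c μ₀) hw
  obtain ⟨r, hr⟩ : ∃ r : ℝ, relaxedEnergy Ω f lam ν c μ₀ w ≤ r := by
    rcases eq_or_ne (relaxedEnergy Ω f lam ν c μ₀ w) ⊥ with h | h
    · exact ⟨0, by rw [h]; exact bot_le⟩
    · exact ⟨_, (EReal.coe_toReal hwt h).ge⟩
  -- The sublevel sets at the energies of the minimizing sequence, viewed in `L²(Ω × [0,1])`. They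
  -- are convex because a supremum of convex energies is convex.
  let A : ℕ → Set (Lp ℝ 2 (layerMeasure Ω)) := fun n =>
    {y | ∃ φ ∈ liftSet Ω, relaxedEnergy Ω f lam ν c μ₀ φ ≤ relaxedEnergy Ω f lam ν c μ₀ (v n) ∧
      φ =ᵐ[layerMeasure Ω] y}
  have hAc : ∀ n, Convex ℝ (A n) := by
    rintro n y ⟨φ, h1, h2, h3⟩ y' ⟨φ', h1', h2', h3'⟩ a b ha hb hab
    refine ⟨a • φ + b • φ', convex_liftSet Ω h1 h1' ha hb hab,
      (relaxedEnergy_combo_le hΩo hΩ hf hM hlam.le hν.le c μ₀ h1 h1' ha hb hab).trans ?_, ?_⟩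
    · rw [← EReal_combo_self ha hb hab (relaxedEnergy Ω f lam ν c μ₀ (v n))]
      exact add_le_add (mul_le_mul_of_nonneg_left h2 (EReal.coe_nonneg.2 ha))
        (mul_le_mul_of_nonneg_left h2' (EReal.coe_nonneg.2 hb))
    · filter_upwards [h3, h3', Lp.coeFn_add (a • y) (b • y'), Lp.coeFn_smul a y,
        Lp.coeFn_smul b y'] with p e1 e2 e3 e4 e5
      rw [e3, Pi.add_apply, Pi.add_apply, e4, e5, Pi.smul_apply, Pi.smul_apply, Pi.smul_apply,
        Pi.smul_apply, e1, e2]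
  have hAne : ∀ n, (A n).Nonempty := fun n => by
    obtain ⟨φ', hl, he⟩ := exists_isLift_of_mem (hv n)
    have hmem : MemLp φ' 2 (layerMeasure Ω) := MemLp.of_bound
      hl.measurable.aestronglyMeasurable 1 (Eventually.of_forall hl.norm_le)
    refine ⟨hmem.toLp φ', v n, hv n, le_rfl, ?_⟩
    filter_upwards [hmem.coeFn_toLp, ae_mono (layerMeasure_le Ω) he] with p e1 e2
    rw [e1, e2]
  have hAa : Antitone A := fun n k hnk y => by
    rintro ⟨φ, h1, h2, h3⟩
    exact ⟨φ, h1, h2.trans (hanti hnk), h3⟩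
  obtain ⟨y, z, hy, hyz⟩ := exists_tendsto_of_nested_convex hAc hAne hAa
    (R := measureUnivNNReal (layerMeasure Ω) ^ (2 : ℝ≥0∞).toReal⁻¹ * 1) <| by
      rintro y ⟨φ, h1, -, h3⟩
      refine Lp.norm_le_of_ae_bound zero_le_one ?_
      filter_upwards [h3, ae_mono (layerMeasure_le Ω) h1.2.2.1] with p e1 e2
      rw [← e1, Real.norm_of_nonneg e2.1]
      exact e2.2
  choose φ hφ hφle hφy using hy
  choose ρ hρ hφρ hρv hρl hρm using fun n => exists_layers hΩo hΩ (hφ n)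
  obtain ⟨σ, hσ, hae⟩ := (tendstoInMeasure_of_tendsto_Lp hyz).exists_seq_tendsto_ae
  -- The `L²` limit covers only heights in `[0,1]`. At other heights the normalised representatives
  -- are constant in `n`.
  have hex : ∀ᵐ p ∂volume.restrict (cyl Ω), ∃ l : ℝ, Tendsto (fun n => ρ (σ n) p) atTop (𝓝 l) := by
    have h1 : ∀ᵐ p ∂layerMeasure Ω, Tendsto (fun n => ρ (σ n) p) atTop (𝓝 (z p)) := by
      filter_upwards [hae, ae_all_iff.2 hφy, ae_mono (layerMeasure_le Ω)
        (ae_all_iff.2 hφρ)] with p e1 e2 e3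
      refine e1.congr fun n => ?_
      rw [← e2, e3]
    filter_upwards [ae_cyl_of_ae_layerMeasure hΩo h1] with p hp
    by_cases h0 : p.2 ≤ 0
    · exact ⟨1, by simp_rw [fun n => (hρ n).eq_one p h0]; exact tendsto_const_nhds⟩
    by_cases h2 : 1 ≤ p.2
    · exact ⟨0, by simp_rw [fun n => (hρ n).eq_zero p h2]; exact tendsto_const_nhds⟩
    · exact ⟨_, hp ⟨(not_le.1 h0).le, (not_le.1 h2).le⟩⟩
  obtain ⟨g, hgm, hg⟩ := measurable_limit_of_tendsto_metrizable_ae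
    (fun n => (hρ (σ n)).measurable.aemeasurable) hex
  obtain ⟨φ₀, hφ₀, hgφ⟩ := exists_isLift (Ω := Ω) hgm.aemeasurable
    (by filter_upwards [hg] with p hp
        exact isClosed_Icc.mem_of_tendsto hp (Eventually.of_forall fun n => (hρ (σ n)).mem_Icc p))
    (by filter_upwards [hg] with p hp h0
        simp_rw [fun n => (hρ n).eq_one p h0] at hp
        exact tendsto_nhds_unique hp tendsto_const_nhds)
    (by filter_upwards [hg] with p hp h0
        simp_rw [fun n => (hρ n).eq_zero p h0] at hp
        exact tendsto_nhds_unique hp tendsto_const_nhds)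
  have hconv : ∀ᵐ p ∂volume.restrict (cyl Ω), Tendsto (fun n => ρ (σ n) p) atTop (𝓝 (φ₀ p)) := by
    filter_upwards [hg, hgφ] with p h1 h2
    rwa [← h2]
  have hvn := vertNonincr_of_tendsto (fun n => hρ (σ n)) (fun n => hρv (σ n)) hconv
  have hq := ae_tendsto_quantile (fun n => hρ (σ n)) hφ₀ hconv
  have hslice := sliceTV_le_liminf (fun n => hρ (σ n)) hconv
  have hqm := measurable_quantile hφ₀.measurable
  have hlay := isLayered_quantile hΩo hφ₀ hvn
  have hK : ∀ n, sliceTV Ω (ρ n) ≤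
      ENNReal.ofReal ((r + M * (layerMeasure Ω).real univ - ν * m) / lam) := fun n => by
    have := isProbabilityMeasure_liftHist hΩo hΩ hne (hφ n)
    have h1 := ((hφle n).trans (hle n)).trans hr
    rw [relaxedEnergy_eq hΩo hΩ hne f hlam hν hc μ₀ (hφ n),
      grayDeriv_eq hΩo (measurable_quantile (hρ n).measurable) (hρm n),
      integral_data_map hΩo hf hM measurable_fst hXΩ (measurable_quantile (hρ n).measurable),
      sliceTV_congr (hφρ n)] at h1
    exact le_ofReal_of_add_mul_le hlam hν (abs_integral_data_le hM hXΩ _)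
      (coe_le_transportCost hc hm _ μ₀) h1
  have hmem : φ₀ ∈ liftSet Ω := by
    refine mem_liftSet_of_sliceTV hΩo hΩ hφ₀ hqm hlay (hslice.trans_lt ?_)
    exact lt_of_le_of_lt (liminf_le_of_frequently_le'
      (Eventually.of_forall fun n => hK (σ n)).frequently) ENNReal.ofReal_lt_top
  refine ⟨φ₀, hmem, fun y hy => le_trans ?_ (hmin y hy)⟩
  -- For a continuous potential, data and histogram terms are integrals along the quantiles and
  -- converge with them. The sliced variation is handled by Fatou.
  rw [relaxedEnergy_eq_iSup hΩo hΩ hne f hlam hν hc μ₀ hmem]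
  refine iSup₂_le fun p hp => ?_
  rw [liftEnergy_eq_of_layers hΩo hΩ hne hf hM lam ν μ₀ hqm
    (isNegVertDeriv_of_isLayered hΩo hΩ hφ₀ hqm hlay) hp]
  refine add_mul_le_of_tendsto hlam (r := fun n =>
    (∫ q, f (quantile (ρ (σ n)) q) q.1 ∂layerMeasure Ω) +
      ν * (∫ γ, p.1 γ ∂((volume Ω)⁻¹ • (layerMeasure Ω).map (quantile (ρ (σ n)))) -
        ∫ γ, p.2 γ ∂μ₀)) ?_ hslice (hlim.comp hσ.tendsto_atTop) fun n => ?_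
  · exact (tendsto_integral_data hΩo hf hM measurable_fst hXΩ
      (fun n => measurable_quantile (hρ (σ n)).measurable) hq).add
      (((tendsto_integral_potential hp.1 _ (fun n => measurable_quantile (hρ (σ n)).measurable)
        hqm hq).sub_const _).const_mul ν)
  · rw [← sliceTV_congr (hφρ (σ n)), ← liftEnergy_eq_of_layers hΩo hΩ hne hf hM lam ν μ₀
      (measurable_quantile (hρ (σ n)).measurable) (hρm (σ n)) hp]
    exact (le_iSup₂_of_le p (contDual_subset c hp) le_rfl).trans (hφle (σ n))

/-! ### The perimeter of a disc -/

lemma deriv_smoothTransition_eq_zero {s : ℝ} (hs : s ∉ Icc (0 : ℝ) 1) :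
    deriv Real.smoothTransition s = 0 := by
  rcases lt_or_ge s 0 with h | h
  · have : Real.smoothTransition =ᶠ[𝓝 s] fun _ => 0 := by
      filter_upwards [gt_mem_nhds h] with y hy
      exact Real.smoothTransition.zero_of_nonpos hy.le
    rw [this.deriv_eq, deriv_const]
  · have h1 : 1 < s := not_le.1 fun h1 => hs ⟨h, h1⟩
    have : Real.smoothTransition =ᶠ[𝓝 s] fun _ => 1 := by
      filter_upwards [lt_mem_nhds h1] with y hy
      exact Real.smoothTransition.one_of_one_le hy.le
    rw [this.deriv_eq, deriv_const]

lemma exists_deriv_smoothTransition_le : ∃ C : ℝ, 0 ≤ C ∧ ∀ s, |deriv Real.smoothTransition s| ≤ C := by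
  obtain ⟨C, hC⟩ := isCompact_Icc.exists_bound_of_continuousOn (s := Icc (0 : ℝ) 1)
    continuous_deriv_smoothTransition.continuousOn
  have h0 : 0 ≤ C := (norm_nonneg _).trans (hC 0 ⟨le_rfl, zero_le_one⟩)
  refine ⟨C, h0, fun s => ?_⟩
  by_cases hs : s ∈ Icc (0 : ℝ) 1
  · exact hC s hs
  · rw [deriv_smoothTransition_eq_zero hs, abs_zero]
    exact h0

/-- A smooth approximation of the indicator function of a closed disc. -/
def discStep (z : Plane) (k r : ℝ) (x : Plane) : ℝ :=
  Real.smoothTransition (1 + k * (r ^ 2 - ‖x - z‖ ^ 2))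

lemma hasFDerivAt_discStep (z : Plane) (k r : ℝ) (x : Plane) :
    HasFDerivAt (discStep z k r) ((deriv Real.smoothTransition (1 + k * (r ^ 2 - ‖x - z‖ ^ 2)) *
      -(2 * k)) • (innerSL ℝ (x - z))) x := by
  have h1 : HasFDerivAt (fun x : Plane => ‖x - z‖ ^ 2) (2 • (innerSL ℝ (x - z))) x := by
    have := ((hasFDerivAt_id x).sub_const z).norm_sq
    simpa using this
  have h2 : HasFDerivAt (fun x : Plane => 1 + k * (r ^ 2 - ‖x - z‖ ^ 2))
      (k • (-(2 • (innerSL ℝ (x - z))) : Plane →L[ℝ] ℝ)) x := ((h1.const_sub (r ^ 2)).const_mul k).const_add 1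
  have h3 := (hasDerivAt_smoothTransition (1 + k * (r ^ 2 - ‖x - z‖ ^ 2))).comp_hasFDerivAt x h2
  refine h3.congr_fderiv ?_
  ext y
  simp
  ring

lemma contDiff_discStep (z : Plane) (k r : ℝ) : ContDiff ℝ 1 (discStep z k r) := by
  refine contDiff_smoothTransition_one.comp ?_
  have : ContDiff ℝ 1 fun x : Plane => ‖x - z‖ ^ 2 := (contDiff_id.sub contDiff_const).norm_sq ℝ
  exact contDiff_const.add (contDiff_const.mul (contDiff_const.sub this))

/-- With `q = ‖x - z‖ / r`, the argument of the transition is `1 + k - k q²`, which lies in `[0,1]`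
exactly for `1 ≤ q² ≤ 1 + 1/k`. Outside this annulus the derivative vanishes. The condition `k ≥ 1`
gives `q ≤ 2` inside, hence the factor `4`. -/
lemma norm_fderiv_discStep_le {C : ℝ} (hC0 : 0 ≤ C)
    (hC : ∀ s, |deriv Real.smoothTransition s| ≤ C) (z : Plane) {k r : ℝ} (hr : 0 < r) (hk : 1 ≤ k)
    (x : Plane) :
    ‖fderiv ℝ (discStep z (k / r ^ 2) r) x‖ ≤
      (Metric.closedBall z (r * Real.sqrt (1 + 1 / k)) \ Metric.ball z r).indicator
        (fun _ => 4 * C * k / r) x := by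
  have hk0 : 0 < k := by linarith
  rw [(hasFDerivAt_discStep z (k / r ^ 2) r x).fderiv, norm_smul, innerSL_apply_norm]
  by_cases hx : 1 + k / r ^ 2 * (r ^ 2 - ‖x - z‖ ^ 2) ∈ Icc (0 : ℝ) 1
  · have e : 1 + k / r ^ 2 * (r ^ 2 - ‖x - z‖ ^ 2) = 1 + k - k * (‖x - z‖ / r) ^ 2 := by
      field_simp
      ring
    have h0 : 0 ≤ ‖x - z‖ / r := by positivity
    obtain ⟨hx1, hx2⟩ := hx
    rw [e] at hx1 hx2
    have h1 : 1 ≤ (‖x - z‖ / r) ^ 2 := by nlinarith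
    have h2 : (‖x - z‖ / r) ^ 2 ≤ 1 + 1 / k := by
      rw [← mul_le_mul_iff_right₀ hk0]
      have : k * (1 + 1 / k) = k + 1 := by field_simp
      linarith
    have h3 : 1 ≤ ‖x - z‖ / r := by nlinarith
    have h4 : ‖x - z‖ / r ≤ Real.sqrt (1 + 1 / k) := Real.le_sqrt_of_sq_le h2
    have h5 : ‖x - z‖ / r ≤ 2 := by
      have : 1 / k ≤ 1 := by rw [div_le_one hk0]; exact hk
      nlinarith
    have hmem : x ∈ Metric.closedBall z (r * Real.sqrt (1 + 1 / k)) \ Metric.ball z r := by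
      refine ⟨?_, ?_⟩
      · rw [Metric.mem_closedBall, dist_eq_norm, mul_comm, ← div_le_iff₀ hr]
        exact h4
      · rw [Metric.mem_ball, dist_eq_norm, not_lt]
        rwa [one_le_div hr] at h3
    rw [indicator_of_mem hmem, norm_mul, Real.norm_eq_abs, Real.norm_eq_abs, abs_neg,
      abs_of_nonneg (show 0 ≤ 2 * (k / r ^ 2) by positivity)]
    rw [div_le_iff₀ hr] at h5
    calc |deriv Real.smoothTransition (1 + k / r ^ 2 * (r ^ 2 - ‖x - z‖ ^ 2))| *
          (2 * (k / r ^ 2)) * ‖x - z‖ ≤ C * (2 * (k / r ^ 2)) * (2 * r) := by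
          gcongr
          exact hC _
      _ = 4 * C * k / r := by field_simp; ring
  · rw [deriv_smoothTransition_eq_zero hx]
    simp only [zero_mul, norm_zero]
    exact indicator_nonneg (fun _ _ => by positivity) _

lemma volume_annulus_le (z : Plane) {k r : ℝ} (hr : 0 < r) (hk : 1 ≤ k) :
    volume.real (Metric.closedBall z (r * Real.sqrt (1 + 1 / k)) \ Metric.ball z r) =
      r ^ 2 / k * Real.pi := by
  have hk0 : 0 < k := by linarith
  have hs : 1 ≤ Real.sqrt (1 + 1 / k) := by
    rw [Real.one_le_sqrt]
    have : 0 ≤ 1 / k := by positivity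
    linarith
  have hsub : Metric.ball z r ⊆ Metric.closedBall z (r * Real.sqrt (1 + 1 / k)) :=
    Metric.ball_subset_closedBall.trans (Metric.closedBall_subset_closedBall (by nlinarith))
  rw [measureReal_sdiff hsub measurableSet_ball measure_closedBall_lt_top.ne, measureReal_def, measureReal_def,
    EuclideanSpace.volume_ball_fin_two, EuclideanSpace.volume_closedBall_fin_two]
  simp only [ENNReal.toReal_mul, ENNReal.toReal_pow]
  rw [ENNReal.toReal_ofReal hr.le, ENNReal.toReal_ofReal (by positivity),
    ENNReal.toReal_ofReal Real.pi_pos.le, mul_pow, Real.sq_sqrt (by positivity)]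
  ring

/-- The gradient bound `4Ck/r` times the annulus area `π r²/k`: the steepness `k` cancels, so the
bound survives the limit. -/
lemma tv_discStep_le {C : ℝ} (hC0 : 0 ≤ C) (hC : ∀ s, |deriv Real.smoothTransition s| ≤ C)
    (Ω : Set Plane) (z : Plane) {k r a : ℝ} (hr : 0 < r) (hk : 1 ≤ k) (ha : |a| ≤ 1) :
    tv Ω (fun x => a * discStep z (k / r ^ 2) r x) ≤ ENNReal.ofReal (4 * C * Real.pi * r) := by
  have hk0 : 0 < k := by linarith
  refine iSup₂_le fun X hX => ENNReal.ofReal_le_ofReal ?_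
  have hms : MeasurableSet (Metric.closedBall z (r * Real.sqrt (1 + 1 / k)) \ Metric.ball z r) :=
    measurableSet_closedBall.diff measurableSet_ball
  have hfin : volume (Metric.closedBall z (r * Real.sqrt (1 + 1 / k)) \ Metric.ball z r) ≠ ∞ :=
    ne_top_of_le_ne_top measure_closedBall_lt_top.ne (measure_mono sdiff_subset)
  have hi : Integrable ((Metric.closedBall z (r * Real.sqrt (1 + 1 / k)) \
      Metric.ball z r).indicator (fun _ => 4 * C * k / r)) (volume : Measure Plane) :=
    (integrable_indicator_iff hms).2 (integrableOn_const hfin)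
  have hd := contDiff_discStep z (k / r ^ 2) r
  simp_rw [mul_assoc]
  rw [integral_const_mul, setIntegral_mul_divergence hX.2.2.1,
    integral_mul_divergence hd hX.1 hX.2.1]
  refine (le_abs_self _).trans ?_
  rw [abs_mul, abs_neg]
  refine (mul_le_of_le_one_left (abs_nonneg _) ha).trans ?_
  refine (norm_integral_le_of_norm_le
    (f := fun x => fderiv ℝ (discStep z (k / r ^ 2) r) x (X x)) hi
    (Eventually.of_forall fun x => ?_)).trans ?_
  · refine (ContinuousLinearMap.le_opNorm _ _).trans ?_
    exact (mul_le_of_le_one_right (norm_nonneg _) (hX.2.2.2 x)).trans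
      (norm_fderiv_discStep_le hC0 hC z hr hk x)
  · rw [integral_indicator_const _ hms, volume_annulus_le z hr hk, smul_eq_mul]
    apply le_of_eq
    field_simp

lemma tendsto_discStep (z : Plane) {r : ℝ} (hr : 0 < r) (x : Plane) :
    Tendsto (fun n : ℕ => discStep z (((n : ℝ) + 1) / r ^ 2) r x) atTop
      (𝓝 (if dist x z ≤ r then 1 else 0)) := by
  rw [dist_eq_norm]
  split_ifs with h
  · refine tendsto_const_nhds.congr fun n => (Real.smoothTransition.one_of_one_le ?_).symm
    have : ‖x - z‖ ^ 2 ≤ r ^ 2 := pow_le_pow_left₀ (norm_nonneg _) h 2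
    have h2 : 0 ≤ ((n : ℝ) + 1) / r ^ 2 := by positivity
    nlinarith
  · rw [not_le] at h
    have hlt : r ^ 2 < ‖x - z‖ ^ 2 := pow_lt_pow_left₀ h hr.le two_ne_zero
    obtain ⟨N, hN⟩ := exists_nat_gt (r ^ 2 / (‖x - z‖ ^ 2 - r ^ 2))
    refine tendsto_const_nhds.congr' ?_
    filter_upwards [eventually_ge_atTop N] with n hn
    refine (Real.smoothTransition.zero_of_nonpos ?_).symm
    have hn' : r ^ 2 / (‖x - z‖ ^ 2 - r ^ 2) < (n : ℝ) + 1 := by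
      have : (N : ℝ) ≤ n := by exact_mod_cast hn
      linarith
    rw [div_lt_iff₀ (by linarith)] at hn'
    have h1 : 1 < ((n : ℝ) + 1) * (‖x - z‖ ^ 2 - r ^ 2) / r ^ 2 := by
      rwa [one_lt_div (by positivity)]
    have e : ((n : ℝ) + 1) / r ^ 2 * (r ^ 2 - ‖x - z‖ ^ 2) =
      -(((n : ℝ) + 1) * (‖x - z‖ ^ 2 - r ^ 2) / r ^ 2) := by ring
    rw [e]
    linarith

/-- Only linear growth in the radius is needed, so the sharp constant of the perimeter is not
pursued. -/
lemma exists_tv_disc_le : ∃ C : ℝ, 0 ≤ C ∧ ∀ (Ω : Set Plane) (z : Plane) (r a : ℝ), 0 < r →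
    |a| ≤ 1 → tv Ω (fun x => a * if dist x z ≤ r then 1 else 0) ≤ ENNReal.ofReal (C * r) := by
  obtain ⟨C, hC0, hC⟩ := exists_deriv_smoothTransition_le
  refine ⟨4 * C * Real.pi, by positivity, fun Ω z r a hr ha => ?_⟩
  refine (tv_le_liminf_of_ae (C := 1) (v := fun (n : ℕ) x =>
    a * discStep z (((n : ℝ) + 1) / r ^ 2) r x) (fun n => ?_) (fun n => ?_) ?_).trans
    (liminf_le_of_frequently_le' (Eventually.of_forall fun n => ?_).frequently)
  · exact (continuous_const.mul (contDiff_discStep z _ r).continuous).aestronglyMeasurable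
  · refine Eventually.of_forall fun x => ?_
    rw [norm_mul]
    refine (mul_le_of_le_one_left (norm_nonneg _) ha).trans ?_
    rw [discStep, Real.norm_of_nonneg (Real.smoothTransition.nonneg _)]
    exact Real.smoothTransition.le_one _
  · exact Eventually.of_forall fun x => (tendsto_discStep z hr x).const_mul a
  · exact tv_discStep_le hC0 hC Ω z hr (by linarith [n.cast_nonneg (α := ℝ)]) ha

/-! ### A function of bounded variation with a given sequence of values -/

/-- The index of the exponential annulus around `z` that contains `x`. -/
def ringIndex (z : Plane) (ρ : ℝ) (x : Plane) : ℕ := ⌊Real.log (ρ / dist x z)⌋₊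

lemma measurable_ringIndex (z : Plane) (ρ : ℝ) : Measurable (ringIndex z ρ) :=
  Nat.measurable_floor.comp (Real.measurable_log.comp
    (measurable_const.div (measurable_id.dist measurable_const)))

/-- Superlevel sets of the index are discs, so functions of the index telescope into disc
indicators. The centre is excluded because `ρ / 0 = 0` and `log 0 = 0` give it index `0`. -/
lemma lt_ringIndex_iff {z : Plane} {ρ : ℝ} (hρ : 0 < ρ) {x : Plane} (hx : x ≠ z) (k : ℕ) :
    k < ringIndex z ρ x ↔ dist x z ≤ ρ * Real.exp (-((k : ℝ) + 1)) := by
  have hd : 0 < dist x z := dist_pos.2 hx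
  rw [ringIndex, ← Nat.succ_le_iff, Nat.le_floor_iff' (Nat.succ_ne_zero k),
    Real.le_log_iff_exp_le (by positivity), le_div_iff₀ hd, Real.exp_neg, ← div_eq_mul_inv,
    le_div_iff₀ (Real.exp_pos _), mul_comm]
  push_cast
  rfl

lemma measure_ringIndex_pos {Ω : Set Plane} {z : Plane} {ρ : ℝ} (hρ : 0 < ρ)
    (hsub : Metric.closedBall z ρ ⊆ Ω) (k : ℕ) :
    0 < (volume.restrict Ω) {x | ringIndex z ρ x = k} := by
  have he : Real.exp (-((k : ℝ) + 1)) < Real.exp (-(k : ℝ)) := Real.exp_lt_exp.2 (by linarith)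
  have hle : Real.exp (-(k : ℝ)) ≤ 1 := Real.exp_le_one_iff.2 (by simp)
  let O : Set Plane := {x | ρ * Real.exp (-((k : ℝ) + 1)) < dist x z ∧
    dist x z < ρ * Real.exp (-(k : ℝ))}
  have hO : IsOpen O := (isOpen_lt continuous_const (continuous_id.dist continuous_const)).inter
    (isOpen_lt (continuous_id.dist continuous_const) continuous_const)
  have hne : O.Nonempty := by
    obtain ⟨s, hs1, hs2⟩ := exists_between (mul_lt_mul_of_pos_left he hρ)
    have hs : 0 < s := lt_trans (by positivity) hs1
    refine ⟨z + s • EuclideanSpace.single 0 1, ?_⟩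
    have : dist (z + s • EuclideanSpace.single 0 (1 : ℝ)) z = s := by
      rw [dist_eq_norm, add_sub_cancel_left, norm_smul, Real.norm_of_nonneg hs.le]
      simp
    exact ⟨by rw [this]; exact hs1, by rw [this]; exact hs2⟩
  have hOΩ : O ⊆ Ω := fun x hx => hsub <| by
    rw [Metric.mem_closedBall]
    nlinarith [hx.2]
  change 0 < (volume.restrict Ω) (ringIndex z ρ ⁻¹' {k})
  rw [Measure.restrict_apply (measurable_ringIndex z ρ (measurableSet_singleton k))]
  refine (hO.measure_pos volume hne).trans_le (measure_mono fun x hx => ⟨?_, hOΩ hx⟩)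
  have hxz : x ≠ z := by
    rintro rfl
    have h1 := hx.1
    rw [dist_self] at h1
    exact absurd h1 (not_lt.2 (by positivity))
  refine le_antisymm (not_lt.1 fun h => ?_) ?_
  · exact hx.1.not_ge ((lt_ringIndex_iff hρ hxz k).1 h)
  · rcases k with _ | k
    · exact Nat.zero_le _
    · refine Nat.succ_le_of_lt ((lt_ringIndex_iff hρ hxz k).2 ?_)
      have := hx.2.le
      push_cast at this
      exact this

/-- Raising the truncation of the index from `K` to `K + 1` adds a disc of radius `ρ e^{-(K+1)}`
with a jump of size at most `1`. The perimeters are summable for every choice of values `g`, and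
lower semicontinuity removes the truncation. -/
lemma tv_ringIndex_lt_top (Ω : Set Plane) (z : Plane) {ρ : ℝ} (hρ : 0 < ρ) (g : ℕ → Gray) :
    tv Ω (fun x => (g (ringIndex z ρ x) : ℝ)) < ∞ := by
  obtain ⟨C, hC0, hC⟩ := exists_tv_disc_le
  have hmeas : ∀ K, Measurable fun x => (g (min (ringIndex z ρ x) K) : ℝ) := fun K =>
    (measurable_from_nat (f := fun n => (g (min n K) : ℝ))).comp (measurable_ringIndex z ρ)
  have hb : ∀ y : Gray, ‖(y : ℝ)‖ ≤ 1 := fun y => by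
    rw [Real.norm_of_nonneg y.2.1]; exact y.2.2
  have hstep : ∀ K : ℕ, tv Ω (fun x => (g (min (ringIndex z ρ x) K) : ℝ)) ≤
      ∑ k ∈ Finset.range K, ENNReal.ofReal (C * (ρ * Real.exp (-((k : ℝ) + 1)))) := fun K => by
    induction K with
    | zero => simp [tv_const]
    | succ K ih =>
      rw [Finset.sum_range_succ]
      have ha : |(g (K + 1) : ℝ) - g K| ≤ 1 := by
        rw [abs_le]
        constructor <;> linarith [(g (K + 1)).2.1, (g (K + 1)).2.2, (g K).2.1, (g K).2.2]
      have hz : ∀ᵐ x ∂volume.restrict Ω, x ≠ z := ae_restrict_of_ae <| by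
        rw [ae_iff]; simp
      have heq : tv Ω (fun x => (g (min (ringIndex z ρ x) (K + 1)) : ℝ)) =
          tv Ω fun x => 1 * (g (min (ringIndex z ρ x) K) : ℝ) + 1 * (((g (K + 1) : ℝ) - g K) *
            if dist x z ≤ ρ * Real.exp (-((K : ℝ) + 1)) then 1 else 0) := by
        refine tv_congr ?_
        filter_upwards [hz] with x hx
        simp_rw [← lt_ringIndex_iff hρ hx]
        split_ifs with h
        · rw [min_eq_right (Nat.succ_le_of_lt h), min_eq_right h.le]
          ring
        · rw [not_lt] at h
          rw [min_eq_left h, min_eq_left (h.trans (Nat.le_succ K))]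
          ring
      rw [heq]
      refine (tv_add_le (C := 1) (hmeas K).aestronglyMeasurable
        (Eventually.of_forall fun x => hb _) ?_ (Eventually.of_forall fun x => ?_) zero_le_one
        zero_le_one).trans ?_
      · refine (measurable_const.mul (Measurable.ite ?_ measurable_const
          measurable_const)).aestronglyMeasurable
        exact measurableSet_le (measurable_id.dist measurable_const) measurable_const
      · split_ifs
        · simpa using ha
        · simp
      · rw [ENNReal.ofReal_one, one_mul, one_mul]
        exact add_le_add ih (hC Ω z _ _ (by positivity) ha)
  have hsum : Summable fun k : ℕ => C * (ρ * Real.exp (-((k : ℝ) + 1))) := by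
    have h1 : Summable fun k : ℕ => Real.exp (-(k : ℝ)) := Real.summable_exp_neg_nat
    refine (h1.mul_left (C * ρ * Real.exp (-1))).congr fun k => ?_
    rw [show -((k : ℝ) + 1) = -1 + -(k : ℝ) by ring, Real.exp_add]
    ring
  have hle : ∀ K : ℕ, tv Ω (fun x => (g (min (ringIndex z ρ x) K) : ℝ)) ≤
      ENNReal.ofReal (∑' k : ℕ, C * (ρ * Real.exp (-((k : ℝ) + 1)))) := fun K => by
    refine (hstep K).trans ?_
    rw [← ENNReal.ofReal_sum_of_nonneg fun k _ => by positivity]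
    exact ENNReal.ofReal_le_ofReal (hsum.sum_le_tsum _ fun k _ => by positivity)
  refine lt_of_le_of_lt (tv_le_liminf_of_ae (C := 1) (fun K => (hmeas K).aestronglyMeasurable)
    (fun K => Eventually.of_forall fun x => hb _) (Eventually.of_forall fun x => ?_))
    (lt_of_le_of_lt (liminf_le_of_frequently_le' (Eventually.of_forall hle).frequently)
      ENNReal.ofReal_lt_top)
  refine tendsto_const_nhds.congr' ?_
  filter_upwards [eventually_ge_atTop (ringIndex z ρ x)] with K hK
  rw [min_eq_left hK]

/-- A potential unbounded below is never harmless: membership in `D` requires integrability for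
Lebesgue measure only, and some function of bounded variation has a histogram that makes the
negative part infinite. -/
lemma exists_bvGray_lintegral_eq_top {Ω : Set Plane} (hΩo : IsOpen Ω) (hΩ : Bornology.IsBounded Ω)
    (hne : Ω.Nonempty) {ψ : Gray → ℝ} (hψ : ∀ M : ℝ, ∃ γ, ψ γ < -M) :
    ∃ v ∈ bvGray Ω, Measurable v ∧ ∫⁻ x in Ω, ENNReal.ofReal (-ψ (v x)) = ∞ := by
  have hfin := isFiniteMeasure_restrict hΩ
  obtain ⟨z, hz⟩ := hne
  obtain ⟨ρ, hρ, hsub⟩ := Metric.nhds_basis_closedBall.mem_iff.1 (hΩo.mem_nhds hz)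
  -- On the `k`-th ring the value is chosen so that `-ψ` exceeds the reciprocal of the area. Each
  -- ring then contributes at least `1`.
  choose g hg using fun k : ℕ => hψ ((volume.restrict Ω).real {x | ringIndex z ρ x = k})⁻¹
  have hm : Measurable fun x => g (ringIndex z ρ x) :=
    measurable_from_nat.comp (measurable_ringIndex z ρ)
  refine ⟨fun x => g (ringIndex z ρ x), ⟨hm.aemeasurable, tv_ringIndex_lt_top Ω z hρ g⟩, hm, ?_⟩
  have e : ∫⁻ x in Ω, ENNReal.ofReal (-ψ (g (ringIndex z ρ x))) =
      ∫⁻ k, ENNReal.ofReal (-ψ (g k)) ∂((volume.restrict Ω).map (ringIndex z ρ)) :=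
    (lintegral_map (μ := volume.restrict Ω) (f := fun k => ENNReal.ofReal (-ψ (g k)))
      measurable_from_nat (measurable_ringIndex z ρ)).symm
  rw [e, lintegral_countable', eq_top_iff,
    ← ENNReal.tsum_const_eq_top_of_ne_zero (α := ℕ) one_ne_zero]
  refine ENNReal.tsum_le_tsum fun k => ?_
  rw [Measure.map_apply (measurable_ringIndex z ρ) (measurableSet_singleton k)]
  have hpos := measure_ringIndex_pos hρ hsub k
  have hpre : ringIndex z ρ ⁻¹' {k} = {x | ringIndex z ρ x = k} := rfl
  rw [hpre, ← ofReal_measureReal, ← ENNReal.ofReal_mul' measureReal_nonneg]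
  have hposr : 0 < (volume.restrict Ω).real {x | ringIndex z ρ x = k} :=
    ENNReal.toReal_pos hpos.ne' (measure_ne_top _ _)
  rw [← ENNReal.ofReal_one]
  refine ENNReal.ofReal_le_ofReal ?_
  rw [← inv_mul_cancel₀ hposr.ne']
  exact mul_le_mul_of_nonneg_right (by linarith [hg k]) hposr.le

/-! ### Exactness of the relaxation -/

lemma measurable_tv_superlevel_slice (Ω : Set Plane) {φ : Plane × ℝ → ℝ} (h : Measurable φ) :
    Measurable fun r : ℝ × ℝ => tv Ω (superlevel (fun x => φ (x, r.2)) r.1) := by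
  refine measurable_tv Ω (w := fun r : Plane × ℝ × ℝ => if r.2.1 < φ (r.1, r.2.2) then (1 : ℝ) else 0)
    (C := 1) ?_ fun r => ?_
  · exact Measurable.ite (measurableSet_lt (measurable_fst.comp measurable_snd)
      (h.comp (measurable_fst.prodMk (measurable_snd.comp measurable_snd))))
      measurable_const measurable_const
  · split_ifs <;> simp

/-- The relation `t < φ(x, s) ↔ s < U(x, t)` exchanges the roles of height and level. Fubini turns
it into equality of superlevel sets for almost every `s`, and the easy half of the coarea formula
does the rest. -/
lemma tv_layer_le {Ω : Set Plane} {φ : Plane × ℝ → ℝ} (h : Measurable φ) {U : Plane × ℝ → Gray}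
    (hU : Measurable U) (hl : IsLayered Ω φ U) {t : ℝ} (ht : t ∈ Ico (0 : ℝ) 1) :
    tv Ω (fun x => (U (x, t) : ℝ)) ≤
      ∫⁻ s in Icc (0 : ℝ) 1, tv Ω (superlevel (fun x => φ (x, s)) t) := by
  have hUt : Measurable fun x => (U (x, t) : ℝ) :=
    measurable_subtype_coe.comp (hU.comp measurable_prodMk_right)
  have hswap : ∀ᵐ s : ℝ, ∀ᵐ x ∂volume.restrict Ω, t < φ (x, s) ↔ s < U (x, t) := by
    have m1 : MeasurableSet {r : Plane × ℝ | t < φ (r.1, r.2)} :=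
      measurableSet_lt measurable_const h
    have m2 : MeasurableSet {r : Plane × ℝ | r.2 < (U (r.1, t) : ℝ)} :=
      measurableSet_lt measurable_snd (hUt.comp measurable_fst)
    refine (Measure.ae_ae_comm (p := fun x s => t < φ (x, s) ↔ s < U (x, t)) (m1.iff m2)).1 ?_
    filter_upwards [hl] with x hx
    exact hx t ht
  refine (tv_le_lintegral_superlevel hUt fun x => (U (x, t)).2).trans_eq ?_
  refine lintegral_congr_ae (ae_restrict_of_ae ?_)
  filter_upwards [hswap] with s hs
  refine tv_congr ?_
  filter_upwards [hs] with x hx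
  simp only [superlevel, hx]

/-- The coarea inequality for the layers of a lifted function. -/
lemma lintegral_tv_layers_le {Ω : Set Plane} (hΩo : IsOpen Ω) (hΩ : Bornology.IsBounded Ω)
    {φ : Plane × ℝ → ℝ} (h : IsLift φ) {U : Plane × ℝ → Gray} (hU : Measurable U)
    (hl : IsLayered Ω φ U) :
    ∫⁻ t in Icc (0 : ℝ) 1, tv Ω (fun x => (U (x, t) : ℝ)) ≤ sliceTV Ω φ := by
  have hw := measurable_tv_superlevel_slice Ω h.measurable
  calc ∫⁻ t in Icc (0 : ℝ) 1, tv Ω (fun x => (U (x, t) : ℝ))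
      ≤ ∫⁻ t in Icc (0 : ℝ) 1, ∫⁻ s in Icc (0 : ℝ) 1, tv Ω (superlevel (fun x => φ (x, s)) t) := by
        refine lintegral_mono_ae ?_
        filter_upwards [ae_mem_Ico] with t ht
        exact tv_layer_le h.measurable hU hl ht
    _ = ∫⁻ s in Icc (0 : ℝ) 1, ∫⁻ t in Icc (0 : ℝ) 1, tv Ω (superlevel (fun x => φ (x, s)) t) :=
        lintegral_lintegral_swap hw.aemeasurable
    _ ≤ sliceTV Ω φ := lintegral_mono fun s => lintegral_tv_superlevel_le hΩo hΩ
        (h.measurable.comp measurable_prodMk_right) fun x => h.norm_le (x, s)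

/-- Some layer of a lifted function has an energy that is at most the lifted one. -/
lemma exists_layer_energyDual_le {Ω : Set Plane} (hΩo : IsOpen Ω) (hΩ : Bornology.IsBounded Ω)
    (hne : Ω.Nonempty) {f : Gray → Plane → ℝ}
    (hf : ContinuousOn (fun q : Gray × Plane => f q.1 q.2) (univ ×ˢ Ω)) {M : ℝ}
    (hM : ∀ γ, ∀ x ∈ Ω, |f γ x| ≤ M) {lam : ℝ} (hlam : 0 < lam) (ν : ℝ)
    (μ₀ : Measure Gray) {φ : Plane × ℝ → ℝ} (hφ : φ ∈ liftSet Ω) (hs : sliceTV Ω φ ≠ ∞)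
    {p : (Gray → ℝ) × (Gray → ℝ)} (hp : Measurable p.1) (h1 : Integrable p.1 (liftHist Ω φ))
    (h2 : Integrable p.2 μ₀) :
    ∃ v ∈ bvGray Ω, energyDual Ω f lam ν μ₀ v p ≤ liftEnergy Ω f lam ν μ₀ φ p := by
  have hfin := isFiniteMeasure_restrict hΩ
  have hfinl := isFiniteMeasure_layerMeasure hΩ
  have hprob : IsProbabilityMeasure (volume.restrict (Icc (0 : ℝ) 1)) := ⟨by simp⟩
  obtain ⟨φ', hl, he, -, hlay, hm⟩ := exists_layers hΩo hΩ hφ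
  obtain ⟨U, hUq⟩ : ∃ U, U = quantile φ' := ⟨_, rfl⟩
  have hU : Measurable U := hUq ▸ measurable_quantile hl.measurable
  rw [← hUq] at hlay hm
  have hUt : ∀ t, Measurable fun x => U (x, t) := fun t => hU.comp measurable_prodMk_right
  have hv0 : (volume Ω)⁻¹ ≠ 0 := ENNReal.inv_ne_zero.2 hΩ.measure_lt_top.ne
  have hv1 : (volume Ω)⁻¹ ≠ ∞ := ENNReal.inv_ne_top.2 (hΩo.measure_pos volume hne).ne'
  have if2 : Integrable (fun q => f (U q) q.1) (layerMeasure Ω) :=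
    integrable_data_comp hΩo hf hM measurable_fst (ae_fst_mem_layerMeasure hΩo) hU
  have iψ : Integrable (fun q => p.1 (U q)) (layerMeasure Ω) := by
    rw [liftHist_eq hΩo hU hm, integrable_smul_measure hv0 hv1] at h1
    exact h1.comp_measurable hU
  have hiψ : ∀ᵐ t ∂volume.restrict (Icc (0 : ℝ) 1),
      Integrable (fun x => p.1 (U (x, t))) (volume.restrict Ω) := iψ.prod_left_ae
  have hBm : Measurable fun t => tv Ω fun x => (U (x, t) : ℝ) :=
    measurable_tv Ω (w := fun q => (U q : ℝ)) (measurable_subtype_coe.comp hU) (C := 1) fun q => by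
      rw [Real.norm_of_nonneg (U q).2.1]; exact (U q).2.2
  have hBle : ∫⁻ t in Icc (0 : ℝ) 1, tv Ω (fun x => (U (x, t) : ℝ)) ≤ sliceTV Ω φ := by
    rw [sliceTV_congr he]
    exact lintegral_tv_layers_le hΩo hΩ hl hU hlay
  have hBtop := ne_top_of_le_ne_top hs hBle
  have hBae := ae_lt_top hBm hBtop
  have iB : Integrable (fun t => (tv Ω fun x => (U (x, t) : ℝ)).toReal)
      (volume.restrict (Icc (0 : ℝ) 1)) := integrable_toReal_of_lintegral_ne_top hBm.aemeasurable hBtop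
  obtain ⟨a, ha⟩ : ∃ a, a = ((volume Ω)⁻¹).toReal := ⟨_, rfl⟩
  -- The energy of the layer at level `t`. Its mean over `[0,1]` is the lifted energy with the
  -- averaged variation of the layers in place of the sliced variation of `φ`, hence no larger.
  let H : ℝ → ℝ := fun t => (∫ x in Ω, f (U (x, t)) x) +
    ν * (a * (∫ x in Ω, p.1 (U (x, t))) - ∫ γ, p.2 γ ∂μ₀) +
    lam * (tv Ω fun x => (U (x, t) : ℝ)).toReal
  have i1 : Integrable (fun t => ∫ x in Ω, f (U (x, t)) x) (volume.restrict (Icc (0 : ℝ) 1)) :=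
    if2.integral_prod_right
  have i2 : Integrable (fun t => ∫ x in Ω, p.1 (U (x, t))) (volume.restrict (Icc (0 : ℝ) 1)) :=
    iψ.integral_prod_right
  have i3 : Integrable (fun t => ν * (a * (∫ x in Ω, p.1 (U (x, t))) - ∫ γ, p.2 γ ∂μ₀))
      (volume.restrict (Icc (0 : ℝ) 1)) := ((i2.const_mul a).sub (integrable_const _)).const_mul ν
  have i4 : Integrable (fun t => (∫ x in Ω, f (U (x, t)) x) +
      ν * (a * (∫ x in Ω, p.1 (U (x, t))) - ∫ γ, p.2 γ ∂μ₀))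
      (volume.restrict (Icc (0 : ℝ) 1)) := i1.add i3
  have iH : Integrable H (volume.restrict (Icc (0 : ℝ) 1)) := i4.add (iB.const_mul lam)
  have eH : ∫ t in Icc (0 : ℝ) 1, H t = (∫ q, f (U q) q.1 ∂layerMeasure Ω) +
      ν * (a * (∫ q, p.1 (U q) ∂layerMeasure Ω) - ∫ γ, p.2 γ ∂μ₀) +
      lam * (∫⁻ t in Icc (0 : ℝ) 1, tv Ω fun x => (U (x, t) : ℝ)).toReal := by
    have e1 : ∫ t in Icc (0 : ℝ) 1, ∫ x in Ω, f (U (x, t)) x =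
        ∫ q, f (U q) q.1 ∂layerMeasure Ω := (integral_prod_symm _ if2).symm
    have e2 : ∫ t in Icc (0 : ℝ) 1, ∫ x in Ω, p.1 (U (x, t)) =
        ∫ q, p.1 (U q) ∂layerMeasure Ω := (integral_prod_symm _ iψ).symm
    simp only [H]
    rw [integral_add i4 (iB.const_mul lam), integral_add i1 i3, integral_const_mul,
      integral_const_mul, integral_sub (i2.const_mul a) (integrable_const _), integral_const_mul,
      e1, e2, integral_const, probReal_univ, one_smul,
      integral_toReal hBm.aemeasurable hBae]
  -- A level with energy at most the mean can be chosen outside the null set where `H` fails to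
  -- represent the energy.
  obtain ⟨t, htN, hHt⟩ := exists_notMem_null_le_integral iH (hiψ.and hBae)
  rw [mem_compl_iff, not_not] at htN
  obtain ⟨hψt, hBt⟩ := htN
  refine ⟨fun x => U (x, t), ⟨(hUt t).aemeasurable, hBt⟩, ?_⟩
  have hψh : Integrable p.1 (hist Ω fun x => U (x, t)) := by
    rw [hist, integrable_smul_measure hv0 hv1,
      integrable_map_measure hp.aestronglyMeasurable (hUt t).aemeasurable]
    exact hψt
  rw [energyDual, liftEnergy, dualValue_eq_coe hψh h2, dualValue_eq_coe h1 h2,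
    grayDeriv_eq hΩo hU hm, integral_data_map hΩo hf hM measurable_fst
      (ae_fst_mem_layerMeasure hΩo) hU, liftHist_eq hΩo hU hm, hist, integral_smul_measure,
    integral_smul_measure, integral_map (hUt t).aemeasurable hp.aestronglyMeasurable,
    integral_map hU.aemeasurable hp.aestronglyMeasurable, ← ha, smul_eq_mul, smul_eq_mul]
  change _ ≤ _ + (lam : EReal) * (sliceTV Ω φ : EReal) + _
  rw [← EReal.coe_ennreal_toReal hBt.ne, ← EReal.coe_ennreal_toReal hs]
  norm_cast
  have hle := mul_le_mul_of_nonneg_left (ENNReal.toReal_mono hs hBle) hlam.le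
  rw [eH] at hHt
  simp only [H] at hHt
  linarith

lemma energyDual_eq_bot (Ω : Set Plane) (f : Gray → Plane → ℝ) (lam : ℝ) {ν : ℝ} (hν : 0 < ν)
    (μ₀ : Measure Gray) (v : Plane → Gray) {p : (Gray → ℝ) × (Gray → ℝ)}
    (h : (∫⁻ γ, ENNReal.ofReal (-p.1 γ) ∂hist Ω v) + ∫⁻ γ, ENNReal.ofReal (p.2 γ) ∂μ₀ = ∞) :
    energyDual Ω f lam ν μ₀ v p = ⊥ := by
  rw [energyDual, dualValue, h, EReal.coe_ennreal_top, EReal.sub_top, EReal.coe_mul_bot_of_pos hν,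
    EReal.add_bot]

lemma integrable_of_lintegral_parts {α : Type*} [MeasurableSpace α] {μ : Measure α} {g : α → ℝ}
    (hg : Measurable g) (h1 : ∫⁻ a, ENNReal.ofReal (g a) ∂μ ≠ ∞)
    (h2 : ∫⁻ a, ENNReal.ofReal (-g a) ∂μ ≠ ∞) : Integrable g μ := by
  refine ⟨hg.aestronglyMeasurable, ?_⟩
  refine lt_of_le_of_lt (lintegral_mono (g := fun a => ENNReal.ofReal (g a) +
    ENNReal.ofReal (-g a)) fun a => ?_) ?_
  · rw [Real.enorm_eq_ofReal_abs]
    rcases abs_cases (g a) with h | h <;> rw [h.1]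
    · exact le_self_add
    · exact le_add_self
  · rw [lintegral_add_left hg.ennreal_ofReal]
    exact ENNReal.add_lt_top.2 ⟨h1.lt_top, h2.lt_top⟩

/-- The layer argument needs integrable potentials. Where integrability fails, either the infimum on
the left is `-∞` or the right side is `∞`. -/
theorem iInf_energyDual_le_relaxedEnergy {Ω : Set Plane} (hΩo : IsOpen Ω)
    (hΩ : Bornology.IsBounded Ω) (hne : Ω.Nonempty) {f : Gray → Plane → ℝ}
    (hf : ContinuousOn (fun q : Gray × Plane => f q.1 q.2) (univ ×ˢ Ω)) {M : ℝ}
    (hM : ∀ γ, ∀ x ∈ Ω, |f γ x| ≤ M) {lam ν : ℝ} (hlam : 0 < lam) (hν : 0 < ν)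
    {c : Gray → Gray → ℝ} (hc : LowerSemicontinuous (fun p : Gray × Gray => c p.1 p.2))
    (μ₀ : Measure Gray) [IsProbabilityMeasure μ₀] {p : (Gray → ℝ) × (Gray → ℝ)}
    (hp : p ∈ dualSet c) {φ : Plane × ℝ → ℝ} (hφ : φ ∈ liftSet Ω) :
    ⨅ v ∈ bvGray Ω, energyDual Ω f lam ν μ₀ v p ≤ relaxedEnergy Ω f lam ν c μ₀ φ := by
  by_cases hR : relaxedEnergy Ω f lam ν c μ₀ φ = ⊤
  · rw [hR]; exact le_top
  by_cases hP : ∫⁻ γ, ENNReal.ofReal (p.2 γ) ∂μ₀ = ∞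
  · refine iInf₂_le_of_le _ (const_mem_bvGray Ω 0) ?_
    rw [energyDual_eq_bot Ω f lam hν μ₀ _ (by rw [hP, add_top])]
    exact bot_le
  by_cases hb : ∀ K : ℝ, ∃ γ, p.1 γ < -K
  · obtain ⟨v, hv, hvm, hv1⟩ := exists_bvGray_lintegral_eq_top hΩo hΩ hne hb
    refine iInf₂_le_of_le v hv ?_
    rw [energyDual_eq_bot Ω f lam hν μ₀ _ ?_]
    · exact bot_le
    have hmn : Measurable fun γ => ENNReal.ofReal (-p.1 γ) := hp.1.neg.ennreal_ofReal
    rw [hist, lintegral_smul_measure, lintegral_map hmn hvm, hv1, smul_eq_mul,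
      ENNReal.mul_top (ENNReal.inv_ne_zero.2 hΩ.measure_lt_top.ne), top_add]
  push Not at hb
  obtain ⟨K, hK⟩ := hb
  have hprob := isProbabilityMeasure_liftHist hΩo hΩ hne hφ
  obtain ⟨m, hm⟩ := exists_lower_bound hc
  have hT := coe_le_transportCost hc hm (liftHist Ω φ) μ₀
  have hR' := hR
  rw [relaxedEnergy_eq hΩo hΩ hne f hlam hν hc μ₀ hφ] at hR'
  have hs := ne_top_of_add_mul_ne_top hlam hν hT hR'
  have hTtop : transportCost c (liftHist Ω φ) μ₀ ≠ ⊤ := by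
    intro h
    refine hR' ?_
    rw [h, EReal.coe_mul_top_of_pos hν, ← EReal.coe_ennreal_toReal hs, ← EReal.coe_mul,
      ← EReal.coe_add, EReal.coe_add_top]
  have hN : ∫⁻ γ, ENNReal.ofReal (-p.1 γ) ∂liftHist Ω φ ≠ ∞ := by
    refine ne_top_of_le_ne_top (ENNReal.ofReal_ne_top (r := K)) ?_
    calc _ ≤ ∫⁻ _, ENNReal.ofReal K ∂liftHist Ω φ :=
          lintegral_mono fun γ => ENNReal.ofReal_le_ofReal (by linarith [hK γ])
      _ = _ := by simp
  -- An infinite positive part against finite negative parts would make the dual value, and by weak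
  -- duality the transport cost, infinite.
  have hPP : (∫⁻ γ, ENNReal.ofReal (p.1 γ) ∂liftHist Ω φ) +
      ∫⁻ γ, ENNReal.ofReal (-p.2 γ) ∂μ₀ ≠ ∞ := by
    intro h
    refine hTtop (eq_top_iff.2 (le_of_eq_of_le ?_
      (dualValue_le_transportCost hc (μ := liftHist Ω φ) (μ' := μ₀) hp)))
    rw [dualValue, h, ← EReal.coe_ennreal_toReal (ENNReal.add_ne_top.2 ⟨hN, hP⟩),
      EReal.coe_ennreal_top, EReal.top_sub_coe]
  obtain ⟨hP1, hP2⟩ := ENNReal.add_ne_top.1 hPP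
  obtain ⟨v, hv, hle⟩ := exists_layer_energyDual_le hΩo hΩ hne hf hM hlam ν μ₀ hφ hs hp.1
    (integrable_of_lintegral_parts hp.1 hP1 hN) (integrable_of_lintegral_parts hp.2.1 hP hP2)
  exact (iInf₂_le v hv).trans (hle.trans (le_iSup₂_of_le p hp le_rfl))

end HistogramTV

end

/-! ### The relaxation theorem -/

theorem mainTheorem2
    (Ω : Set Plane) (hΩo : IsOpen Ω) (hΩb : Bornology.IsBounded Ω) (hΩne : Ω.Nonempty)
    (f : Gray → Plane → ℝ)
    (hf : ContinuousOn (fun q : Gray × Plane => f q.1 q.2) (Set.univ ×ˢ Ω))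
    (hfb : ∃ M : ℝ, ∀ γ, ∀ x ∈ Ω, |f γ x| ≤ M)
    (lam ν : ℝ) (hlam : 0 < lam) (hν : 0 < ν)
    (c : Gray → Gray → ℝ) (hc : LowerSemicontinuous (fun p : Gray × Gray => c p.1 p.2))
    (μ₀ : Measure Gray) [IsProbabilityMeasure μ₀] :
    -- `E'` is convex in `φ` and concave in `(ψ, ψ')`
    (∀ p ∈ dualSet c, EConvexOn (liftSet Ω) (fun φ => liftEnergy Ω f lam ν μ₀ φ p)) ∧
    (∀ φ ∈ liftSet Ω, EConcaveOn (dualSet c) (fun p => liftEnergy Ω f lam ν μ₀ φ p)) ∧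
    -- both minima are attained, at `u` and `φ`, and the second one is a lower bound
    ∃ u ∈ bvGray Ω, ∃ φ ∈ liftSet Ω,
      IsMinOn (energy Ω f lam ν c μ₀) (bvGray Ω) u ∧
      IsMinOn (relaxedEnergy Ω f lam ν c μ₀) (liftSet Ω) φ ∧
      relaxedEnergy Ω f lam ν c μ₀ φ ≤ energy Ω f lam ν c μ₀ u ∧
      -- exactness if minimum and maximum can be interchanged in the original problem
      ((⨅ v ∈ bvGray Ω, ⨆ p ∈ dualSet c, energyDual Ω f lam ν μ₀ v p) =
          (⨆ p ∈ dualSet c, ⨅ v ∈ bvGray Ω, energyDual Ω f lam ν μ₀ v p) →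
        relaxedEnergy Ω f lam ν c μ₀ φ = energy Ω f lam ν c μ₀ u) := by
  obtain ⟨M, hM⟩ := hfb
  obtain ⟨u, hu, humin⟩ := exists_isMinOn_energy hΩo hΩb hΩne hf hM hlam hν hc μ₀
  obtain ⟨φ, hφ, hφmin⟩ := exists_isMinOn_relaxedEnergy hΩo hΩb hΩne hf hM hlam hν hc μ₀
  have hle : relaxedEnergy Ω f lam ν c μ₀ φ ≤ energy Ω f lam ν c μ₀ u := by
    obtain ⟨v, hvm, hv, huv⟩ := exists_measurable_of_mem hu
    rw [energy_congr huv]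
    exact (hφmin (subgraph_mem_liftSet hΩo hΩb hvm hv)).trans
      (relaxedEnergy_subgraph_le hΩo hΩb hΩne hf hM hlam hν hc μ₀ hvm hv)
  refine ⟨fun p _ => econvexOn_liftEnergy hΩo hΩb hf hM hlam.le hν.le μ₀ p,
    fun φ _ => econcaveOn_liftEnergy Ω f lam hν.le c μ₀ φ, u, hu, φ, hφ, humin, hφmin, hle,
    fun hmm => le_antisymm hle ?_⟩
  -- Duality writes the minimum as an infimum of suprema, the hypothesis exchanges them, and the
  -- layer argument bounds each inner infimum by the relaxed energy.
  calc energy Ω f lam ν c μ₀ u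
      ≤ ⨅ v ∈ bvGray Ω, ⨆ p ∈ dualSet c, energyDual Ω f lam ν μ₀ v p :=
        le_iInf₂ fun v hv => (humin hv).trans_eq (energy_eq_iSup hΩo hΩb hΩne f hlam hν hc μ₀
          (contDual_subset c) le_rfl hv.1)
    _ = ⨆ p ∈ dualSet c, ⨅ v ∈ bvGray Ω, energyDual Ω f lam ν μ₀ v p := hmm
    _ ≤ relaxedEnergy Ω f lam ν c μ₀ φ := iSup₂_le fun p hp =>
        iInf_energyDual_le_relaxedEnergy hΩo hΩb hΩne hf hM hlam hν hc μ₀ hp hφ
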